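/- Let $X=(M,j)$ be a (Hausdorff, finite-dimensional) complex manifold and let $E\to X$ be a holomorphic vector bundle, i.e. a smooth complex vector bundle $E\to M$ of finite rank with a flat $T^{0,1}X$-connection $\overline\partial$. Let $D_{\mathbb R}E$ be the real gauge algebroid of $E$ (its sections are the $\mathbb R$-linear derivations $\Delta$ of $\Gamma(E)$, with $\Delta(fe)=\sigma(\Delta)(f)e+f\Delta e$ for a symbol $\sigma(\Delta)\in\mathfrak X(M)$; the bracket is the commutator and the anchor is $\sigma$), and let $DE\subset D_{\mathbb R}E$ be the subbundle of $\mathbb C$-linear derivations, with the complex structure $j_{DE}\Delta=i\,(\Delta-2\overline\partial_{\sigma(\Delta)^{0,1}})$, whose symbol is $j\sigma(\Delta)$. Let $D_{\mathbb C}E$ be the complex gauge algebroid (its sections are the $\mathbb C$-linear operators $\Delta$ on $\Gamma(E)$ with $\Delta(fe)=\sigma(\Delta)(f)e+f\Delta e$ for $f\in C^\infty(M,\mathbb C)$ and a complex vector field $\sigma(\Delta)$), let $D^{1,0}E=\sigma^{-1}(T^{1,0}X)\subset D_{\mathbb C}E$, and let $\Delta\mapsto\Delta^{1,0}$ be the projection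 $D_{\mathbb C}E\to D^{1,0}E$, $\Delta^{1,0}=\Delta-\overline\partial_{\sigma(\Delta)^{0,1}}$. (In rank $0$, where $\Delta$ does not determine its symbol, elements of these bundles are understood as pairs of an operator and a symbol.) The formula $\overline\partial{}^{DE}_\xi\Delta=[\overline\partial_\xi,\Delta]^{1,0}$ defines a flat $T^{0,1}X$-connection on the complex vector bundle $D^{1,0}E$, which makes it a holomorphic vector bundle, and $D^{1,0}E$ is a complex Lie algebroid with anchor $\sigma$ and the commutator bracket. Lemma. The formula $$\iota\Delta=\Delta+\overline\partial_{\overline{\sigma(\Delta)}}$$ defines an isomorphism of complex vector bundles $\iota:D^{1,0}E\to DE$ such that (1) $\sigma(\iota\Delta)=2\operatorname{Re}\sigma(\Delta)$ for all $\Delta\in D^{1,0}E$; (2) $\iota[\Delta_1,\Delta_2]=[\iota\Delta_1,\iota\Delta_2]$ for all (local) holomorphic sections $\Delta_1,\Delta_2$ of $D^{1,0}E$. Corollary. The complex vector bundle $DE$, with the holomorphic structure transported along $\iota$, carries a holomorphic Lie algebroid structure (a holomorphic vector bundle morphism $\rho:DE\to TX$ and a $\mathbb C$-bilinear Lie bracket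 on the sheaf of holomorphic sections satisfying the Leibniz rule over holomorphic functions) such that (1) its underlying real Lie algebroid (same anchor, with bracket extending that on holomorphic sections) is $DE$ with the anchor and the bracket of $D_{\mathbb R}E$, restricted to $DE$; (2) its associated complex Lie algebroid $(DE)^{1,0}$ (the $i$-eigenbundle of $j_{DE}$ in $DE\otimes_{\mathbb R}\mathbb C$, with the complex linearly extended anchor and bracket) coincides with $D^{1,0}E$: the natural map $DE\otimes_{\mathbb R}\mathbb C\to D_{\mathbb C}E$, $\Delta\otimes z\mapsto z\Delta$, restricts to an isomorphism of complex Lie algebroids $(DE)^{1,0}\to D^{1,0}E$. -/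

import Mathlib

open Bundle Set Filter Topology
open scoped Manifold ContDiff TensorProduct

set_option linter.unusedSectionVars false

noncomputable section

namespace HolGauge

universe u v w u' v' w'

/-! ### Real structures underlying complex ones -/

/-- The smooth (real) manifold underlying a complex manifold. -/
instance (priority := 50) isManifoldReal
    {EX : Type u} [NormedAddCommGroup EX] [NormedSpace ℂ EX]
    {M : Type v} [TopologicalSpace M] [ChartedSpace EX M] [IsManifold 𝓘(ℂ, EX) ω M] :
    IsManifold 𝓘(ℝ, EX) ∞ M := by
  apply isManifold_of_contDiffOn
  intro e e' he he'
  have h := (contDiffGroupoid ω 𝓘(ℂ, EX)).compatible he he'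
  rw [contDiffGroupoid, mem_groupoid_of_pregroupoid] at h
  exact (h.1.restrict_scalars ℝ).of_le le_top

/-- The real vector bundle underlying a complex vector bundle. -/
instance (priority := 50) vectorBundleReal
    {F : Type u} [NormedAddCommGroup F] [NormedSpace ℂ F] {M : Type v} [TopologicalSpace M]
    {V : M → Type w} [∀ x, AddCommGroup (V x)] [∀ x, Module ℂ (V x)]
    [TopologicalSpace (TotalSpace F V)] [∀ x, TopologicalSpace (V x)]
    [FiberBundle F V] [VectorBundle ℂ F V] : VectorBundle ℝ F V where
  trivialization_linear' e he :=
    ⟨fun b hb =>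
      ⟨(e.linear ℂ hb).map_add, fun c y => by
        have := (e.linear ℂ hb).map_smul (c : ℂ) y
        simpa using this⟩⟩
  continuousOn_coordChange' e e' he he' := by
    have : e.IsLinear ℝ := ⟨fun b hb =>
      ⟨(e.linear ℂ hb).map_add, fun c y => by
        have := (e.linear ℂ hb).map_smul (c : ℂ) y
        simpa using this⟩⟩
    have : e'.IsLinear ℝ := ⟨fun b hb =>
      ⟨(e'.linear ℂ hb).map_add, fun c y => by
        have := (e'.linear ℂ hb).map_smul (c : ℂ) y
        simpa using this⟩⟩
    have h := continuousOn_coordChange ℂ e e'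
    have h2 := (ContinuousLinearMap.restrictScalarsL ℂ F F ℝ ℝ).continuous.comp_continuousOn h
    refine h2.congr fun b hb => ?_
    ext y
    simp only [Function.comp_apply, ContinuousLinearEquiv.coe_coe]
    rw [Trivialization.coordChangeL_apply e e' hb]
    exact (Trivialization.coordChangeL_apply e e' hb y).symm

/-- The complex vector space structure on a real vector space defined by `J` with `J² = -1`. -/
@[reducible] def complexModule {W : Type u} [AddCommGroup W] [Module ℝ W] (J : W →ₗ[ℝ] W)
    (hJ : ∀ a, J (J a) = -a) : Module ℂ W where
  smul z a := z.re • a + z.im • J a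
  one_smul a := by
    change (1 : ℂ).re • a + (1 : ℂ).im • J a = a
    simp
  mul_smul z z' a := by
    change (z * z').re • a + (z * z').im • J a
      = z.re • (z'.re • a + z'.im • J a) + z.im • J (z'.re • a + z'.im • J a)
    simp only [Complex.mul_re, Complex.mul_im, map_add, map_smul, hJ]
    module
  smul_zero z := by
    change z.re • (0 : W) + z.im • J 0 = 0
    simp
  smul_add z a b := by
    change z.re • (a + b) + z.im • J (a + b) = (z.re • a + z.im • J a) + (z.re • b + z.im • J b)
    rw [map_add]; module
  add_smul z z' a := by
    change (z + z').re • a + (z + z').im • J a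
      = (z.re • a + z.im • J a) + (z'.re • a + z'.im • J a)
    simp only [Complex.add_re, Complex.add_im]; module
  zero_smul a := by
    change (0 : ℂ).re • a + (0 : ℂ).im • J a = 0
    simp

/-! ### Complexification -/

section Complexification

variable {W : Type u} [AddCommGroup W] [Module ℝ W]

/-- Real part of an element of the complexification `ℂ ⊗ W`. -/
def cRe : ℂ ⊗[ℝ] W →ₗ[ℝ] W :=
  (TensorProduct.lid ℝ W).toLinearMap ∘ₗ LinearMap.rTensor W Complex.reLm

/-- Imaginary part of an element of the complexification `ℂ ⊗ W`. -/
def cIm : ℂ ⊗[ℝ] W →ₗ[ℝ] W :=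
  (TensorProduct.lid ℝ W).toLinearMap ∘ₗ LinearMap.rTensor W Complex.imLm

/-- Complex conjugation on the complexification `ℂ ⊗ W`. -/
def cConj : ℂ ⊗[ℝ] W →ₗ[ℝ] ℂ ⊗[ℝ] W :=
  LinearMap.rTensor W Complex.conjAe.toLinearMap

/-- The `c`-eigenspace of the complexification of `j : W → W`. -/
def cEigen (j : W →ₗ[ℝ] W) (c : ℂ) : Submodule ℂ (ℂ ⊗[ℝ] W) :=
  LinearMap.eqLocus (j.baseChange ℂ) (c • LinearMap.id)

/-- The complex bilinear extension of a bracket on sections of a real vector bundle to sections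
of its complexification. -/
def cBracket {M : Type v} {A : M → Type w} [∀ x, AddCommGroup (A x)] [∀ x, Module ℝ (A x)]
    (br : (∀ x, A x) → (∀ x, A x) → ∀ x, A x) (s t : ∀ x, ℂ ⊗[ℝ] A x) (x : M) : ℂ ⊗[ℝ] A x :=
  (1 : ℂ) ⊗ₜ[ℝ] (br (fun y => cRe (s y)) (fun y => cRe (t y)) x
      - br (fun y => cIm (s y)) (fun y => cIm (t y)) x)
    + Complex.I ⊗ₜ[ℝ] (br (fun y => cRe (s y)) (fun y => cIm (t y)) x
      + br (fun y => cIm (s y)) (fun y => cRe (t y)) x)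

end Complexification

/-! ### Complex vector bundles presented by fibres and smooth local sections -/

/-- A family of complex vector spaces over `M` with a notion of smooth section over a subset
(only open subsets matter). Local sections are represented by total families, of which only the
values on the open subset matter. It is a smooth complex vector bundle when `IsVectorBundle`
below holds. -/
structure CBundle (M : Type v) where
  Fib : M → Type w
  [addCommGroup : ∀ x, AddCommGroup (Fib x)]
  [module : ∀ x, Module ℂ (Fib x)]
  IsSmooth : Set M → (∀ x, Fib x) → Prop

attribute [instance] CBundle.addCommGroup CBundle.module

section Manifold

variable (EX : Type u) [NormedAddCommGroup EX] [NormedSpace ℂ EX]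
  {M : Type v} [TopologicalSpace M] [ChartedSpace EX M]

/-- The family `A` carries a structure of smooth complex vector bundle over the real manifold
underlying `M` whose smooth sections over open subsets are those prescribed by `A.IsSmooth`. -/
def CBundle.IsVectorBundle (A : CBundle.{v, w} M) : Prop :=
  ∃ (G : Type) (_ : NormedAddCommGroup G) (_ : NormedSpace ℂ G) (_ : FiniteDimensional ℂ G)
    (_ : ∀ x, TopologicalSpace (A.Fib x)) (_ : TopologicalSpace (TotalSpace G A.Fib))
    (_ : FiberBundle G A.Fib) (_ : VectorBundle ℂ G A.Fib),
    ContMDiffVectorBundle ∞ G A.Fib 𝓘(ℝ, EX) ∧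
    ∀ U : Set M, IsOpen U → ∀ s : (∀ x, A.Fib x),
      A.IsSmooth U s ↔
        ContMDiffOn 𝓘(ℝ, EX) (𝓘(ℝ, EX).prod 𝓘(ℝ, G)) ∞ (fun x => TotalSpace.mk' G x (s x)) U

/-- The bundle `A^{1,0}`: the `i`-eigenbundle in the complexification of the real vector bundle
underlying `A` of the complex structure of `A`. -/
def CBundle.oneZero (A : CBundle.{v, w} M) : CBundle.{v, w} M where
  Fib x := cEigen ((LinearMap.lsmul ℂ (A.Fib x) Complex.I).restrictScalars ℝ) Complex.I
  IsSmooth U s := A.IsSmooth U (fun x => cRe (s x : ℂ ⊗[ℝ] A.Fib x)) ∧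
    A.IsSmooth U (fun x => cIm (s x : ℂ ⊗[ℝ] A.Fib x))

/-! ### The tangent bundle of the complex manifold -/

variable [IsManifold 𝓘(ℂ, EX) ω M]

/-- Smooth real vector fields on `U`. -/
def SmoothVF (U : Set M) (v : ∀ x : M, TangentSpace 𝓘(ℝ, EX) x) : Prop :=
  ContMDiffOn 𝓘(ℝ, EX) (𝓘(ℝ, EX).prod 𝓘(ℝ, EX)) ∞
    (fun x => TotalSpace.mk' EX x (v x)) U

/-- The complex structure `j` on `T_x M`. The space `TangentSpace 𝓘(ℝ, EX) x` is a copy of `EX`,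
identified with the tangent space by means of a holomorphic chart, and `j` is multiplication by
`i` in `EX`. -/
def jT (x : M) : TangentSpace 𝓘(ℝ, EX) x →ₗ[ℝ] TangentSpace 𝓘(ℝ, EX) x :=
  ((LinearMap.lsmul ℂ EX Complex.I).restrictScalars ℝ : EX →ₗ[ℝ] EX)

/-- The complexified tangent space. -/
abbrev CT (x : M) : Type u := ℂ ⊗[ℝ] TangentSpace 𝓘(ℝ, EX) x

/-- `T^{1,0}`. -/
abbrev T10 (x : M) : Submodule ℂ (CT EX x) := cEigen (jT EX x) Complex.I

/-- `T^{0,1}`. -/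
abbrev T01 (x : M) : Submodule ℂ (CT EX x) := cEigen (jT EX x) (-Complex.I)

/-- The differential of a real valued function. -/
def rDiff (f : M → ℝ) (x : M) : TangentSpace 𝓘(ℝ, EX) x →ₗ[ℝ] ℝ :=
  let L : TangentSpace 𝓘(ℝ, EX) x →L[ℝ] ℝ := mfderiv 𝓘(ℝ, EX) 𝓘(ℝ, ℝ) f x
  L.toLinearMap

/-- The action of a real tangent vector on a real function. -/
def tAct {x : M} (ξ : TangentSpace 𝓘(ℝ, EX) x) (f : M → ℝ) : ℝ := rDiff EX f x ξ

/-- The differential of a complex valued function, extended complex linearly. -/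
def cDiff (f : M → ℂ) (x : M) : CT EX x →ₗ[ℂ] ℂ :=
  let L : TangentSpace 𝓘(ℝ, EX) x →L[ℝ] ℂ := mfderiv 𝓘(ℝ, EX) 𝓘(ℝ, ℂ) f x
  LinearMap.liftBaseChange ℂ L.toLinearMap

/-- The action of a complex tangent vector on a complex function. -/
def cAct {x : M} (ξ : CT EX x) (f : M → ℂ) : ℂ := cDiff EX f x ξ

/-- Smooth complex vector fields on `U`. -/
def SmoothCVF (U : Set M) (ξ : ∀ x : M, CT EX x) : Prop :=
  SmoothVF EX U (fun x => cRe (ξ x)) ∧ SmoothVF EX U (fun x => cIm (ξ x))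

/-- The Lie bracket of complex vector fields. -/
def cLie (ξ η : ∀ x : M, CT EX x) : ∀ x : M, CT EX x :=
  cBracket (VectorField.mlieBracket 𝓘(ℝ, EX)) ξ η

/-- Smooth complex valued functions on `U`. -/
def SmoothFun (U : Set M) (f : M → ℂ) : Prop := ContMDiffOn 𝓘(ℝ, EX) 𝓘(ℝ, ℂ) ∞ f U

theorem jT_jT (x : M) (v : TangentSpace 𝓘(ℝ, EX) x) : jT EX x (jT EX x v) = -v := by
  have h : ∀ a : EX, Complex.I • (Complex.I • a) = -a := fun a => by
    rw [smul_smul, Complex.I_mul_I, neg_one_smul]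
  exact h v

theorem jT_baseChange_sq (x : M) (ξ : CT EX x) :
    (jT EX x).baseChange ℂ ((jT EX x).baseChange ℂ ξ) = -ξ := by
  induction ξ using TensorProduct.induction_on with
  | zero => simp
  | tmul z v => simp [jT_jT, TensorProduct.tmul_neg]
  | add a b ha hb => rw [map_add, map_add, ha, hb, neg_add]

/-- The projection of the complexified tangent space onto `T^{1,0}` along `T^{0,1}`:
`ξ ↦ (ξ - i jξ) / 2`. -/
def p10 (x : M) : CT EX x →ₗ[ℂ] T10 EX x :=
  LinearMap.codRestrict (T10 EX x)
    ((1 / 2 : ℂ) • (LinearMap.id - Complex.I • (jT EX x).baseChange ℂ)) fun ξ => by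
      change (jT EX x).baseChange ℂ
          ((1 / 2 : ℂ) • (ξ - Complex.I • (jT EX x).baseChange ℂ ξ))
        = Complex.I • ((1 / 2 : ℂ) • (ξ - Complex.I • (jT EX x).baseChange ℂ ξ))
      rw [map_smul, map_sub, map_smul, jT_baseChange_sq]
      simp only [smul_sub, smul_smul, smul_neg]
      rw [mul_left_comm Complex.I, Complex.I_mul_I]
      module

/-- The projection of the complexified tangent space onto `T^{0,1}` along `T^{1,0}`:
`ξ ↦ (ξ + i jξ) / 2`. -/
def p01 (x : M) : CT EX x →ₗ[ℂ] T01 EX x :=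
  LinearMap.codRestrict (T01 EX x)
    ((1 / 2 : ℂ) • (LinearMap.id + Complex.I • (jT EX x).baseChange ℂ)) fun ξ => by
      change (jT EX x).baseChange ℂ
          ((1 / 2 : ℂ) • (ξ + Complex.I • (jT EX x).baseChange ℂ ξ))
        = (-Complex.I) • ((1 / 2 : ℂ) • (ξ + Complex.I • (jT EX x).baseChange ℂ ξ))
      rw [map_smul, map_add, map_smul, jT_baseChange_sq]
      simp only [smul_add, smul_smul, smul_neg, neg_smul, neg_mul]
      rw [mul_left_comm Complex.I, Complex.I_mul_I]
      module

/-- Complex conjugation `T^{1,0} → T^{0,1}`. -/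
theorem cConj_mem_T01 {x : M} {ξ : CT EX x} (h : ξ ∈ T10 EX x) : cConj ξ ∈ T01 EX x := by
  have hcomm : ∀ η : CT EX x,
      (jT EX x).baseChange ℂ (cConj η) = cConj ((jT EX x).baseChange ℂ η) := by
    intro η
    induction η using TensorProduct.induction_on with
    | zero => simp
    | tmul z v => simp [cConj]
    | add a b ha hb => simp only [map_add, ha, hb]
  have hI : ∀ η : CT EX x, cConj (Complex.I • η) = (-Complex.I) • cConj η := by
    intro η
    induction η using TensorProduct.induction_on with
    | zero => simp
    | tmul z v => simp [cConj, TensorProduct.smul_tmul', TensorProduct.neg_tmul]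
    | add a b ha hb => simp only [map_add, smul_add, ha, hb]
  have h' : (jT EX x).baseChange ℂ ξ = Complex.I • ξ := h
  change (jT EX x).baseChange ℂ (cConj ξ) = (-Complex.I) • cConj ξ
  rw [hcomm, h', hI]

/-! ### Flat `T^{0,1}`-connections -/

/-- A flat `T^{0,1}`-connection in `A`. The value `toFun s x ξ` is `∂̄_ξ s ∈ A_x`,
for `ξ ∈ T^{0,1}_x` and a section `s` of `A` which is smooth around `x`; the values on sections
that are not smooth around `x` carry no information. Locality follows from the Leibniz rule. In
the flatness condition `p01` is the identity, as `[ζ, η]` is a section of `T^{0,1}`. -/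
structure DbarConnection (A : CBundle.{v, w} M) where
  toFun : (∀ y, A.Fib y) → ∀ x : M, T01 EX x →ₗ[ℂ] A.Fib x
  map_add : ∀ U : Set M, IsOpen U → ∀ s t, A.IsSmooth U s → A.IsSmooth U t → ∀ x ∈ U,
    toFun (fun y => s y + t y) x = toFun s x + toFun t x
  leibniz : ∀ U : Set M, IsOpen U → ∀ f s, SmoothFun EX U f → A.IsSmooth U s → ∀ x ∈ U,
    ∀ ξ : T01 EX x,
      toFun (fun y => f y • s y) x ξ = cAct EX (ξ : CT EX x) f • s x + f x • toFun s x ξ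
  smooth : ∀ U : Set M, IsOpen U → ∀ (ζ : ∀ y, T01 EX y) (s : ∀ y, A.Fib y),
    SmoothCVF EX U (fun y => (ζ y : CT EX y)) → A.IsSmooth U s →
      A.IsSmooth U (fun x => toFun s x (ζ x))
  flat : ∀ U : Set M, IsOpen U → ∀ (ζ η : ∀ y, T01 EX y) (s : ∀ y, A.Fib y),
    SmoothCVF EX U (fun y => (ζ y : CT EX y)) → SmoothCVF EX U (fun y => (η y : CT EX y)) →
    A.IsSmooth U s → ∀ x ∈ U,
      toFun (fun y => toFun s y (η y)) x (ζ x) - toFun (fun y => toFun s y (ζ y)) x (η x)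
        = toFun s x (p01 EX x (cLie EX (fun y => (ζ y : CT EX y)) (fun y => (η y : CT EX y)) x))

variable {EX} in
/-- Holomorphic sections over `U`: smooth sections in the kernel of `∂̄`. -/
def DbarConnection.IsHol {A : CBundle.{v, w} M} (D : DbarConnection EX A) (U : Set M)
    (s : ∀ x, A.Fib x) : Prop :=
  A.IsSmooth U s ∧ ∀ x ∈ U, D.toFun s x = 0

/-- The standard flat `T^{0,1}`-connection on the holomorphic tangent bundle, on real vector
fields: `∂̄_ζ v = 2 Re ([ζ, v^{1,0}]^{1,0})`, where `v^{1,0} = (v - i jv) / 2`. -/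
def dbarT (ζ : ∀ y : M, T01 EX y) (v : ∀ y : M, TangentSpace 𝓘(ℝ, EX) y) (x : M) :
    TangentSpace 𝓘(ℝ, EX) x :=
  (2 : ℝ) • cRe (p10 EX x (cLie EX (fun y => (ζ y : CT EX y))
    (fun y => (p10 EX y ((1 : ℂ) ⊗ₜ[ℝ] v y) : CT EX y)) x) : CT EX x)

/-! ### Lie algebroids -/

/-- A real Lie algebroid structure on the real vector bundle underlying `A`. The bracket of
sections smooth around `x` is evaluated at `x`; its locality follows from the Leibniz rule. -/
structure RealLieAlgebroid (A : CBundle.{v, w} M) where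
  isVectorBundle : A.IsVectorBundle EX
  anchor : ∀ x : M, A.Fib x →ₗ[ℝ] TangentSpace 𝓘(ℝ, EX) x
  bracket : (∀ y, A.Fib y) → (∀ y, A.Fib y) → ∀ x, A.Fib x
  anchor_smooth : ∀ U : Set M, IsOpen U → ∀ s, A.IsSmooth U s →
    SmoothVF EX U (fun x => anchor x (s x))
  bracket_smooth : ∀ U : Set M, IsOpen U → ∀ s t, A.IsSmooth U s → A.IsSmooth U t →
    A.IsSmooth U (bracket s t)
  add_bracket : ∀ U : Set M, IsOpen U → ∀ s s' t, A.IsSmooth U s → A.IsSmooth U s' →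
    A.IsSmooth U t → ∀ x ∈ U, bracket (fun y => s y + s' y) t x = bracket s t x + bracket s' t x
  smul_bracket : ∀ U : Set M, IsOpen U → ∀ (c : ℝ) s t, A.IsSmooth U s → A.IsSmooth U t →
    ∀ x ∈ U, bracket (fun y => c • s y) t x = c • bracket s t x
  skew : ∀ U : Set M, IsOpen U → ∀ s t, A.IsSmooth U s → A.IsSmooth U t →
    ∀ x ∈ U, bracket s t x = -bracket t s x
  jacobi : ∀ U : Set M, IsOpen U → ∀ s t r, A.IsSmooth U s → A.IsSmooth U t → A.IsSmooth U r →
    ∀ x ∈ U, bracket s (bracket t r) x = bracket (bracket s t) r x + bracket t (bracket s r) x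
  leibniz : ∀ U : Set M, IsOpen U → ∀ (f : M → ℝ) s t, ContMDiffOn 𝓘(ℝ, EX) 𝓘(ℝ, ℝ) ∞ f U →
    A.IsSmooth U s → A.IsSmooth U t → ∀ x ∈ U,
      bracket s (fun y => f y • t y) x = tAct EX (anchor x (s x)) f • t x + f x • bracket s t x

/-- A complex Lie algebroid structure on the complex vector bundle `A`. -/
structure ComplexLieAlgebroid (A : CBundle.{v, w} M) where
  isVectorBundle : A.IsVectorBundle EX
  anchor : ∀ x : M, A.Fib x →ₗ[ℂ] CT EX x
  bracket : (∀ y, A.Fib y) → (∀ y, A.Fib y) → ∀ x, A.Fib x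
  anchor_smooth : ∀ U : Set M, IsOpen U → ∀ s, A.IsSmooth U s →
    SmoothCVF EX U (fun x => anchor x (s x))
  bracket_smooth : ∀ U : Set M, IsOpen U → ∀ s t, A.IsSmooth U s → A.IsSmooth U t →
    A.IsSmooth U (bracket s t)
  add_bracket : ∀ U : Set M, IsOpen U → ∀ s s' t, A.IsSmooth U s → A.IsSmooth U s' →
    A.IsSmooth U t → ∀ x ∈ U, bracket (fun y => s y + s' y) t x = bracket s t x + bracket s' t x
  smul_bracket : ∀ U : Set M, IsOpen U → ∀ (c : ℂ) s t, A.IsSmooth U s → A.IsSmooth U t →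
    ∀ x ∈ U, bracket (fun y => c • s y) t x = c • bracket s t x
  skew : ∀ U : Set M, IsOpen U → ∀ s t, A.IsSmooth U s → A.IsSmooth U t →
    ∀ x ∈ U, bracket s t x = -bracket t s x
  jacobi : ∀ U : Set M, IsOpen U → ∀ s t r, A.IsSmooth U s → A.IsSmooth U t → A.IsSmooth U r →
    ∀ x ∈ U, bracket s (bracket t r) x = bracket (bracket s t) r x + bracket t (bracket s r) x
  leibniz : ∀ U : Set M, IsOpen U → ∀ (f : M → ℂ) s t, SmoothFun EX U f →
    A.IsSmooth U s → A.IsSmooth U t → ∀ x ∈ U,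
      bracket s (fun y => f y • t y) x = cAct EX (anchor x (s x)) f • t x + f x • bracket s t x

/-- A holomorphic Lie algebroid structure on `A`: a holomorphic vector bundle structure on `A`
(a smooth complex vector bundle with a flat `T^{0,1}`-connection), a holomorphic vector bundle
morphism `anchor` with values in the holomorphic tangent bundle (whose underlying real vector
bundle is `TM` with the complex structure `j`), and a complex bilinear Lie bracket on the sheaf of
holomorphic sections with the Leibniz rule over holomorphic functions. -/
structure HolLieAlgebroid (A : CBundle.{v, w} M) where
  isVectorBundle : A.IsVectorBundle EX
  dbar : DbarConnection EX A
  anchor : ∀ x : M, A.Fib x →ₗ[ℝ] TangentSpace 𝓘(ℝ, EX) x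
  anchor_I : ∀ (x : M) (a : A.Fib x), anchor x (Complex.I • a) = jT EX x (anchor x a)
  anchor_smooth : ∀ U : Set M, IsOpen U → ∀ s, A.IsSmooth U s →
    SmoothVF EX U (fun x => anchor x (s x))
  anchor_hol : ∀ U : Set M, IsOpen U → ∀ (ζ : ∀ y, T01 EX y) (s : ∀ y, A.Fib y),
    SmoothCVF EX U (fun y => (ζ y : CT EX y)) → A.IsSmooth U s → ∀ x ∈ U,
      anchor x (dbar.toFun s x (ζ x)) = dbarT EX ζ (fun y => anchor y (s y)) x
  bracket : (∀ y, A.Fib y) → (∀ y, A.Fib y) → ∀ x, A.Fib x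
  bracket_hol : ∀ U : Set M, IsOpen U → ∀ s t, dbar.IsHol U s → dbar.IsHol U t →
    dbar.IsHol U (bracket s t)
  add_bracket : ∀ U : Set M, IsOpen U → ∀ s s' t, dbar.IsHol U s → dbar.IsHol U s' →
    dbar.IsHol U t → ∀ x ∈ U, bracket (fun y => s y + s' y) t x = bracket s t x + bracket s' t x
  smul_bracket : ∀ U : Set M, IsOpen U → ∀ (c : ℂ) s t, dbar.IsHol U s → dbar.IsHol U t →
    ∀ x ∈ U, bracket (fun y => c • s y) t x = c • bracket s t x
  skew : ∀ U : Set M, IsOpen U → ∀ s t, dbar.IsHol U s → dbar.IsHol U t →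
    ∀ x ∈ U, bracket s t x = -bracket t s x
  jacobi : ∀ U : Set M, IsOpen U → ∀ s t r, dbar.IsHol U s → dbar.IsHol U t → dbar.IsHol U r →
    ∀ x ∈ U, bracket s (bracket t r) x = bracket (bracket s t) r x + bracket t (bracket s r) x
  leibniz : ∀ U : Set M, IsOpen U → ∀ (f : M → ℂ) s t, MDifferentiableOn 𝓘(ℂ, EX) 𝓘(ℂ, ℂ) f U →
    dbar.IsHol U s → dbar.IsHol U t → ∀ x ∈ U,
      bracket s (fun y => f y • t y) x
        = cAct EX ((1 : ℂ) ⊗ₜ[ℝ] anchor x (s x)) f • t x + f x • bracket s t x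

variable {EX} in
/-- `R` is the real Lie algebroid underlying the holomorphic Lie algebroid `H`: it has the same
anchor, and its bracket restricts to the bracket of `H` on holomorphic sections. -/
def HolLieAlgebroid.IsUnderlyingReal {A : CBundle.{v, w} M} (H : HolLieAlgebroid EX A)
    (R : RealLieAlgebroid EX A) : Prop :=
  (∀ x, R.anchor x = H.anchor x) ∧
  ∀ U : Set M, IsOpen U → ∀ s t, H.dbar.IsHol U s → H.dbar.IsHol U t → ∀ x ∈ U,
    R.bracket s t x = H.bracket s t x

variable {EX} in
/-- `C` is the complex Lie algebroid structure on `A^{1,0}` obtained from the real Lie algebroid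
`R` by extending anchor and bracket to the complexification and restricting to `A^{1,0}`. -/
def RealLieAlgebroid.IsOneZeroPart {A : CBundle.{v, w} M} (R : RealLieAlgebroid EX A)
    (C : ComplexLieAlgebroid EX A.oneZero) : Prop :=
  (∀ (x : M) (a : A.oneZero.Fib x),
    C.anchor x a = (R.anchor x).baseChange ℂ (a.1 : ℂ ⊗[ℝ] A.Fib x)) ∧
  ∀ U : Set M, IsOpen U → ∀ s t, A.oneZero.IsSmooth U s → A.oneZero.IsSmooth U t → ∀ x ∈ U,
    ((C.bracket s t x).1 : ℂ ⊗[ℝ] A.Fib x)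
      = cBracket R.bracket (fun y => ((s y).1 : ℂ ⊗[ℝ] A.Fib y))
          (fun y => ((t y).1 : ℂ ⊗[ℝ] A.Fib y)) x

variable {EX} in
/-- A family of linear isomorphisms is an isomorphism of smooth complex vector bundles. -/
def IsBundleIso {A : CBundle.{v, w} M} {B : CBundle.{v, w'} M}
    (φ : ∀ x, A.Fib x ≃ₗ[ℂ] B.Fib x) : Prop :=
  ∀ U : Set M, IsOpen U → ∀ s, A.IsSmooth U s ↔ B.IsSmooth U (fun x => φ x (s x))

variable {EX} in
/-- A family of linear isomorphisms is an isomorphism of complex Lie algebroids. -/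
def ComplexLieAlgebroid.IsIso {A : CBundle.{v, w} M} {B : CBundle.{v, w'} M}
    (C : ComplexLieAlgebroid EX A) (C' : ComplexLieAlgebroid EX B)
    (φ : ∀ x, A.Fib x ≃ₗ[ℂ] B.Fib x) : Prop :=
  IsBundleIso φ ∧
  (∀ x a, C'.anchor x (φ x a) = C.anchor x a) ∧
  ∀ U : Set M, IsOpen U → ∀ s t, A.IsSmooth U s → A.IsSmooth U t → ∀ x ∈ U,
    φ x (C.bracket s t x) = C'.bracket (fun y => φ y (s y)) (fun y => φ y (t y)) x

/-! ### Gauge algebroids -/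

variable (F : Type u') [NormedAddCommGroup F] [NormedSpace ℂ F]
  (V : M → Type w) [TopologicalSpace (TotalSpace F V)]
  [∀ x, AddCommGroup (V x)] [∀ x, Module ℂ (V x)] [∀ x, TopologicalSpace (V x)]
  [FiberBundle F V] [VectorBundle ℂ F V]

/-- The complex vector bundle `E` with fibres `V x`. -/
def vecBundle : CBundle.{v, w} M where
  Fib := V
  IsSmooth U s := ContMDiffOn 𝓘(ℝ, EX) (𝓘(ℝ, EX).prod 𝓘(ℝ, F)) ∞
    (fun x => TotalSpace.mk' F x (s x)) U

theorem smooth_smul {f : M → ℂ} (hf : ContMDiff 𝓘(ℝ, EX) 𝓘(ℝ, ℂ) ∞ f) {s : ∀ x, V x}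
    (hs : ContMDiff 𝓘(ℝ, EX) (𝓘(ℝ, EX).prod 𝓘(ℝ, F)) ∞ (fun x => TotalSpace.mk' F x (s x))) :
    ContMDiff 𝓘(ℝ, EX) (𝓘(ℝ, EX).prod 𝓘(ℝ, F)) ∞
      (fun x => TotalSpace.mk' F x (f x • s x)) := by
  intro x₀
  have h := hs x₀
  rw [contMDiffAt_section] at h ⊢
  set e := trivializationAt F V x₀ with he
  have h2 : ContMDiffAt 𝓘(ℝ, EX) 𝓘(ℝ, F) ∞ (fun x => f x • (e ⟨x, s x⟩).2) x₀ := by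
    have hc : ContDiff ℝ ∞ (fun p : ℂ × F => p.1 • p.2) := contDiff_fst.smul contDiff_snd
    exact hc.contMDiff.contMDiffAt.comp x₀ ((hf x₀).prodMk_space h)
  refine h2.congr_of_eventuallyEq ?_
  filter_upwards [e.open_baseSet.mem_nhds (mem_baseSet_trivializationAt F V x₀)] with x hx
  exact (e.linear ℂ hx).map_smul (f x) (s x)

/-- The complex vector space `Γ(E)` of smooth global sections of `E`. -/
def Sec : Submodule ℂ (∀ x, V x) where
  carrier := {s | ContMDiff 𝓘(ℝ, EX) (𝓘(ℝ, EX).prod 𝓘(ℝ, F)) ∞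
    (fun x => TotalSpace.mk' F x (s x))}
  add_mem' hs ht := hs.add_section ht
  zero_mem' := contMDiff_zeroSection ℝ V
  smul_mem' c _ hs := smooth_smul EX F V (f := fun _ => c) contMDiff_const hs

/-- Multiplication of smooth sections by smooth complex valued functions. -/
def Sec.mul (f : M → ℂ) (hf : ContMDiff 𝓘(ℝ, EX) 𝓘(ℝ, ℂ) ∞ f) (e : Sec EX F V) : Sec EX F V :=
  ⟨fun x => f x • e.1 x, smooth_smul EX F V hf e.2⟩

/-- Multiplication of smooth sections by smooth real valued functions. -/
def Sec.rmul (f : M → ℝ) (hf : ContMDiff 𝓘(ℝ, EX) 𝓘(ℝ, ℝ) ∞ f) (e : Sec EX F V) :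
    Sec EX F V :=
  Sec.mul EX F V (fun x => (f x : ℂ))
    (Complex.ofRealCLM.contDiff.contMDiff.comp hf) e

/-- The fibre over `x` of the complex gauge algebroid `D_ℂ E`: pairs consisting of a complex linear
map `Δ : Γ(E) → E_x` and a complex tangent vector `ξ` at `x`, the symbol of `Δ`, related by the
Leibniz rule `Δ(fe) = ξ(f) e_x + f(x) Δ(e)` for `f ∈ C^∞(M, ℂ)`.
(If `E` has positive rank, then `ξ` is determined by `Δ`.) -/
def DCfib (x : M) : Submodule ℂ ((Sec EX F V →ₗ[ℂ] V x) × CT EX x) where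
  carrier := {D | ∀ (f : M → ℂ) (hf : ContMDiff 𝓘(ℝ, EX) 𝓘(ℝ, ℂ) ∞ f) (e : Sec EX F V),
    D.1 (Sec.mul EX F V f hf e) = cAct EX D.2 f • e.1 x + f x • D.1 e}
  add_mem' {D D'} h h' f hf e := by
    have h1 := h f hf e
    have h2 := h' f hf e
    simp only [cAct, Prod.fst_add, Prod.snd_add, LinearMap.add_apply, map_add] at h1 h2 ⊢
    rw [h1, h2]; module
  zero_mem' f hf e := by simp [cAct]
  smul_mem' c D h f hf e := by
    have h1 := h f hf e
    simp only [cAct, Prod.smul_fst, Prod.smul_snd, LinearMap.smul_apply, map_smul] at h1 ⊢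
    rw [h1, smul_eq_mul]; module

/-- The fibre over `x` of the real gauge algebroid `D_ℝ E`: pairs consisting of a real linear
map `Δ : Γ(E) → E_x` and a tangent vector `ξ` at `x`, the symbol of `Δ`, related by the
Leibniz rule `Δ(fe) = ξ(f) e_x + f(x) Δ(e)` for `f ∈ C^∞(M)`. -/
def DRfib (x : M) : Submodule ℝ ((Sec EX F V →ₗ[ℝ] V x) × TangentSpace 𝓘(ℝ, EX) x) where
  carrier := {D | ∀ (f : M → ℝ) (hf : ContMDiff 𝓘(ℝ, EX) 𝓘(ℝ, ℝ) ∞ f) (e : Sec EX F V),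
    D.1 (Sec.rmul EX F V f hf e) = tAct EX D.2 f • e.1 x + f x • D.1 e}
  add_mem' {D D'} h h' f hf e := by
    have h1 := h f hf e
    have h2 := h' f hf e
    simp only [tAct, Prod.fst_add, Prod.snd_add, LinearMap.add_apply, map_add] at h1 h2 ⊢
    rw [h1, h2]; module
  zero_mem' f hf e := by simp [tAct]
  smul_mem' c D h f hf e := by
    have h1 := h f hf e
    simp only [tAct, Prod.smul_fst, Prod.smul_snd, LinearMap.smul_apply, map_smul] at h1 ⊢
    rw [h1, smul_eq_mul]; module

/-- The fibre over `x` of `DE`: the complex linear elements of the fibre of `D_ℝ E`. -/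
def Dfib (x : M) : Submodule ℝ ((Sec EX F V →ₗ[ℝ] V x) × TangentSpace 𝓘(ℝ, EX) x) :=
  DRfib EX F V x ⊓
  { carrier := {D | ∀ (c : ℂ) (e : Sec EX F V), D.1 (c • e) = c • D.1 e}
    add_mem' := fun {D D'} h h' c e => by
      simp only [Prod.fst_add, LinearMap.add_apply]
      rw [h c e, h' c e, smul_add]
    zero_mem' := fun c e => by simp
    smul_mem' := fun r D h c e => by
      simp only [Prod.smul_fst, LinearMap.smul_apply]
      rw [h c e, smul_comm] }

/-- The fibre over `x` of `D^{1,0} E`: the elements of the fibre of `D_ℂ E` with symbol in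
`T^{1,0}`. -/
def D10fib (x : M) : Submodule ℂ ((Sec EX F V →ₗ[ℂ] V x) × CT EX x) :=
  DCfib EX F V x ⊓ (T10 EX x).comap (LinearMap.snd ℂ _ _)

/-- The bundle `D^{1,0} E`; a section is smooth if it maps smooth sections of `E` to smooth
sections of `E`, and its symbol is smooth. -/
def D10 : CBundle.{v, max (max v w) u} M where
  Fib x := D10fib EX F V x
  IsSmooth U Δ := (∀ e : Sec EX F V, (vecBundle EX F V).IsSmooth U (fun x => (Δ x).1.1 e)) ∧
    SmoothCVF EX U (fun x => (Δ x).1.2)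

variable {EX F V}

/-- The operator and the symbol of an element of `D^{1,0} E`. -/
def D10.val {x : M} (Δ : (D10 EX F V).Fib x) : (Sec EX F V →ₗ[ℂ] V x) × CT EX x :=
  Subtype.val (p := fun D => D ∈ D10fib EX F V x) Δ

/-- The complex conjugate `σ(Δ)‾ ∈ T^{0,1}` of the symbol of an element of `D^{1,0} E`. -/
def D10.symbConj {x : M} (Δ : (D10 EX F V).Fib x) : T01 EX x :=
  ⟨cConj (D10.val Δ).2,
    cConj_mem_T01 EX (Subtype.property (p := fun D => D ∈ D10fib EX F V x) Δ).2⟩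

section Commutator

/-- `D`, an operator `Γ(E) → E_x` with a symbol, is the value at `x` of the commutator of two local
families of such operators. The condition on operators is `D(e) = Δ(Δ'(e)) - Δ'(Δ(e))` for all
`e ∈ Γ(E)`, where in order to apply `Δ` at `x` to the local section `Δ'(e)`, this is replaced by a
global smooth section `e₂` with the same germ at `x`, and likewise for `Δ(e)`. -/
def IsCommC (Δ Δ' : ∀ y : M, (Sec EX F V →ₗ[ℂ] V y) × CT EX y) (x : M)
    (D : (Sec EX F V →ₗ[ℂ] V x) × CT EX x) : Prop :=
  (∀ e e₁ e₂ : Sec EX F V, (∀ᶠ y in 𝓝 x, e₁.1 y = (Δ y).1 e) →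
    (∀ᶠ y in 𝓝 x, e₂.1 y = (Δ' y).1 e) → D.1 e = (Δ x).1 e₂ - (Δ' x).1 e₁) ∧
  D.2 = cLie EX (fun y => (Δ y).2) (fun y => (Δ' y).2) x

/-- The analogue of `IsCommC` for the real gauge algebroid. -/
def IsCommR (Δ Δ' : ∀ y : M, (Sec EX F V →ₗ[ℝ] V y) × TangentSpace 𝓘(ℝ, EX) y) (x : M)
    (D : (Sec EX F V →ₗ[ℝ] V x) × TangentSpace 𝓘(ℝ, EX) x) : Prop :=
  (∀ e e₁ e₂ : Sec EX F V, (∀ᶠ y in 𝓝 x, e₁.1 y = (Δ y).1 e) →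
    (∀ᶠ y in 𝓝 x, e₂.1 y = (Δ' y).1 e) → D.1 e = (Δ x).1 e₂ - (Δ' x).1 e₁) ∧
  D.2 = VectorField.mlieBracket 𝓘(ℝ, EX) (fun y => (Δ y).2) (fun y => (Δ' y).2) x

end Commutator

section Holomorphic

variable (dbar : DbarConnection EX (vecBundle EX F V))

theorem smooth_univ (e : Sec EX F V) : (vecBundle EX F V).IsSmooth univ e.1 :=
  contMDiffOn_univ.2 e.2

/-- `∂̄_ξ`, with symbol `ξ`, as an element of the fibre of `D_ℂ E`, for `ξ ∈ T^{0,1}_x`. -/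
def dbarOp (x : M) : T01 EX x →ₗ[ℂ] DCfib EX F V x :=
  LinearMap.codRestrict (DCfib EX F V x)
    (LinearMap.prod
      { toFun := fun ξ =>
          { toFun := fun e => dbar.toFun e.1 x ξ
            map_add' := fun e e' => by
              have h := dbar.map_add univ isOpen_univ e.1 e'.1 (smooth_univ e) (smooth_univ e') x
                (mem_univ x)
              exact congrArg (fun L => L ξ) h
            map_smul' := fun c e => by
              have h := dbar.leibniz univ isOpen_univ (fun _ => c) e.1 contMDiffOn_const
                (smooth_univ e) x (mem_univ x) ξ
              have h0 : cAct EX (ξ : CT EX x) (fun _ : M => c) = 0 := by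
                have : cDiff EX (fun _ : M => c) x = 0 := by
                  unfold cDiff
                  rw [mfderiv_const]
                  ext v
                  change (LinearMap.liftBaseChange ℂ (0 : TangentSpace 𝓘(ℝ, EX) x →ₗ[ℝ] ℂ))
                    ((1 : ℂ) ⊗ₜ[ℝ] v) = 0
                  rw [LinearMap.liftBaseChange_tmul, LinearMap.zero_apply, smul_zero]
                simp [cAct, this]
              have h3 : dbar.toFun (fun y => c • e.1 y) x ξ
                  = (0 : ℂ) • (show (vecBundle EX F V).Fib x from e.1 x)
                    + c • dbar.toFun e.1 x ξ := h.trans (by rw [h0])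
              exact h3.trans (by rw [zero_smul, zero_add]; rfl) }
        map_add' := fun ξ η => by ext e; exact (dbar.toFun e.1 x).map_add ξ η
        map_smul' := fun c ξ => by ext e; exact (dbar.toFun e.1 x).map_smul c ξ }
      (T01 EX x).subtype)
    (fun ξ f hf e => dbar.leibniz univ isOpen_univ f e.1 (contMDiffOn_univ.2 hf) (smooth_univ e) x
      (mem_univ x) ξ)

/-- The projection `Δ ↦ Δ^{1,0}` of the fibre of `D_ℂ E` onto that of `D^{1,0} E`, with kernel the
image of `∂̄`. -/
def proj10 (x : M) (Δ : DCfib EX F V x) : D10fib EX F V x :=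
  ⟨Δ.1 - (dbarOp dbar x (p01 EX x Δ.1.2)).1, by
    refine ⟨Submodule.sub_mem _ Δ.2 (dbarOp dbar x (p01 EX x Δ.1.2)).2, ?_⟩
    have h : Δ.1.2 - (p01 EX x Δ.1.2 : CT EX x) = (p10 EX x Δ.1.2 : CT EX x) := by
      change Δ.1.2 - (1 / 2 : ℂ) • (Δ.1.2 + Complex.I • (jT EX x).baseChange ℂ Δ.1.2)
        = (1 / 2 : ℂ) • (Δ.1.2 - Complex.I • (jT EX x).baseChange ℂ Δ.1.2)
      module
    change Δ.1.2 - (p01 EX x Δ.1.2 : CT EX x) ∈ T10 EX x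
    rw [h]
    exact (p10 EX x Δ.1.2).2⟩

/-- The component in `T^{0,1}` of a real tangent vector. -/
def t01 (x : M) : TangentSpace 𝓘(ℝ, EX) x →ₗ[ℝ] T01 EX x :=
  (p01 EX x).restrictScalars ℝ ∘ₗ TensorProduct.mk ℝ ℂ (TangentSpace 𝓘(ℝ, EX) x) 1

theorem cAct_real {x : M} (f : M → ℝ) (hf : ContMDiff 𝓘(ℝ, EX) 𝓘(ℝ, ℝ) ∞ f)
    (v : TangentSpace 𝓘(ℝ, EX) x) (z : ℂ) :
    cAct EX (z ⊗ₜ[ℝ] v) (fun y => (f y : ℂ)) = z * (tAct EX v f : ℂ) := by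
  have hd : MDifferentiableAt 𝓘(ℝ, EX) 𝓘(ℝ, ℝ) f x := (hf x).mdifferentiableAt (by simp)
  have hc : HasMFDerivAt 𝓘(ℝ, ℝ) 𝓘(ℝ, ℂ) (fun r : ℝ => (r : ℂ)) (f x) Complex.ofRealCLM :=
    Complex.ofRealCLM.hasFDerivAt.hasMFDerivAt
  have h := (hc.comp x hd.hasMFDerivAt).mfderiv
  have h' : mfderiv 𝓘(ℝ, EX) 𝓘(ℝ, ℂ) (fun y => (f y : ℂ)) x
      = Complex.ofRealCLM.comp
        (mfderiv 𝓘(ℝ, EX) 𝓘(ℝ, ℝ) f x : TangentSpace 𝓘(ℝ, EX) x →L[ℝ] ℝ) := h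
  unfold cAct cDiff
  rw [h', LinearMap.liftBaseChange_tmul]
  rfl

/-- The complex structure `j_{DE}` on `DE`: `j_{DE} Δ = j_E ∘ (Δ - 2 ∂̄_{σ(Δ)^{0,1}})`, with
symbol `j σ(Δ)`, on the ambient space of pairs. -/
def jAmb (x : M) : ((Sec EX F V →ₗ[ℝ] V x) × TangentSpace 𝓘(ℝ, EX) x) →ₗ[ℝ]
    ((Sec EX F V →ₗ[ℝ] V x) × TangentSpace 𝓘(ℝ, EX) x) where
  toFun D :=
    ({ toFun := fun e => Complex.I • (D.1 e - (2 : ℝ) • (dbarOp dbar x (t01 x D.2)).1.1 e)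
       map_add' := fun e e' => by simp only [map_add]; module
       map_smul' := fun r e => by
         have h : (dbarOp dbar x (t01 x D.2)).1.1 (r • e)
             = r • (dbarOp dbar x (t01 x D.2)).1.1 e :=
           ((dbarOp dbar x (t01 x D.2)).1.1.restrictScalars ℝ).map_smul r e
         rw [h, map_smul, RingHom.id_apply, smul_comm (2 : ℝ) r, ← smul_sub,
           smul_comm Complex.I r] },
      jT EX x D.2)
  map_add' D D' := by
    refine Prod.ext (LinearMap.ext fun e => ?_) (map_add _ _ _)
    simp only [Prod.fst_add, Prod.snd_add, map_add, Submodule.coe_add, LinearMap.add_apply,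
      LinearMap.coe_mk, AddHom.coe_mk]
    module
  map_smul' r D := by
    refine Prod.ext (LinearMap.ext fun e => ?_) (map_smul _ _ _)
    have h : (dbarOp dbar x (t01 x (r • D.2))).1.1 e
        = r • (dbarOp dbar x (t01 x D.2)).1.1 e := by
      have h1 : dbarOp dbar x (t01 x (r • D.2)) = (r : ℂ) • dbarOp dbar x (t01 x D.2) := by
        have h2 : t01 x (r • D.2) = (r : ℂ) • t01 x D.2 := by
          rw [map_smul]; rfl
        rw [h2, map_smul]
      rw [h1]
      rfl
    simp only [Prod.smul_fst, Prod.smul_snd, LinearMap.smul_apply, LinearMap.coe_mk,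
      AddHom.coe_mk, RingHom.id_apply]
    rw [h, smul_comm (2 : ℝ) r, ← smul_sub, smul_comm Complex.I r]

theorem jAmb_mem (x : M) (D : Dfib EX F V x) : jAmb dbar x D.1 ∈ Dfib EX F V x := by
  obtain ⟨D, hR, hC⟩ := D
  have hbar := (dbarOp dbar x (t01 x D.2)).2
  refine ⟨fun f hf e => ?_, fun c e => ?_⟩
  · have h1 := hR f hf e
    have h2 := hbar (fun y => (f y : ℂ)) (Complex.ofRealCLM.contDiff.contMDiff.comp hf) e
    have hs : (dbarOp dbar x (t01 x D.2)).1.2 = (1 / 2 : ℂ) • ((1 : ℂ) ⊗ₜ[ℝ] D.2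
        + Complex.I • ((1 : ℂ) ⊗ₜ[ℝ] jT EX x D.2)) := rfl
    have h3 : cAct EX (dbarOp dbar x (t01 x D.2)).1.2 (fun y => (f y : ℂ))
        = (1 / 2 : ℂ) * ((tAct EX D.2 f : ℂ) + Complex.I * (tAct EX (jT EX x D.2) f : ℂ)) := by
      have e1 := cAct_real f hf D.2 1
      have e2 := cAct_real f hf (jT EX x D.2) 1
      rw [hs]
      unfold cAct at e1 e2 ⊢
      rw [map_smul, map_add, map_smul, e1, e2]
      simp
    change Complex.I • (D.1 (Sec.rmul EX F V f hf e)
        - (2 : ℝ) • (dbarOp dbar x (t01 x D.2)).1.1 (Sec.rmul EX F V f hf e))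
      = tAct EX (jT EX x D.2) f • e.1 x
        + f x • (Complex.I • (D.1 e - (2 : ℝ) • (dbarOp dbar x (t01 x D.2)).1.1 e))
    rw [h1]
    change Complex.I • (_ - (2 : ℝ) • (dbarOp dbar x (t01 x D.2)).1.1
      (Sec.mul EX F V (fun y => (f y : ℂ)) _ e)) = _
    rw [h2, h3]
    simp only [← Complex.coe_smul]
    push_cast
    have hI : Complex.I * Complex.I = -1 := Complex.I_mul_I
    match_scalars
    · linear_combination (-(tAct EX (jT EX x D.2) f : ℂ)) * hI
    · ring
    · ring
  · change Complex.I • (D.1 (c • e) - (2 : ℝ) • (dbarOp dbar x (t01 x D.2)).1.1 (c • e))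
      = c • (Complex.I • (D.1 e - (2 : ℝ) • (dbarOp dbar x (t01 x D.2)).1.1 e))
    rw [hC c e, map_smul]
    simp only [← Complex.coe_smul]
    module

theorem jAmb_sq (x : M) (D : (Sec EX F V →ₗ[ℝ] V x) × TangentSpace 𝓘(ℝ, EX) x) :
    jAmb dbar x (jAmb dbar x D) = -D := by
  refine Prod.ext (LinearMap.ext fun e => ?_) (jT_jT EX x D.2)
  have ht : t01 x (jT EX x D.2) = (-Complex.I) • t01 x D.2 := by
    apply Subtype.ext
    change (1 / 2 : ℂ) • ((1 : ℂ) ⊗ₜ[ℝ] jT EX x D.2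
        + Complex.I • ((1 : ℂ) ⊗ₜ[ℝ] jT EX x (jT EX x D.2)))
      = (-Complex.I) • ((1 / 2 : ℂ) • ((1 : ℂ) ⊗ₜ[ℝ] D.2
        + Complex.I • ((1 : ℂ) ⊗ₜ[ℝ] jT EX x D.2)))
    rw [jT_jT, TensorProduct.tmul_neg]
    have hI : Complex.I * Complex.I = -1 := Complex.I_mul_I
    match_scalars
    · linear_combination (1 / 2 : ℂ) * hI
    · ring
  change Complex.I • (Complex.I • (D.1 e - (2 : ℝ) • (dbarOp dbar x (t01 x D.2)).1.1 e)
    - (2 : ℝ) • (dbarOp dbar x (t01 x (jT EX x D.2))).1.1 e) = -(D.1 e)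
  rw [ht, map_smul]
  change Complex.I • (Complex.I • (D.1 e - (2 : ℝ) • (dbarOp dbar x (t01 x D.2)).1.1 e)
    - (2 : ℝ) • ((-Complex.I) • (dbarOp dbar x (t01 x D.2)).1.1 e)) = -(D.1 e)
  simp only [← Complex.coe_smul]
  push_cast
  have hI : Complex.I * Complex.I = -1 := Complex.I_mul_I
  match_scalars
  · linear_combination hI
  · ring

/-- The complex structure `j_{DE}` on `DE`. -/
def jDE (x : M) : Dfib EX F V x →ₗ[ℝ] Dfib EX F V x :=
  LinearMap.restrict (jAmb dbar x) fun D hD => jAmb_mem dbar x ⟨D, hD⟩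

/-- The bundle `DE` of complex linear derivations in `D_ℝ E`, with the complex structure
`j_{DE}`; a section is smooth if it maps smooth sections of `E` to smooth sections of `E`, and its
symbol is smooth. -/
def DE : CBundle.{v, max (max v w) u} M where
  Fib x := Dfib EX F V x
  module x := complexModule (jDE dbar x) fun D => Subtype.ext (jAmb_sq dbar x D.1)
  IsSmooth U Δ := (∀ e : Sec EX F V, (vecBundle EX F V).IsSmooth U (fun x => (Δ x).1.1 e)) ∧
    SmoothVF EX U (fun x => (Δ x).1.2)

variable {dbar} in
/-- The operator and the symbol of an element of `DE`, as a subspace of `D_ℝ E`. -/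
def DE.val {x : M} (Δ : (DE dbar).Fib x) :
    (Sec EX F V →ₗ[ℝ] V x) × TangentSpace 𝓘(ℝ, EX) x :=
  Subtype.val (p := fun D => D ∈ Dfib EX F V x) Δ

end Holomorphic

end Manifold

end HolGauge

end

open HolGauge

/-! Everything takes place inside the complex gauge algebroid `DCfib`, whose elements are pairs of
an operator and a symbol. A section of it is determined by its action on germs of sections of E
together with its symbol (`opAct_ext`), and a complex vector field by its action on germs of
functions (`cAct_ext`). Linearity, skew symmetry, Leibniz rules and Jacobi identities for the
commutator `comm` thus reduce to formal identities between composed derivations. D^{1,0}E enters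
through the inclusion `incl10`, and DE through `deToDC`, whose image consists of the elements with
real symbol.

There is a splitting D_ℂE = D^{1,0}E ⊕ ∂̄(T^{0,1}), with projection `proj10L` along the second
summand. Modulo that summand, the complex structure j_DE is multiplication by i (`deToDC_smul`). So
the projection restricts to a complex linear map DE → D^{1,0}E, and this is the inverse of ι: an
element D with real symbol differs from its projection by ∂̄ of the (0,1)-part of σ(D), which is the
conjugate of the (1,0)-part. The formula [∂̄_ζ, Δ]^{1,0} depends only on the value of ζ at the
point, because derivatives of the coefficients of ζ produce multiples of ∂̄, which the projection
kills (`proj10L_comm_congr`). It is flat by the Jacobi identity and the flatness of ∂̄ (`nabla`).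

If Δ is holomorphic, then [∂̄_ζ, Δ] is ∂̄ of the (0,1)-part of its symbol. For holomorphic Δ, Δ' the
bracket of conj σ(Δ) with σ(Δ') is therefore of type (0,1); by the conjugate statement with the
roles exchanged it is also of type (1,0), so it vanishes (`cLie_conj_eq_zero`). Hence in [Δ +
∂̄_{conj σ(Δ)}, Δ' + ∂̄_{conj σ(Δ')}] the mixed terms vanish, and the two remaining terms are those
of ι[Δ, Δ'] (`iota_bracket`).

For the complex algebroid of DE, write ιΔ = a + b with b = ∂̄_{conj σ(Δ)}; then j_DE ιΔ = i(a - b).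
The eigenvector with real part ιΔ is sent by the natural map to (a + b) - i·i(a - b) = 2Δ, and in
the complexified bracket the mixed terms cancel for all smooth sections (`deBracket_iota_sub`,
`deBracket_iota_add`).

Two analytic facts remain. A trivialization of E and a holomorphic chart identify an element of
D^{1,0}E with a connection matrix and a symbol, so that D^{1,0}E is a vector bundle, and DE and
(DE)^{1,0} inherit this. The Leibniz rule over holomorphic functions requires that complex
differentiable functions of several variables are smooth (`contDiffOn_of_complexDifferentiableOn`).
-/

noncomputable section
namespace HolGauge
open VectorField

/-! ### Vector fields in a chart; the Lie bracket as a commutator of derivations. -/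

section RealCalculus

variable {E : Type*} [NormedAddCommGroup E] [NormedSpace ℝ E]
  {M : Type*} [TopologicalSpace M] [ChartedSpace E M]
  {G : Type*} [NormedAddCommGroup G] [NormedSpace ℝ G]

/-- The derivative of a vector valued function along a tangent vector. -/
def dAct (f : M → G) {x : M} (v : TangentSpace 𝓘(ℝ, E) x) : G :=
  mfderiv 𝓘(ℝ, E) 𝓘(ℝ, G) f x v

variable [IsManifold 𝓘(ℝ, E) ∞ M]

/-- The representative of a vector field in the preferred chart at `x`. -/
def chartRep (x : M) (V : ∀ y : M, TangentSpace 𝓘(ℝ, E) y) (z : E) : E :=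
  mpullbackWithin 𝓘(ℝ, E) 𝓘(ℝ, E) (extChartAt 𝓘(ℝ, E) x).symm V (range 𝓘(ℝ, E)) z

/-- The chain rule for `f` composed with the inverse chart. It holds at every point of one fixed
chart domain, so that the right side can be differentiated once more. -/
theorem dAct_eq_fderiv {f : M → G} {x y : M} (hy : y ∈ (extChartAt 𝓘(ℝ, E) x).source)
    (hf : MDifferentiableAt 𝓘(ℝ, E) 𝓘(ℝ, G) f y) (V : ∀ y : M, TangentSpace 𝓘(ℝ, E) y) :
    dAct f (V y) = fderiv ℝ (f ∘ (extChartAt 𝓘(ℝ, E) x).symm) (extChartAt 𝓘(ℝ, E) x y)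
      (chartRep x V (extChartAt 𝓘(ℝ, E) x y)) := by
  have hz := (extChartAt 𝓘(ℝ, E) x).map_source hy
  have hl : (extChartAt 𝓘(ℝ, E) x).symm (extChartAt 𝓘(ℝ, E) x y) = y :=
    (extChartAt 𝓘(ℝ, E) x).left_inv hy
  have hd := (mdifferentiableWithinAt_extChartAt_symm (I := 𝓘(ℝ, E)) hz)
  rw [modelWithCornersSelf_coe, range_id, mdifferentiableWithinAt_univ] at hd
  have hf' : MDifferentiableAt 𝓘(ℝ, E) 𝓘(ℝ, G) f
    ((extChartAt 𝓘(ℝ, E) x).symm (extChartAt 𝓘(ℝ, E) x y)) := by rwa [hl]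
  have h := mfderiv_comp (extChartAt 𝓘(ℝ, E) x y) hf' hd
  have hi := isInvertible_mfderivWithin_extChartAt_symm (I := 𝓘(ℝ, E)) hz
  -- `chartRep` is built with `ContinuousLinearMap.inverse`, which is meaningful only on invertible
  -- maps; invertibility of the derivative of the inverse chart makes the two cancel.
  have hi' : ∀ v : TangentSpace 𝓘(ℝ, E) ((extChartAt 𝓘(ℝ, E) x).symm (extChartAt 𝓘(ℝ, E) x y)),
      mfderivWithin 𝓘(ℝ, E) 𝓘(ℝ, E) (extChartAt 𝓘(ℝ, E) x).symm (range 𝓘(ℝ, E))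
        (extChartAt 𝓘(ℝ, E) x y) ((mfderivWithin 𝓘(ℝ, E) 𝓘(ℝ, E) (extChartAt 𝓘(ℝ, E) x).symm
          (range 𝓘(ℝ, E)) (extChartAt 𝓘(ℝ, E) x y)).inverse v) = v := fun v => by
    exact congrArg (fun L => L v) hi.self_comp_inverse
  have hV := hi' (V _)
  rw [mfderiv_eq_fderiv] at h
  rw [h]
  change _ = mfderiv 𝓘(ℝ, E) 𝓘(ℝ, G) f _ (mfderiv 𝓘(ℝ, E) 𝓘(ℝ, E) _ _
    ((mfderivWithin 𝓘(ℝ, E) 𝓘(ℝ, E) (extChartAt 𝓘(ℝ, E) x).symm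
          (range 𝓘(ℝ, E)) (extChartAt 𝓘(ℝ, E) x y)).inverse (V _)))
  have hw : mfderivWithin 𝓘(ℝ, E) 𝓘(ℝ, E) (extChartAt 𝓘(ℝ, E) x).symm (range 𝓘(ℝ, E))
        (extChartAt 𝓘(ℝ, E) x y) = mfderiv 𝓘(ℝ, E) 𝓘(ℝ, E) (extChartAt 𝓘(ℝ, E) x).symm
        (extChartAt 𝓘(ℝ, E) x y) := by
    rw [modelWithCornersSelf_coe, range_id, mfderivWithin_univ]
  rw [← hw, hV]
  unfold dAct
  rw [hl]

theorem differentiableAt_chartRep [CompleteSpace E] {x : M} {V : ∀ y : M, TangentSpace 𝓘(ℝ, E) y}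
    (hV : MDifferentiableAt 𝓘(ℝ, E) (𝓘(ℝ, E).prod 𝓘(ℝ, E)) (fun y => TotalSpace.mk' E y (V y)) x) :
    DifferentiableAt ℝ (chartRep x V) (extChartAt 𝓘(ℝ, E) x x) := by
  have h : DifferentiableWithinAt ℝ (chartRep x V) ((extChartAt 𝓘(ℝ, E) x).symm ⁻¹' univ ∩
      range 𝓘(ℝ, E)) (extChartAt 𝓘(ℝ, E) x x) :=
    (mdifferentiableWithinAt_univ.2 hV).differentiableWithinAt_mpullbackWithin_vectorField
  rwa [modelWithCornersSelf_coe, range_id, preimage_univ, inter_univ,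
    differentiableWithinAt_univ] at h

/-- The tangent space at `x` is identified with the model by the preferred chart at `x`, so at its
own centre that chart has derivative the identity. -/
theorem chartRep_self (x : M) (V : ∀ y : M, TangentSpace 𝓘(ℝ, E) y) :
    chartRep x V (extChartAt 𝓘(ℝ, E) x x) = V x := by
  have h : mfderivWithin 𝓘(ℝ, E) 𝓘(ℝ, E) (extChartAt 𝓘(ℝ, E) x).symm (range 𝓘(ℝ, E))
      (extChartAt 𝓘(ℝ, E) x x) = ContinuousLinearMap.id ℝ E :=
    mfderivWithin_range_extChartAt_symm
  refine (congrArg (fun L : E →L[ℝ] E => L.inverse (V ((extChartAt 𝓘(ℝ, E) x).symm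
    (extChartAt 𝓘(ℝ, E) x x)) : E)) h).trans ?_
  refine (congrArg (fun L : E →L[ℝ] E => L (V ((extChartAt 𝓘(ℝ, E) x).symm
    (extChartAt 𝓘(ℝ, E) x x)) : E)) ContinuousLinearMap.inverse_id).trans ?_
  have : ∀ y, y = x → (V y : E) = V x := fun y hy => by rw [hy]
  exact this _ (extChartAt_to_inv x)

theorem mlieBracket_eq_fderiv (x : M) (V W : ∀ y : M, TangentSpace 𝓘(ℝ, E) y) :
    mlieBracket 𝓘(ℝ, E) V W x
      = fderiv ℝ (chartRep x W) (extChartAt 𝓘(ℝ, E) x x) (chartRep x V (extChartAt 𝓘(ℝ, E) x x))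
        - fderiv ℝ (chartRep x V) (extChartAt 𝓘(ℝ, E) x x)
          (chartRep x W (extChartAt 𝓘(ℝ, E) x x)) := by
  have h : (mfderiv 𝓘(ℝ, E) 𝓘(ℝ, E) (extChartAt 𝓘(ℝ, E) x) x).inverse
      = ContinuousLinearMap.id ℝ E :=
    (congrArg ContinuousLinearMap.inverse
      (mfderiv_extChartAt_self (I := 𝓘(ℝ, E)) (x := x))).trans ContinuousLinearMap.inverse_id
  rw [← mlieBracketWithin_univ, mlieBracketWithin_apply]
  refine (congrArg (fun L : E →L[ℝ] E => L _) h).trans ?_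
  change lieBracketWithin ℝ (chartRep x V) (chartRep x W) _ _ = _
  rw [modelWithCornersSelf_coe, range_id, preimage_univ, inter_univ, lieBracketWithin_univ]
  rfl

/-- In the chart, V(Wf) = D²g(V, W) + Dg(DW·V) with g the local expression of f. The second
derivative is symmetric and drops out of the commutator; what remains is Dg applied to the flat
bracket. All later bracket identities rest on this. -/
theorem dAct_mlieBracket [CompleteSpace E] {f : M → G} {x : M}
    {V W : ∀ y : M, TangentSpace 𝓘(ℝ, E) y}
    (hf : ContMDiffAt 𝓘(ℝ, E) 𝓘(ℝ, G) ∞ f x)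
    (hV : MDifferentiableAt 𝓘(ℝ, E) (𝓘(ℝ, E).prod 𝓘(ℝ, E)) (fun y => TotalSpace.mk' E y (V y)) x)
    (hW : MDifferentiableAt 𝓘(ℝ, E) (𝓘(ℝ, E).prod 𝓘(ℝ, E)) (fun y => TotalSpace.mk' E y (W y)) x) :
    dAct f (mlieBracket 𝓘(ℝ, E) V W x)
      = dAct (fun y => dAct f (W y)) (V x) - dAct (fun y => dAct f (V y)) (W x) := by
  set c := extChartAt 𝓘(ℝ, E) x with hc
  have hxs : x ∈ c.source := mem_extChartAt_source x
  set g : E → G := f ∘ c.symm with hg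
  have hgs : ContDiffAt ℝ ∞ g (c x) := by
    have := (contMDiffAt_iff.1 hf).2
    simpa [hg, hc, contDiffWithinAt_univ] using! this
  have hsrc : c.source ∈ 𝓝 x := extChartAt_source_mem_nhds x
  have hfy : ∀ᶠ y in 𝓝 x, MDifferentiableAt 𝓘(ℝ, E) 𝓘(ℝ, G) f y := by
    have h1 : ContMDiffAt 𝓘(ℝ, E) 𝓘(ℝ, G) 1 f x := hf.of_le (by simp)
    filter_upwards [contMDiffAt_iff_contMDiffAt_nhds (by simp) |>.1 h1] with y hy
    exact hy.mdifferentiableAt (by simp)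
  have two_le : (1 : ℕ∞ω) + 1 ≤ ∞ := by
    rw [one_add_one_eq_two]
    exact WithTop.coe_le_coe.2 le_top
  have key : ∀ (V W : ∀ y : M, TangentSpace 𝓘(ℝ, E) y)
      (_ : MDifferentiableAt 𝓘(ℝ, E) (𝓘(ℝ, E).prod 𝓘(ℝ, E)) (fun y => TotalSpace.mk' E y (V y)) x)
      (_ : MDifferentiableAt 𝓘(ℝ, E) (𝓘(ℝ, E).prod 𝓘(ℝ, E)) (fun y => TotalSpace.mk' E y (W y)) x),
      dAct (fun y => dAct f (W y)) (V x)
        = fderiv ℝ (fderiv ℝ g) (c x) (chartRep x V (c x)) (chartRep x W (c x))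
          + fderiv ℝ g (c x) (fderiv ℝ (chartRep x W) (c x) (chartRep x V (c x))) := by
    intro V W hV hW
    have hd : DifferentiableAt ℝ (fun z => fderiv ℝ g z (chartRep x W z)) (c x) :=
      ((hgs.fderiv_right (m := 1) two_le).differentiableAt (by simp)).clm_apply
        (differentiableAt_chartRep hW)
    have he : (fun y => dAct f (W y)) =ᶠ[𝓝 x]
        (fun z => fderiv ℝ g z (chartRep x W z)) ∘ c := by
      filter_upwards [hsrc, hfy] with y hy hfy
      exact dAct_eq_fderiv hy hfy W
    have hm : MDifferentiableAt 𝓘(ℝ, E) 𝓘(ℝ, G) (fun y => dAct f (W y)) x := by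
      refine MDifferentiableAt.congr_of_eventuallyEq ?_ he
      exact hd.mdifferentiableAt.comp x (mdifferentiableAt_extChartAt (mem_chart_source E x))
    rw [dAct_eq_fderiv hxs hm V]
    have he' : (fun y => dAct f (W y)) ∘ c.symm =ᶠ[𝓝 (c x)]
        (fun z => fderiv ℝ g z (chartRep x W z)) := by
      have ht : c.target ∈ 𝓝 (c x) := extChartAt_target_mem_nhds x
      have hcont : Tendsto c.symm (𝓝 (c x)) (𝓝 x) := by
        have := (continuousAt_extChartAt_symm (I := 𝓘(ℝ, E)) x).tendsto
        rwa [extChartAt_to_inv] at this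
      filter_upwards [ht, hcont.eventually he] with z hz h
      rw [Function.comp_apply, h, Function.comp_apply, c.right_inv hz]
    rw [he'.fderiv_eq, fderiv_clm_apply
      ((hgs.fderiv_right (m := 1) two_le).differentiableAt (by simp))
      (differentiableAt_chartRep hW)]
    simp only [add_apply, ContinuousLinearMap.comp_apply,
      ContinuousLinearMap.flip_apply]
    exact add_comm _ _
  have hsymm : IsSymmSndFDerivAt ℝ g (c x) :=
    hgs.isSymmSndFDerivAt (by simpa [one_add_one_eq_two] using two_le)
  rw [key V W hV hW, key W V hW hV, hsymm (chartRep x V (c x))]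
  have hfx := dAct_eq_fderiv hxs (hfy.self_of_nhds) (mlieBracket 𝓘(ℝ, E) V W)
  rw [chartRep_self, mlieBracket_eq_fderiv] at hfx
  refine (congrArg (dAct f) (mlieBracket_eq_fderiv x V W)).trans (hfx.trans ?_)
  rw [map_sub]
  abel

end RealCalculus

/-! ### Germs of smooth functions, sections and real vector fields. -/

section Germs

variable {EX : Type*} [NormedAddCommGroup EX] [NormedSpace ℂ EX]
  {M : Type*} [TopologicalSpace M] [ChartedSpace EX M]

section

variable {G G' : Type*} [NormedAddCommGroup G] [NormedSpace ℝ G]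
  [NormedAddCommGroup G'] [NormedSpace ℝ G']

variable (EX) in
/-- The function `f` is smooth on a neighbourhood of `x`. -/
def FunAt (f : M → G) (x : M) : Prop :=
  ∀ᶠ y in 𝓝 x, ContMDiffAt 𝓘(ℝ, EX) 𝓘(ℝ, G) ∞ f y

theorem FunAt.contMDiffAt {f : M → G} {x : M} (h : FunAt EX f x) :
    ContMDiffAt 𝓘(ℝ, EX) 𝓘(ℝ, G) ∞ f x := h.self_of_nhds

theorem FunAt.mdifferentiableAt {f : M → G} {x : M} (h : FunAt EX f x) :
    MDifferentiableAt 𝓘(ℝ, EX) 𝓘(ℝ, G) f x := h.contMDiffAt.mdifferentiableAt (by simp)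

/-- Smoothness of order ∞ at one point only gives a neighbourhood for each finite order separately.
Asking for it on a neighbourhood yields a condition that persists at nearby points, as iterated
derivatives require. -/
theorem FunAt.eventually {f : M → G} {x : M} (h : FunAt EX f x) : ∀ᶠ y in 𝓝 x, FunAt EX f y :=
  eventually_eventually_nhds.2 h

theorem FunAt.congr {f g : M → G} {x : M} (h : FunAt EX f x) (hg : g =ᶠ[𝓝 x] f) :
    FunAt EX g x := by
  filter_upwards [h, hg.eventuallyEq_nhds] with y hy hg using hy.congr_of_eventuallyEq hg

theorem funAt_of_contMDiff {f : M → G} (h : ContMDiff 𝓘(ℝ, EX) 𝓘(ℝ, G) ∞ f) (x : M) :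
    FunAt EX f x := Eventually.of_forall h

theorem contMDiffOn_iff_funAt {f : M → G} {U : Set M} (hU : IsOpen U) :
    ContMDiffOn 𝓘(ℝ, EX) 𝓘(ℝ, G) ∞ f U ↔ ∀ x ∈ U, FunAt EX f x := by
  refine ⟨fun h x hx => ?_, fun h x hx => (h x hx).contMDiffAt.contMDiffWithinAt⟩
  filter_upwards [hU.mem_nhds hx] with y hy using h.contMDiffAt (hU.mem_nhds hy)

theorem funAt_const (c : G) (x : M) : FunAt EX (fun _ => c) x :=
  Eventually.of_forall fun _ => contMDiffAt_const

theorem FunAt.clm {f : M → G} {x : M} (h : FunAt EX f x) (L : G →L[ℝ] G') :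
    FunAt EX (fun y => L (f y)) x := by
  filter_upwards [h] with y hy using L.contDiff.contMDiff.contMDiffAt.comp y hy

theorem FunAt.add {f g : M → G} {x : M} (hf : FunAt EX f x) (hg : FunAt EX g x) :
    FunAt EX (fun y => f y + g y) x := by
  filter_upwards [hf, hg] with y h1 h2 using h1.add h2

theorem FunAt.mul {f g : M → ℂ} {x : M} (hf : FunAt EX f x) (hg : FunAt EX g x) :
    FunAt EX (fun y => f y * g y) x := by
  filter_upwards [hf, hg] with y h1 h2
  exact (contDiff_mul (𝕜 := ℝ) (𝔸 := ℂ)).contMDiff.contMDiffAt.comp y (h1.prodMk_space h2)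

theorem dAct_add {f g : M → G} {x : M} (hf : FunAt EX f x) (hg : FunAt EX g x)
    (v : TangentSpace 𝓘(ℝ, EX) x) :
    dAct (fun y => f y + g y) v = dAct f v + dAct g v := by
  have h := (hf.mdifferentiableAt.hasMFDerivAt.add hg.mdifferentiableAt.hasMFDerivAt).mfderiv
  exact congrArg (fun L : EX →L[ℝ] G => L v) h

theorem dAct_clm {f : M → G} {x : M} (hf : FunAt EX f x) (L : G →L[ℝ] G')
    (v : TangentSpace 𝓘(ℝ, EX) x) : dAct (fun y => L (f y)) v = L (dAct f v) := by
  have h := ((L.hasFDerivAt (x := f x)).hasMFDerivAt.comp x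
    hf.mdifferentiableAt.hasMFDerivAt).mfderiv
  exact congrArg (fun L : EX →L[ℝ] G' => L v) h

theorem dAct_const (c : G) {x : M} (v : TangentSpace 𝓘(ℝ, EX) x) :
    dAct (fun _ : M => c) v = 0 := by
  have h := (hasMFDerivAt_const (I := 𝓘(ℝ, EX)) (I' := 𝓘(ℝ, G)) c x).mfderiv
  exact congrArg (fun L : EX →L[ℝ] G => L v) h

theorem dAct_congr {f g : M → G} {x : M} (h : f =ᶠ[𝓝 x] g) (v : TangentSpace 𝓘(ℝ, EX) x) :
    dAct f v = dAct g v := by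
  have h' := h.mfderiv_eq (I := 𝓘(ℝ, EX)) (I' := 𝓘(ℝ, G))
  exact congrArg (fun L : EX →L[ℝ] G => L v) h'

theorem dAct_mul {f g : M → ℂ} {x : M} (hf : FunAt EX f x) (hg : FunAt EX g x)
    (v : TangentSpace 𝓘(ℝ, EX) x) :
    dAct (fun y => f y * g y) v = dAct f v * g x + f x * dAct g v := by
  have h := (hf.mdifferentiableAt.hasMFDerivAt.mul hg.mdifferentiableAt.hasMFDerivAt).mfderiv
  refine (congrArg (fun L : EX →L[ℝ] ℂ => L v) h).trans ?_
  change f x * dAct g v + g x * dAct f v = _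
  ring

theorem dAct_map_add (f : M → G) {x : M} (v w : TangentSpace 𝓘(ℝ, EX) x) :
    dAct f (v + w) = dAct f v + dAct f w :=
  map_add (mfderiv 𝓘(ℝ, EX) 𝓘(ℝ, G) f x) v w

theorem dAct_map_smul (f : M → G) {x : M} (r : ℝ) (v : TangentSpace 𝓘(ℝ, EX) x) :
    dAct f (r • v) = r • dAct f v :=
  map_smul (mfderiv 𝓘(ℝ, EX) 𝓘(ℝ, G) f x) r v

end

section Sections

variable {F : Type*} [NormedAddCommGroup F] [NormedSpace ℝ F]
  {V : M → Type*} [TopologicalSpace (TotalSpace F V)]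
  [∀ x, TopologicalSpace (V x)] [FiberBundle F V]

variable (EX F V) in
/-- The section `s` is smooth on a neighbourhood of `x`. -/
def SecAt (s : ∀ x, V x) (x : M) : Prop :=
  ∀ᶠ y in 𝓝 x, ContMDiffAt 𝓘(ℝ, EX) (𝓘(ℝ, EX).prod 𝓘(ℝ, F)) ∞
    (fun z => TotalSpace.mk' F z (s z)) y

theorem SecAt.eventually {s : ∀ x, V x} {x : M} (h : SecAt EX F V s x) :
    ∀ᶠ y in 𝓝 x, SecAt EX F V s y :=
  eventually_eventually_nhds.2 h

theorem SecAt.congr {s t : ∀ x, V x} {x : M} (h : SecAt EX F V s x) (hg : ∀ᶠ y in 𝓝 x, t y = s y) :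
    SecAt EX F V t x := by
  filter_upwards [h, eventually_eventually_nhds.2 hg] with y hy hg
  exact hy.congr_of_eventuallyEq (by filter_upwards [hg] with z hz; rw [hz])

theorem contMDiffOn_iff_secAt {s : ∀ x, V x} {U : Set M} (hU : IsOpen U) :
    ContMDiffOn 𝓘(ℝ, EX) (𝓘(ℝ, EX).prod 𝓘(ℝ, F)) ∞ (fun z => TotalSpace.mk' F z (s z)) U
      ↔ ∀ x ∈ U, SecAt EX F V s x := by
  refine ⟨fun h x hx => ?_, fun h x hx => (h x hx).self_of_nhds.contMDiffWithinAt⟩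
  filter_upwards [hU.mem_nhds hx] with y hy using h.contMDiffAt (hU.mem_nhds hy)

variable [∀ x, AddCommGroup (V x)] [∀ x, Module ℝ (V x)] [VectorBundle ℝ F V]

theorem SecAt.add {s t : ∀ x, V x} {x : M} (hs : SecAt EX F V s x) (ht : SecAt EX F V t x) :
    SecAt EX F V (fun y => s y + t y) x := by
  filter_upwards [hs, ht] with y h1 h2 using h1.add_section h2

theorem SecAt.sub {s t : ∀ x, V x} {x : M} (hs : SecAt EX F V s x) (ht : SecAt EX F V t x) :
    SecAt EX F V (fun y => s y - t y) x := by
  filter_upwards [hs, ht] with y h1 h2 using h1.sub_section h2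

theorem SecAt.smul {f : M → ℝ} {s : ∀ x, V x} {x : M} (hf : FunAt EX f x)
    (hs : SecAt EX F V s x) : SecAt EX F V (fun y => f y • s y) x := by
  filter_upwards [hf, hs] with y h1 h2 using h1.smul_section h2

theorem SecAt.const_smul {s : ∀ x, V x} {x : M} (c : ℝ)
    (hs : SecAt EX F V s x) : SecAt EX F V (fun y => c • s y) x :=
  hs.smul (funAt_const c x)

end Sections

variable [IsManifold 𝓘(ℂ, EX) ω M]

/-- The real vector field `v` is smooth on a neighbourhood of `x`. -/
abbrev VFAt (v : ∀ y : M, TangentSpace 𝓘(ℝ, EX) y) (x : M) : Prop :=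
  SecAt EX EX (fun y : M => TangentSpace 𝓘(ℝ, EX) y) v x

theorem VFAt.mdifferentiableAt {v : ∀ y : M, TangentSpace 𝓘(ℝ, EX) y} {x : M} (h : VFAt v x) :
    MDifferentiableAt 𝓘(ℝ, EX) (𝓘(ℝ, EX).prod 𝓘(ℝ, EX)) (fun y => TotalSpace.mk' EX y (v y)) x :=
  h.self_of_nhds.mdifferentiableAt (by simp)

theorem smoothVF_iff {v : ∀ y : M, TangentSpace 𝓘(ℝ, EX) y} {U : Set M} (hU : IsOpen U) :
    SmoothVF EX U v ↔ ∀ x ∈ U, VFAt v x := contMDiffOn_iff_secAt hU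

/-- The derivative along a field is the fibre component of the tangent map of `f` composed with the
field, and both are smooth. -/
theorem FunAt.dAct {G : Type*} [NormedAddCommGroup G] [NormedSpace ℝ G] {f : M → G}
    {v : ∀ y : M, TangentSpace 𝓘(ℝ, EX) y} {x : M} (hf : FunAt EX f x) (hv : VFAt v x) :
    FunAt EX (fun y => HolGauge.dAct f (v y)) x := by
  obtain ⟨U, hU, hUo, hxU⟩ := eventually_nhds_iff.1 (hf.and hv)
  have h1 : ContMDiffOn 𝓘(ℝ, EX) 𝓘(ℝ, G) ∞ f U := fun y hy => (hU y hy).1.contMDiffWithinAt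
  have h2 : ContMDiffOn 𝓘(ℝ, EX) (𝓘(ℝ, EX).prod 𝓘(ℝ, EX)) ∞
    (fun y => TotalSpace.mk' EX y (v y)) U := fun y hy => (hU y hy).2.contMDiffWithinAt
  have h3 := h1.contMDiffOn_tangentMapWithin (m := ∞) (by simp) hUo.uniqueMDiffOn
  have h4 := (contMDiff_snd_tangentBundle_modelSpace G 𝓘(ℝ, G) (n := ∞)).comp_contMDiffOn
    (h3.comp h2 fun y hy => hy)
  filter_upwards [hUo.mem_nhds hxU] with y hy
  refine (h4.contMDiffAt (hUo.mem_nhds hy)).congr_of_eventuallyEq ?_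
  filter_upwards [hUo.mem_nhds hy] with z hz
  have := mfderivWithin_of_isOpen (I := 𝓘(ℝ, EX)) (I' := 𝓘(ℝ, G)) (f := f) hUo hz
  exact (congrArg (fun L : EX →L[ℝ] G => L (v z)) this).symm

theorem VFAt.lie [FiniteDimensional ℂ EX] {v w : ∀ y : M, TangentSpace 𝓘(ℝ, EX) y} {x : M}
    (hv : VFAt v x) (hw : VFAt w x) : VFAt (mlieBracket 𝓘(ℝ, EX) v w) x := by
  have : CompleteSpace EX := FiniteDimensional.complete ℂ EX
  -- The bracket costs one derivative, which is harmless as ∞ + 1 is ∞.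
  have : IsManifold 𝓘(ℝ, EX) ((⊤ : ℕ∞) + 1) M := inferInstanceAs (IsManifold 𝓘(ℝ, EX) ∞ M)
  have : IsManifold 𝓘(ℝ, EX) (minSmoothness ℝ 2) M := by
    rw [minSmoothness_of_isRCLikeNormedField]; infer_instance
  filter_upwards [hv, hw] with y h1 h2
  exact ContMDiffAt.mlieBracket_vectorField (m := ⊤) (n := ⊤) h1 h2 (by simp)

theorem hasMFDerivAt_real {G : Type*} [NormedAddCommGroup G] [NormedSpace ℂ G] {f : M → G} {x : M}
    (hf : MDifferentiableAt 𝓘(ℂ, EX) 𝓘(ℂ, G) f x) (v : TangentSpace 𝓘(ℝ, EX) x) :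
    dAct f v = (mfderiv 𝓘(ℂ, EX) 𝓘(ℂ, G) f x : EX →L[ℂ] G) v := by
  have h : HasMFDerivAt 𝓘(ℝ, EX) 𝓘(ℝ, G) f x
      ((mfderiv 𝓘(ℂ, EX) 𝓘(ℂ, G) f x : EX →L[ℂ] G).restrictScalars ℝ) :=
    ⟨hf.hasMFDerivAt.1, HasFDerivWithinAt.restrictScalars ℝ hf.hasMFDerivAt.2⟩
  exact congrArg (fun L : EX →L[ℝ] G => L v) h.mfderiv

/-- The Cauchy–Riemann equations: the real derivative of a complex differentiable map is its complex
derivative. -/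
theorem dAct_jT {G : Type*} [NormedAddCommGroup G] [NormedSpace ℂ G] {f : M → G} {x : M}
    (hf : MDifferentiableAt 𝓘(ℂ, EX) 𝓘(ℂ, G) f x) (v : TangentSpace 𝓘(ℝ, EX) x) :
    dAct f (jT EX x v) = Complex.I • dAct f v := by
  rw [hasMFDerivAt_real hf, hasMFDerivAt_real hf]
  exact (mfderiv 𝓘(ℂ, EX) 𝓘(ℂ, G) f x : EX →L[ℂ] G).map_smul Complex.I v

theorem mdifferentiableAt_chart {x y : M} (hy : y ∈ (chartAt EX x).source) :
    MDifferentiableAt 𝓘(ℂ, EX) 𝓘(ℂ, EX) (extChartAt 𝓘(ℝ, EX) x) y :=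
  mdifferentiableAt_extChartAt (I := 𝓘(ℂ, EX)) hy

theorem trivializationAt_tangent_apply {x y : M} (hy : y ∈ (chartAt EX x).source)
    (v : TangentSpace 𝓘(ℝ, EX) y) :
    (trivializationAt EX (fun y : M => TangentSpace 𝓘(ℝ, EX) y) x ⟨y, v⟩).2
      = dAct (extChartAt 𝓘(ℝ, EX) x) v := by
  have h := TangentBundle.continuousLinearMapAt_trivializationAt (I := 𝓘(ℝ, EX)) hy
  refine Eq.trans ?_ (congrArg (fun L : EX →L[ℝ] EX => L v) h)
  change _ = (trivializationAt EX (fun y : M => TangentSpace 𝓘(ℝ, EX) y) x).linearMapAt ℝ y v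
  rw [Trivialization.linearMapAt_apply, if_pos]
  simpa using hy

theorem contMDiffAt_vectorField_iff {v : ∀ y : M, TangentSpace 𝓘(ℝ, EX) y} {x : M} :
    ContMDiffAt 𝓘(ℝ, EX) (𝓘(ℝ, EX).prod 𝓘(ℝ, EX)) ∞ (fun y => TotalSpace.mk' EX y (v y)) x ↔
      ContMDiffAt 𝓘(ℝ, EX) 𝓘(ℝ, EX) ∞ (fun y => dAct (extChartAt 𝓘(ℝ, EX) x) (v y)) x := by
  rw [contMDiffAt_section]
  refine Filter.EventuallyEq.contMDiffAt_iff ?_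
  filter_upwards [(chartAt EX x).open_source.mem_nhds (mem_chart_source EX x)] with y hy
  exact trivializationAt_tangent_apply hy (v y)

/-- The charts are holomorphic, so in each of them `j` is the constant operator of multiplication by
i. -/
theorem VFAt.jT {v : ∀ y : M, TangentSpace 𝓘(ℝ, EX) y} {x : M} (hv : VFAt v x) :
    VFAt (fun y => HolGauge.jT EX y (v y)) x := by
  filter_upwards [hv] with y h1
  rw [contMDiffAt_vectorField_iff] at h1 ⊢
  have hL : ContDiff ℝ ∞ (fun z : EX => Complex.I • z) := contDiff_id.const_smul Complex.I
  refine (hL.contMDiff.contMDiffAt.comp y h1).congr_of_eventuallyEq ?_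
  filter_upwards [(chartAt EX y).open_source.mem_nhds (mem_chart_source EX y)] with z hz
  exact dAct_jT (mdifferentiableAt_chart hz) (v z)

theorem dAct_chart_self (x : M) (v : TangentSpace 𝓘(ℝ, EX) x) :
    dAct (extChartAt 𝓘(ℝ, EX) x) v = v :=
  congrArg (fun L : EX →L[ℝ] EX => L v) (mfderiv_extChartAt_self (I := 𝓘(ℝ, EX)) (x := x))

end Germs
end HolGauge

end

noncomputable section
namespace HolGauge
open VectorField

/-! ### Real and imaginary parts in the complexification of a vector space. -/

section ComplexifiedSpace

variable {W : Type*} [AddCommGroup W] [Module ℝ W]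

@[simp] theorem cRe_tmul (z : ℂ) (v : W) : cRe (z ⊗ₜ[ℝ] v) = z.re • v := by simp [cRe]

@[simp] theorem cIm_tmul (z : ℂ) (v : W) : cIm (z ⊗ₜ[ℝ] v) = z.im • v := by simp [cIm]

theorem eq_cRe_add_cIm (ξ : ℂ ⊗[ℝ] W) :
    ξ = (1 : ℂ) ⊗ₜ[ℝ] cRe ξ + Complex.I ⊗ₜ[ℝ] cIm ξ := by
  induction ξ using TensorProduct.induction_on with
  | zero => simp
  | tmul z v =>
    rw [cRe_tmul, cIm_tmul, TensorProduct.tmul_smul, TensorProduct.tmul_smul,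
      TensorProduct.smul_tmul', TensorProduct.smul_tmul', ← TensorProduct.add_tmul]
    congr 1
    apply Complex.ext <;> simp
  | add a b ha hb =>
    nth_rewrite 1 [ha, hb]
    simp only [map_add, TensorProduct.tmul_add]
    abel

theorem complexified_ext {ξ η : ℂ ⊗[ℝ] W} (hr : cRe ξ = cRe η) (hi : cIm ξ = cIm η) : ξ = η := by
  rw [eq_cRe_add_cIm ξ, hr, hi, ← eq_cRe_add_cIm]

@[simp] theorem cRe_smul (z : ℂ) (ξ : ℂ ⊗[ℝ] W) :
    cRe (z • ξ) = z.re • cRe ξ - z.im • cIm ξ := by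
  induction ξ using TensorProduct.induction_on with
  | zero => simp
  | tmul w v =>
    simp only [TensorProduct.smul_tmul', cRe_tmul, cIm_tmul, smul_eq_mul, Complex.mul_re]
    module
  | add a b ha hb => simp only [map_add, smul_add, ha, hb]; abel

@[simp] theorem cIm_smul (z : ℂ) (ξ : ℂ ⊗[ℝ] W) :
    cIm (z • ξ) = z.re • cIm ξ + z.im • cRe ξ := by
  induction ξ using TensorProduct.induction_on with
  | zero => simp
  | tmul w v =>
    simp only [TensorProduct.smul_tmul', cRe_tmul, cIm_tmul, smul_eq_mul, Complex.mul_im]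
    module
  | add a b ha hb => simp only [map_add, smul_add, ha, hb]; abel

@[simp] theorem cRe_cConj (ξ : ℂ ⊗[ℝ] W) : cRe (cConj ξ) = cRe ξ := by
  induction ξ using TensorProduct.induction_on with
  | zero => simp
  | tmul w v => simp [cConj]
  | add a b ha hb => simp only [map_add, ha, hb]

@[simp] theorem cIm_cConj (ξ : ℂ ⊗[ℝ] W) : cIm (cConj ξ) = -cIm ξ := by
  induction ξ using TensorProduct.induction_on with
  | zero => simp
  | tmul w v => simp [cConj]
  | add a b ha hb => simp only [map_add, ha, hb]; abel

@[simp] theorem cRe_baseChange {W' : Type*} [AddCommGroup W'] [Module ℝ W'] (L : W →ₗ[ℝ] W')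
    (ξ : ℂ ⊗[ℝ] W) : cRe (L.baseChange ℂ ξ) = L (cRe ξ) := by
  induction ξ using TensorProduct.induction_on with
  | zero => simp
  | tmul w v => simp
  | add a b ha hb => simp only [map_add, ha, hb]

@[simp] theorem cIm_baseChange {W' : Type*} [AddCommGroup W'] [Module ℝ W'] (L : W →ₗ[ℝ] W')
    (ξ : ℂ ⊗[ℝ] W) : cIm (L.baseChange ℂ ξ) = L (cIm ξ) := by
  induction ξ using TensorProduct.induction_on with
  | zero => simp
  | tmul w v => simp
  | add a b ha hb => simp only [map_add, ha, hb]

theorem cConj_smul (z : ℂ) (ξ : ℂ ⊗[ℝ] W) : cConj (z • ξ) = (starRingEnd ℂ z) • cConj ξ := by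
  apply complexified_ext <;> simp
  module

@[simp] theorem cConj_cConj (ξ : ℂ ⊗[ℝ] W) : cConj (cConj ξ) = ξ := by
  apply complexified_ext <;> simp

/-- For ξ = a + ib the eigenvalue equation says ja = -b and jb = a, and the two are equivalent when
j² = -1. Eigenvectors are thus parametrized by their real parts. -/
theorem mem_cEigen_I_iff {j : W →ₗ[ℝ] W} (hj : ∀ v, j (j v) = -v) {ξ : ℂ ⊗[ℝ] W} :
    ξ ∈ cEigen j Complex.I ↔ cIm ξ = -j (cRe ξ) := by
  change j.baseChange ℂ ξ = Complex.I • ξ ↔ _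
  refine ⟨fun h => ?_, fun h => complexified_ext ?_ ?_⟩
  · have := congrArg cRe h
    simp only [cRe_baseChange, cRe_smul, Complex.I_re, Complex.I_im, zero_smul, one_smul,
      zero_sub] at this
    rw [this, neg_neg]
  · simp [h]
  · simp [h, hj]

theorem mem_cEigen_neg_I_iff {j : W →ₗ[ℝ] W} (hj : ∀ v, j (j v) = -v) {ξ : ℂ ⊗[ℝ] W} :
    ξ ∈ cEigen j (-Complex.I) ↔ cIm ξ = j (cRe ξ) := by
  change j.baseChange ℂ ξ = (-Complex.I) • ξ ↔ _
  refine ⟨fun h => ?_, fun h => complexified_ext ?_ ?_⟩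
  · have := congrArg cRe h
    rw [cRe_baseChange, cRe_smul] at this
    simp only [Complex.neg_re, Complex.neg_im, Complex.I_re, Complex.I_im, neg_zero, zero_smul,
      neg_smul, one_smul, zero_sub, neg_neg] at this
    rw [this]
  · simp [h]
  · simp [h, hj]

end ComplexifiedSpace

/-! ### Types (1,0) and (0,1), and smooth complex vector fields. -/

section ComplexTangent

variable {EX : Type*} [NormedAddCommGroup EX] [NormedSpace ℂ EX]
  {M : Type*} [TopologicalSpace M] [ChartedSpace EX M] [IsManifold 𝓘(ℂ, EX) ω M]

theorem mem_T10_iff {x : M} {ξ : CT EX x} : ξ ∈ T10 EX x ↔ cIm ξ = -jT EX x (cRe ξ) :=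
  mem_cEigen_I_iff (jT_jT EX x)

theorem mem_T01_iff {x : M} {ξ : CT EX x} : ξ ∈ T01 EX x ↔ cIm ξ = jT EX x (cRe ξ) :=
  mem_cEigen_neg_I_iff (jT_jT EX x)

theorem cConj_mem_T10 {x : M} {ξ : CT EX x} (h : ξ ∈ T01 EX x) : cConj ξ ∈ T10 EX x := by
  rw [mem_T01_iff] at h
  rw [mem_T10_iff, cIm_cConj, cRe_cConj, h]

theorem cRe_p10 {x : M} (ξ : CT EX x) :
    cRe (p10 EX x ξ : CT EX x) = (1 / 2 : ℝ) • (cRe ξ + jT EX x (cIm ξ)) := by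
  change cRe ((1 / 2 : ℂ) • (ξ - Complex.I • (jT EX x).baseChange ℂ ξ)) = _
  simp

theorem cIm_p10 {x : M} (ξ : CT EX x) :
    cIm (p10 EX x ξ : CT EX x) = (1 / 2 : ℝ) • (cIm ξ - jT EX x (cRe ξ)) := by
  change cIm ((1 / 2 : ℂ) • (ξ - Complex.I • (jT EX x).baseChange ℂ ξ)) = _
  simp

theorem cRe_p01 {x : M} (ξ : CT EX x) :
    cRe (p01 EX x ξ : CT EX x) = (1 / 2 : ℝ) • (cRe ξ - jT EX x (cIm ξ)) := by
  change cRe ((1 / 2 : ℂ) • (ξ + Complex.I • (jT EX x).baseChange ℂ ξ)) = _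
  simp [sub_eq_add_neg]

theorem cIm_p01 {x : M} (ξ : CT EX x) :
    cIm (p01 EX x ξ : CT EX x) = (1 / 2 : ℝ) • (cIm ξ + jT EX x (cRe ξ)) := by
  change cIm ((1 / 2 : ℂ) • (ξ + Complex.I • (jT EX x).baseChange ℂ ξ)) = _
  simp

theorem p10_add_p01 {x : M} (ξ : CT EX x) : (p10 EX x ξ : CT EX x) + p01 EX x ξ = ξ := by
  change (1 / 2 : ℂ) • (ξ - Complex.I • (jT EX x).baseChange ℂ ξ)
    + (1 / 2 : ℂ) • (ξ + Complex.I • (jT EX x).baseChange ℂ ξ) = ξ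
  module

theorem p10_of_mem {x : M} {ξ : CT EX x} (h : ξ ∈ T10 EX x) : (p10 EX x ξ : CT EX x) = ξ := by
  have h' : (jT EX x).baseChange ℂ ξ = Complex.I • ξ := h
  change (1 / 2 : ℂ) • (ξ - Complex.I • (jT EX x).baseChange ℂ ξ) = ξ
  rw [h', smul_smul, Complex.I_mul_I]
  module

theorem p01_of_mem {x : M} {ξ : CT EX x} (h : ξ ∈ T01 EX x) : p01 EX x ξ = ⟨ξ, h⟩ := by
  have h' : (jT EX x).baseChange ℂ ξ = (-Complex.I) • ξ := h
  apply Subtype.ext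
  change (1 / 2 : ℂ) • (ξ + Complex.I • (jT EX x).baseChange ℂ ξ) = ξ
  rw [h', smul_smul, mul_neg, Complex.I_mul_I]
  module

theorem p01_of_mem_T10 {x : M} {ξ : CT EX x} (h : ξ ∈ T10 EX x) : p01 EX x ξ = 0 := by
  apply Subtype.ext
  have := p10_add_p01 ξ
  rw [p10_of_mem h] at this
  simpa using this

theorem p10_of_mem_T01 {x : M} {ξ : CT EX x} (h : ξ ∈ T01 EX x) : p10 EX x ξ = 0 := by
  apply Subtype.ext
  have := p10_add_p01 ξ
  rw [p01_of_mem h] at this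
  simpa using this

/-- The complex vector field `ξ` is smooth on a neighbourhood of `x`. -/
def CVFAt (ξ : ∀ y : M, CT EX y) (x : M) : Prop :=
  VFAt (fun y => cRe (ξ y)) x ∧ VFAt (fun y => cIm (ξ y)) x

theorem smoothCVF_iff {ξ : ∀ y : M, CT EX y} {U : Set M} (hU : IsOpen U) :
    SmoothCVF EX U ξ ↔ ∀ x ∈ U, CVFAt ξ x := by
  unfold SmoothCVF CVFAt
  rw [smoothVF_iff hU, smoothVF_iff hU]
  exact ⟨fun h x hx => ⟨h.1 x hx, h.2 x hx⟩, fun h => ⟨fun x hx => (h x hx).1,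
    fun x hx => (h x hx).2⟩⟩

section

variable {ξ η : ∀ y : M, CT EX y} {x : M}

theorem CVFAt.eventually (h : CVFAt ξ x) : ∀ᶠ y in 𝓝 x, CVFAt ξ y :=
  (SecAt.eventually h.1).and (SecAt.eventually h.2)

theorem CVFAt.congr (h : CVFAt ξ x) (hη : ∀ᶠ y in 𝓝 x, η y = ξ y) : CVFAt η x :=
  ⟨SecAt.congr h.1 (hη.mono fun y hy => by rw [hy]),
    SecAt.congr h.2 (hη.mono fun y hy => by rw [hy])⟩

theorem CVFAt.add (hξ : CVFAt ξ x) (hη : CVFAt η x) : CVFAt (fun y => ξ y + η y) x := by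
  simp only [CVFAt, map_add]
  exact ⟨SecAt.add hξ.1 hη.1, SecAt.add hξ.2 hη.2⟩

theorem FunAt.re {f : M → ℂ} (hf : FunAt EX f x) : FunAt EX (fun y => (f y).re) x :=
  hf.clm Complex.reCLM

theorem FunAt.im {f : M → ℂ} (hf : FunAt EX f x) : FunAt EX (fun y => (f y).im) x :=
  hf.clm Complex.imCLM

theorem CVFAt.smul {f : M → ℂ} (hf : FunAt EX f x) (hξ : CVFAt ξ x) :
    CVFAt (fun y => f y • ξ y) x := by
  simp only [CVFAt, cRe_smul, cIm_smul]
  exact ⟨SecAt.sub (SecAt.smul hf.re hξ.1) (SecAt.smul hf.im hξ.2),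
    SecAt.add (SecAt.smul hf.re hξ.2) (SecAt.smul hf.im hξ.1)⟩

theorem CVFAt.sub (hξ : CVFAt ξ x) (hη : CVFAt η x) : CVFAt (fun y => ξ y - η y) x := by
  simp only [CVFAt, map_sub]
  exact ⟨SecAt.sub hξ.1 hη.1, SecAt.sub hξ.2 hη.2⟩

theorem VFAt.ofReal {v : ∀ y : M, TangentSpace 𝓘(ℝ, EX) y} (hv : VFAt v x) :
    CVFAt (fun y => (1 : ℂ) ⊗ₜ[ℝ] v y) x := by
  have h : VFAt (fun y : M => (0 : TangentSpace 𝓘(ℝ, EX) y)) x :=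
    Eventually.of_forall fun y => contMDiff_zeroSection ℝ (TangentSpace 𝓘(ℝ, EX)) y
  simp only [CVFAt, cRe_tmul, cIm_tmul, Complex.one_re, Complex.one_im, one_smul, zero_smul]
  exact ⟨hv, h⟩

theorem CVFAt.conj (hξ : CVFAt ξ x) : CVFAt (fun y => cConj (ξ y)) x := by
  simp only [CVFAt, cRe_cConj, cIm_cConj]
  refine ⟨hξ.1, (SecAt.const_smul (-1) hξ.2).congr (Eventually.of_forall fun y => ?_)⟩
  rw [neg_one_smul]

theorem CVFAt.p01 (hξ : CVFAt ξ x) : CVFAt (fun y => (HolGauge.p01 EX y (ξ y) : CT EX y)) x := by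
  simp only [CVFAt, cRe_p01, cIm_p01]
  exact ⟨(SecAt.sub hξ.1 hξ.2.jT).const_smul _, (SecAt.add hξ.2 hξ.1.jT).const_smul _⟩

theorem cRe_cLie (ξ η : ∀ y : M, CT EX y) (x : M) : cRe (cLie EX ξ η x)
    = mlieBracket 𝓘(ℝ, EX) (fun y => cRe (ξ y)) (fun y => cRe (η y)) x
      - mlieBracket 𝓘(ℝ, EX) (fun y => cIm (ξ y)) (fun y => cIm (η y)) x := by
  simp [cLie, cBracket]

theorem cIm_cLie (ξ η : ∀ y : M, CT EX y) (x : M) : cIm (cLie EX ξ η x)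
    = mlieBracket 𝓘(ℝ, EX) (fun y => cRe (ξ y)) (fun y => cIm (η y)) x
      + mlieBracket 𝓘(ℝ, EX) (fun y => cIm (ξ y)) (fun y => cRe (η y)) x := by
  simp [cLie, cBracket]

theorem CVFAt.lie [FiniteDimensional ℂ EX] (hξ : CVFAt ξ x) (hη : CVFAt η x) :
    CVFAt (cLie EX ξ η) x := by
  simp only [CVFAt, cRe_cLie, cIm_cLie]
  exact ⟨SecAt.sub (hξ.1.lie hη.1) (hξ.2.lie hη.2), SecAt.add (hξ.1.lie hη.2) (hξ.2.lie hη.1)⟩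

end

/-! ### Complex tangent vectors as derivations. -/

section Action

variable {x : M} {f g : M → ℂ}

theorem cAct_eq (ξ : CT EX x) (f : M → ℂ) :
    cAct EX ξ f = dAct f (cRe ξ) + Complex.I * dAct f (cIm ξ) := by
  conv_lhs => rw [eq_cRe_add_cIm ξ]
  unfold cAct cDiff
  rw [map_add, LinearMap.liftBaseChange_tmul, LinearMap.liftBaseChange_tmul, one_smul, smul_eq_mul]
  rfl

theorem cAct_map_add (ξ η : CT EX x) (f : M → ℂ) :
    cAct EX (ξ + η) f = cAct EX ξ f + cAct EX η f := map_add _ _ _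

theorem cAct_map_smul (z : ℂ) (ξ : CT EX x) (f : M → ℂ) :
    cAct EX (z • ξ) f = z * cAct EX ξ f := map_smul _ _ _

theorem cAct_map_neg (ξ : CT EX x) (f : M → ℂ) : cAct EX (-ξ) f = -cAct EX ξ f := map_neg _ _

theorem cAct_congr (ξ : CT EX x) (h : f =ᶠ[𝓝 x] g) : cAct EX ξ f = cAct EX ξ g := by
  rw [cAct_eq, cAct_eq, dAct_congr h, dAct_congr h]

theorem cAct_const (ξ : CT EX x) (c : ℂ) : cAct EX ξ (fun _ : M => c) = 0 := by
  rw [cAct_eq, dAct_const, dAct_const, mul_zero, add_zero]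

theorem cAct_add (ξ : CT EX x) (hf : FunAt EX f x) (hg : FunAt EX g x) :
    cAct EX ξ (fun y => f y + g y) = cAct EX ξ f + cAct EX ξ g := by
  simp only [cAct_eq, dAct_add hf hg]; ring

theorem cAct_mul (ξ : CT EX x) (hf : FunAt EX f x) (hg : FunAt EX g x) :
    cAct EX ξ (fun y => f y * g y) = cAct EX ξ f * g x + f x * cAct EX ξ g := by
  simp only [cAct_eq, dAct_mul hf hg]; ring

theorem cAct_const_mul (ξ : CT EX x) (c : ℂ) (hg : FunAt EX g x) :
    cAct EX ξ (fun y => c * g y) = c * cAct EX ξ g := by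
  rw [cAct_mul ξ (funAt_const c x) hg, cAct_const, zero_mul, zero_add]

theorem cAct_sub (ξ : CT EX x) (hf : FunAt EX f x) (hg : FunAt EX g x) :
    cAct EX ξ (fun y => f y - g y) = cAct EX ξ f - cAct EX ξ g := by
  have h : (fun y => f y - g y) = fun y => f y + (-1 : ℂ) * g y := by ext y; ring
  have hg' : FunAt EX (fun y => (-1 : ℂ) * g y) x := (funAt_const _ x).mul hg
  rw [h, cAct_add ξ hf hg', cAct_const_mul ξ _ hg]
  ring

theorem cAct_conj (ξ : CT EX x) (hf : FunAt EX f x) :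
    cAct EX (cConj ξ) (fun y => starRingEnd ℂ (f y)) = starRingEnd ℂ (cAct EX ξ f) := by
  have h : ∀ v : TangentSpace 𝓘(ℝ, EX) x,
      dAct (fun y => starRingEnd ℂ (f y)) v = starRingEnd ℂ (dAct f v) :=
    fun v => dAct_clm hf Complex.conjCLE.toContinuousLinearMap v
  have hn : ∀ v : TangentSpace 𝓘(ℝ, EX) x, dAct f (-v) = -dAct f v := fun v => by
    rw [← neg_one_smul ℝ v, dAct_map_smul, neg_one_smul]
  rw [cAct_eq, cAct_eq, cRe_cConj, cIm_cConj, h, h, hn]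
  simp

theorem FunAt.conj (hf : FunAt EX f x) : FunAt EX (fun y => starRingEnd ℂ (f y)) x :=
  hf.clm Complex.conjCLE.toContinuousLinearMap

theorem FunAt.cAct {ξ : ∀ y : M, CT EX y} (hf : FunAt EX f x) (hξ : CVFAt ξ x) :
    FunAt EX (fun y => HolGauge.cAct EX (ξ y) f) x := by
  simp only [cAct_eq]
  exact (hf.dAct hξ.1).add ((funAt_const _ x).mul (hf.dAct hξ.2))

/-- The complex bilinear extension of `dAct_mlieBracket`: the minus sign in the real part of the
bracket is i² in the composition of the two derivations. -/
theorem cAct_cLie [FiniteDimensional ℂ EX] {ξ η : ∀ y : M, CT EX y} (hξ : CVFAt ξ x)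
    (hη : CVFAt η x) (hf : FunAt EX f x) :
    cAct EX (cLie EX ξ η x) f
      = cAct EX (ξ x) (fun y => cAct EX (η y) f) - cAct EX (η x) (fun y => cAct EX (ξ y) f) := by
  have : CompleteSpace EX := FiniteDimensional.complete ℂ EX
  have key : ∀ {v w : ∀ y : M, TangentSpace 𝓘(ℝ, EX) y}, VFAt v x → VFAt w x →
      dAct f (mlieBracket 𝓘(ℝ, EX) v w x)
        = dAct (fun y => dAct f (w y)) (v x) - dAct (fun y => dAct f (v y)) (w x) :=
    fun hv hw => dAct_mlieBracket hf.contMDiffAt hv.mdifferentiableAt hw.mdifferentiableAt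
  have exp : ∀ {η : ∀ y : M, CT EX y} (_ : CVFAt η x) (v : TangentSpace 𝓘(ℝ, EX) x),
      dAct (fun y => cAct EX (η y) f) v = dAct (fun y => dAct f (cRe (η y))) v
        + Complex.I * dAct (fun y => dAct f (cIm (η y))) v := by
    intro η hη v
    simp only [cAct_eq]
    rw [dAct_add (hf.dAct hη.1) ((funAt_const _ x).mul (hf.dAct hη.2)),
      dAct_mul (funAt_const _ x) (hf.dAct hη.2), dAct_const, zero_mul, zero_add]
  have hsub : ∀ v w : TangentSpace 𝓘(ℝ, EX) x, dAct f (v - w) = dAct f v - dAct f w :=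
    fun v w => map_sub (mfderiv 𝓘(ℝ, EX) 𝓘(ℝ, ℂ) f x) v w
  rw [cAct_eq, cRe_cLie, cIm_cLie, hsub, dAct_map_add, key hξ.1 hη.1, key hξ.2 hη.2,
    key hξ.1 hη.2, key hξ.2 hη.1, cAct_eq (ξ x), cAct_eq (η x), exp hη, exp hη, exp hξ, exp hξ]
  linear_combination (dAct (fun y => dAct f (cIm (η y))) (cIm (ξ x))
    - dAct (fun y => dAct f (cIm (ξ y))) (cIm (η x))) * (-Complex.I_mul_I)

theorem contMDiffAt_chart (x : M) : FunAt EX (extChartAt 𝓘(ℝ, EX) x) x := by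
  filter_upwards [(chartAt EX x).open_source.mem_nhds (mem_chart_source EX x)] with y hy
  exact contMDiffAt_extChartAt' hy

/-- Real linear functionals of the preferred chart serve as test functions: at the centre their
derivatives are the functionals themselves, and these separate points. Identities between vector
fields become identities between derivations. -/
theorem cAct_ext {ξ η : CT EX x} (h : ∀ f, FunAt EX f x → cAct EX ξ f = cAct EX η f) : ξ = η := by
  have key : ∀ ℓ : EX →L[ℝ] ℝ, ℓ (cRe ξ : TangentSpace 𝓘(ℝ, EX) x) = ℓ (cRe η : TangentSpace 𝓘(ℝ, EX) x)
      ∧ ℓ (cIm ξ : TangentSpace 𝓘(ℝ, EX) x) = ℓ (cIm η : TangentSpace 𝓘(ℝ, EX) x) := by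
    intro ℓ
    have hv : ∀ v : TangentSpace 𝓘(ℝ, EX) x,
        dAct (fun y => (Complex.ofRealCLM ∘L ℓ) (extChartAt 𝓘(ℝ, EX) x y)) v = (ℓ v : ℂ) :=
      fun v => by
        rw [dAct_clm (contMDiffAt_chart x), dAct_chart_self]; rfl
    have := h _ ((contMDiffAt_chart x).clm (Complex.ofRealCLM ∘L ℓ))
    rw [cAct_eq, cAct_eq, hv, hv, hv, hv] at this
    have h1 := congrArg Complex.re this
    have h2 := congrArg Complex.im this
    simp at h1 h2
    exact ⟨h1, h2⟩
  apply complexified_ext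
  · exact (SeparatingDual.eq_iff_forall_dual_eq (R := ℝ) (V := EX)).2 fun ℓ => (key ℓ).1
  · exact (SeparatingDual.eq_iff_forall_dual_eq (R := ℝ) (V := EX)).2 fun ℓ => (key ℓ).2

theorem cAct_eq_zero_of_mem_T01 {ξ : CT EX x} (hξ : ξ ∈ T01 EX x)
    (hf : MDifferentiableAt 𝓘(ℂ, EX) 𝓘(ℂ, ℂ) f x) : cAct EX ξ f = 0 := by
  rw [cAct_eq, mem_T01_iff.1 hξ, dAct_jT hf, smul_eq_mul, ← mul_assoc, Complex.I_mul_I]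
  ring

/-- Complex linear functionals ℓ of the chart are holomorphic test functions. From ℓ(Re ξ) + iℓ(Im
ξ) = 0 follows ℓ(Im ξ) = iℓ(Re ξ) = ℓ(j Re ξ) for all ℓ. So the (0,1)-vectors are exactly those that
annihilate holomorphic functions. -/
theorem mem_T01_of_cAct {ξ : CT EX x} (h : ∀ f : M → ℂ, FunAt EX f x →
    (∀ᶠ y in 𝓝 x, MDifferentiableAt 𝓘(ℂ, EX) 𝓘(ℂ, ℂ) f y) → cAct EX ξ f = 0) :
    ξ ∈ T01 EX x := by
  have key : ∀ ℓ : EX →L[ℂ] ℂ, ℓ (cIm ξ : TangentSpace 𝓘(ℝ, EX) x)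
      = ℓ (jT EX x (cRe ξ)) := by
    intro ℓ
    have hv : ∀ v : TangentSpace 𝓘(ℝ, EX) x,
        dAct (fun y => ℓ (extChartAt 𝓘(ℝ, EX) x y)) v = ℓ v :=
      fun v => by
        have := dAct_clm (contMDiffAt_chart x) (ℓ.restrictScalars ℝ) v
        rw [dAct_chart_self] at this
        exact this
    have := h (fun y => ℓ (extChartAt 𝓘(ℝ, EX) x y))
      ((contMDiffAt_chart x).clm (ℓ.restrictScalars ℝ)) (by
        filter_upwards [(chartAt EX x).open_source.mem_nhds (mem_chart_source EX x)] with y hy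
        exact ℓ.differentiableAt.mdifferentiableAt.comp y (mdifferentiableAt_chart hy))
    rw [cAct_eq, hv, hv] at this
    have hj : ℓ (jT EX x (cRe ξ)) = Complex.I * ℓ (cRe ξ : TangentSpace 𝓘(ℝ, EX) x) :=
      ℓ.map_smul Complex.I (cRe ξ : TangentSpace 𝓘(ℝ, EX) x)
    rw [hj]
    linear_combination (-Complex.I) * this - ℓ (cIm ξ : TangentSpace 𝓘(ℝ, EX) x) * (-Complex.I_mul_I)
  rw [mem_T01_iff]
  exact (SeparatingDual.eq_iff_forall_dual_eq (R := ℂ) (V := EX)).2 key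

end Action

/-! ### Bracket identities for complex vector fields, and integrability. -/

section LieBracket

variable [FiniteDimensional ℂ EX] {x : M} {ξ ξ' η ζ : ∀ y : M, CT EX y}

theorem cLie_congr (hξ : ∀ᶠ y in 𝓝 x, ξ y = ξ' y) (hη : ∀ᶠ y in 𝓝 x, η y = ζ y) :
    cLie EX ξ η x = cLie EX ξ' ζ x := by
  have h1 : (fun y => cRe (ξ y)) =ᶠ[𝓝 x] fun y => cRe (ξ' y) := hξ.mono fun y h => by simp only [h]
  have h2 : (fun y => cIm (ξ y)) =ᶠ[𝓝 x] fun y => cIm (ξ' y) := hξ.mono fun y h => by simp only [h]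
  have h3 : (fun y => cRe (η y)) =ᶠ[𝓝 x] fun y => cRe (ζ y) := hη.mono fun y h => by simp only [h]
  have h4 : (fun y => cIm (η y)) =ᶠ[𝓝 x] fun y => cIm (ζ y) := hη.mono fun y h => by simp only [h]
  apply complexified_ext
  · rw [cRe_cLie, cRe_cLie]
    exact congrArg₂ (· - ·) (EventuallyEq.mlieBracket_vectorField_eq h1 h3)
      (EventuallyEq.mlieBracket_vectorField_eq h2 h4)
  · rw [cIm_cLie, cIm_cLie]
    exact congrArg₂ (· + ·) (EventuallyEq.mlieBracket_vectorField_eq h1 h4)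
      (EventuallyEq.mlieBracket_vectorField_eq h2 h3)

theorem cLie_swap (hξ : CVFAt ξ x) (hη : CVFAt η x) : cLie EX ξ η x = -cLie EX η ξ x := by
  refine cAct_ext fun f hf => ?_
  rw [cAct_map_neg, cAct_cLie hξ hη hf, cAct_cLie hη hξ hf]
  ring

theorem cLie_add_left (hξ : CVFAt ξ x) (hξ' : CVFAt ξ' x) (hη : CVFAt η x) :
    cLie EX (fun y => ξ y + ξ' y) η x = cLie EX ξ η x + cLie EX ξ' η x := by
  refine cAct_ext fun f hf => ?_
  rw [cAct_map_add, cAct_cLie hξ hη hf, cAct_cLie hξ' hη hf, cAct_cLie (hξ.add hξ') hη hf]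
  simp only [cAct_map_add]
  rw [cAct_add _ (hf.cAct hξ) (hf.cAct hξ')]
  ring

theorem cLie_smul_right {f : M → ℂ} (hf : FunAt EX f x) (hξ : CVFAt ξ x) (hη : CVFAt η x) :
    cLie EX ξ (fun y => f y • η y) x = cAct EX (ξ x) f • η x + f x • cLie EX ξ η x := by
  refine cAct_ext fun g hg => ?_
  rw [cAct_map_add, cAct_map_smul, cAct_map_smul, cAct_cLie hξ hη hg, cAct_cLie hξ (hη.smul hf) hg]
  simp only [cAct_map_smul]
  rw [cAct_mul _ hf (hg.cAct hη)]
  ring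

/-- As derivations, both sides are the same signed sums of triple compositions. The inner brackets
stand under a further derivative and so have to be expanded on a whole neighbourhood. -/
theorem cLie_jacobi (hξ : CVFAt ξ x) (hη : CVFAt η x) (hζ : CVFAt ζ x) :
    cLie EX ξ (cLie EX η ζ) x = cLie EX (cLie EX ξ η) ζ x + cLie EX η (cLie EX ξ ζ) x := by
  refine cAct_ext fun f hf => ?_
  have e : ∀ {ξ η ζ : ∀ y : M, CT EX y}, CVFAt ξ x → CVFAt η x → CVFAt ζ x →
      cAct EX (ξ x) (fun y => cAct EX (cLie EX η ζ y) f)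
        = cAct EX (ξ x) (fun y => cAct EX (η y) (fun z => cAct EX (ζ z) f))
          - cAct EX (ξ x) (fun y => cAct EX (ζ y) (fun z => cAct EX (η z) f)) := by
    intro ξ η ζ hξ hη hζ
    rw [← cAct_sub _ ((hf.cAct hζ).cAct hη) ((hf.cAct hη).cAct hζ)]
    refine cAct_congr _ ?_
    filter_upwards [hη.eventually, hζ.eventually, hf.eventually] with y h1 h2 h3
    exact cAct_cLie h1 h2 h3
  rw [cAct_map_add, cAct_cLie hξ (hη.lie hζ) hf, cAct_cLie (hξ.lie hη) hζ hf,
    cAct_cLie hη (hξ.lie hζ) hf, e hξ hη hζ, e hζ hξ hη, e hη hξ hζ,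
    cAct_cLie hη hζ (hf.cAct hξ), cAct_cLie hξ hη (hf.cAct hζ), cAct_cLie hξ hζ (hf.cAct hη)]
  ring

/-- Conjugation of derivations: the conjugate of ξ acts on f as the conjugate of ξ acting on the
conjugate of f. -/
theorem cLie_conj (hξ : CVFAt ξ x) (hη : CVFAt η x) :
    cLie EX (fun y => cConj (ξ y)) (fun y => cConj (η y)) x = cConj (cLie EX ξ η x) := by
  refine cAct_ext fun f hf => ?_
  have key : ∀ {ξ : ∀ y : M, CT EX y} {f : M → ℂ} {y : M}, FunAt EX f y →
      cAct EX (cConj (ξ y)) f = starRingEnd ℂ (cAct EX (ξ y) fun z => starRingEnd ℂ (f z)) := by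
    intro ξ f y hf
    rw [← cAct_conj _ hf.conj]
    simp
  have key2 : ∀ {ξ η : ∀ y : M, CT EX y}, CVFAt ξ x → CVFAt η x →
      cAct EX (cConj (ξ x)) (fun y => cAct EX (cConj (η y)) f)
        = starRingEnd ℂ (cAct EX (ξ x) fun y => cAct EX (η y) fun z => starRingEnd ℂ (f z)) := by
    intro ξ η hξ hη
    rw [key (hf.cAct hη.conj)]
    congr 1
    refine cAct_congr _ ?_
    filter_upwards [hf.eventually] with y hy
    rw [key hy, Complex.conj_conj]
  rw [cAct_cLie hξ.conj hη.conj hf, key hf, cAct_cLie hξ hη hf.conj, key2 hξ hη, key2 hη hξ, map_sub]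

theorem cLie_ofReal {v w : ∀ y : M, TangentSpace 𝓘(ℝ, EX) y} (hv : VFAt v x) (hw : VFAt w x) :
    cLie EX (fun y => (1 : ℂ) ⊗ₜ[ℝ] v y) (fun y => (1 : ℂ) ⊗ₜ[ℝ] w y) x
      = (1 : ℂ) ⊗ₜ[ℝ] mlieBracket 𝓘(ℝ, EX) v w x := by
  have : CompleteSpace EX := FiniteDimensional.complete ℂ EX
  refine cAct_ext fun f hf => ?_
  have h0 : ∀ (y : M) (v : TangentSpace 𝓘(ℝ, EX) y) (f : M → ℂ),
      cAct EX ((1 : ℂ) ⊗ₜ[ℝ] v) f = dAct f v := fun y v f => by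
    rw [cAct_eq]
    simp only [cRe_tmul, cIm_tmul, Complex.one_re, Complex.one_im, one_smul, zero_smul]
    rw [show dAct f (0 : TangentSpace 𝓘(ℝ, EX) y) = 0 from
      map_zero (mfderiv 𝓘(ℝ, EX) 𝓘(ℝ, ℂ) f y), mul_zero, add_zero]
  rw [cAct_cLie hv.ofReal hw.ofReal hf]
  simp only [h0]
  exact (dAct_mlieBracket hf.contMDiffAt hv.mdifferentiableAt hw.mdifferentiableAt).symm

/-- Integrability: if two fields annihilate holomorphic functions, then so does their commutator,
and this characterizes type (0,1). -/
theorem cLie_mem_T01 (hξ : CVFAt ξ x) (hη : CVFAt η x) (h1 : ∀ᶠ y in 𝓝 x, ξ y ∈ T01 EX y)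
    (h2 : ∀ᶠ y in 𝓝 x, η y ∈ T01 EX y) : cLie EX ξ η x ∈ T01 EX x := by
  refine mem_T01_of_cAct fun f hf hol => ?_
  have h : ∀ {ξ η : ∀ y : M, CT EX y}, (∀ᶠ y in 𝓝 x, η y ∈ T01 EX y) →
      cAct EX (ξ x) (fun y => cAct EX (η y) f) = 0 := by
    intro ξ η h2
    rw [← cAct_const (ξ x) 0]
    refine cAct_congr _ ?_
    filter_upwards [h2, hol] with y hy hh using cAct_eq_zero_of_mem_T01 hy hh
  rw [cAct_cLie hξ hη hf, h h2, h h1, sub_zero]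

theorem cLie_mem_T10 (hξ : CVFAt ξ x) (hη : CVFAt η x) (h1 : ∀ᶠ y in 𝓝 x, ξ y ∈ T10 EX y)
    (h2 : ∀ᶠ y in 𝓝 x, η y ∈ T10 EX y) : cLie EX ξ η x ∈ T10 EX x := by
  have h := cLie_mem_T01 hξ.conj hη.conj (h1.mono fun y hy => cConj_mem_T01 EX hy)
    (h2.mono fun y hy => cConj_mem_T01 EX hy)
  rw [cLie_conj hξ hη] at h
  simpa using cConj_mem_T10 h

end LieBracket

end ComplexTangent

end HolGauge

end

noncomputable section
namespace HolGauge
open VectorField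

/-! ### Elements of D_ℂE as operators on germs of sections. -/

section LocalSections

variable {EX : Type*} [NormedAddCommGroup EX] [NormedSpace ℂ EX] [FiniteDimensional ℂ EX]
  {M : Type*} [TopologicalSpace M] [T2Space M] [ChartedSpace EX M] [IsManifold 𝓘(ℂ, EX) ω M]

/-- The source of all cut-off functions. Hausdorffness is needed for a bump function in a chart,
extended by zero, to be smooth on all of `M`. -/
theorem exists_bump {x : M} {s : Set M} (hs : s ∈ 𝓝 x) :
    ∃ χ : M → ℝ, ContMDiff 𝓘(ℝ, EX) 𝓘(ℝ, ℝ) ∞ χ ∧ χ =ᶠ[𝓝 x] 1 ∧ tsupport χ ⊆ s := by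
  obtain ⟨f, -, hf⟩ :=
    (SmoothBumpFunction.nhds_basis_tsupport (I := 𝓘(ℝ, EX)) x).mem_iff.1 hs
  exact ⟨f, f.contMDiff, f.eventuallyEq_one, hf⟩

theorem exists_fun_germ {f : M → ℂ} {x : M} (hf : FunAt EX f x) :
    ∃ g : M → ℂ, ContMDiff 𝓘(ℝ, EX) 𝓘(ℝ, ℂ) ∞ g ∧ g =ᶠ[𝓝 x] f := by
  obtain ⟨χ, hχ, h1, hs⟩ := exists_bump (EX := EX) hf
  refine ⟨fun y => χ y • f y, contMDiff_of_tsupport fun y hy => ?_, ?_⟩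
  · exact hχ.contMDiffAt.smul (hs (tsupport_smul_subset_left _ _ hy))
  · filter_upwards [h1] with y hy
    rw [hy, Pi.one_apply, one_smul]

variable {F : Type*} [NormedAddCommGroup F] [NormedSpace ℂ F]
  {V : M → Type*} [TopologicalSpace (TotalSpace F V)]
  [∀ x, AddCommGroup (V x)] [∀ x, Module ℂ (V x)] [∀ x, TopologicalSpace (V x)]
  [FiberBundle F V] [VectorBundle ℂ F V]

instance instAddCommGroupSec : AddCommGroup (Sec EX F V) := Submodule.addCommGroup _

instance instModuleSec : Module ℂ (Sec EX F V) := Submodule.module _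

instance instAddCommGroupDCfib (x : M) : AddCommGroup (DCfib EX F V x) := Submodule.addCommGroup _

instance instModuleDCfib (x : M) : Module ℂ (DCfib EX F V x) := Submodule.module _

theorem vecBundle_isSmooth_iff {s : ∀ x, V x} {U : Set M} (hU : IsOpen U) :
    (vecBundle EX F V).IsSmooth U s ↔ ∀ x ∈ U, SecAt EX F V s x := contMDiffOn_iff_secAt hU

theorem Sec.secAt (e : Sec EX F V) (x : M) : SecAt EX F V e.1 x :=
  Eventually.of_forall fun y => e.2 y

theorem SecAt.csmul {f : M → ℂ} {s : ∀ x, V x} {x : M} (hf : FunAt EX f x)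
    (hs : SecAt EX F V s x) : SecAt EX F V (fun y => f y • s y) x := by
  filter_upwards [hf, hs] with x₀ hf h
  rw [contMDiffAt_section] at h ⊢
  set e := trivializationAt F V x₀ with he
  have h2 : ContMDiffAt 𝓘(ℝ, EX) 𝓘(ℝ, F) ∞ (fun x => f x • (e ⟨x, s x⟩).2) x₀ := by
    have hc : ContDiff ℝ ∞ (fun p : ℂ × F => p.1 • p.2) := contDiff_fst.smul contDiff_snd
    exact hc.contMDiff.contMDiffAt.comp x₀ (hf.prodMk_space h)
  refine h2.congr_of_eventuallyEq ?_
  filter_upwards [e.open_baseSet.mem_nhds (mem_baseSet_trivializationAt F V x₀)] with x hx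
  exact (e.linear ℂ hx).map_smul (f x) (s x)

theorem secAt_zero (x : M) : SecAt EX F V (fun y => (0 : V y)) x :=
  Sec.secAt (0 : Sec EX F V) x

variable [ContMDiffVectorBundle ∞ F V 𝓘(ℝ, EX)]

/-- Elements of `DCfib` act on global sections only; cutting off with a bump function lets them act
on germs. -/
theorem exists_sec_germ {s : ∀ x, V x} {x : M} (hs : SecAt EX F V s x) :
    ∃ e : Sec EX F V, ∀ᶠ y in 𝓝 x, e.1 y = s y := by
  obtain ⟨U, hU, hUo, hxU⟩ := eventually_nhds_iff.1 hs
  obtain ⟨χ, hχ, h1, hsupp⟩ := exists_bump (EX := EX) (hUo.mem_nhds hxU)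
  refine ⟨⟨fun y => χ y • s y, ?_⟩, ?_⟩
  · exact ContMDiffOn.smul_section_of_tsupport hχ.contMDiffOn hUo hsupp
      fun y hy => (hU y hy).contMDiffWithinAt
  · filter_upwards [h1] with y hy
    rw [hy, Pi.one_apply, one_smul]

open Classical in
/-- A global smooth section with the same germ at `x` as `s`, if `s` is smooth around `x`. -/
def secGerm (x : M) (s : ∀ x, V x) : Sec EX F V :=
  if h : SecAt EX F V s x then (exists_sec_germ h).choose else 0

theorem secGerm_eq {s : ∀ x, V x} {x : M} (hs : SecAt EX F V s x) :
    ∀ᶠ y in 𝓝 x, (secGerm x s : Sec EX F V).1 y = s y := by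
  rw [secGerm, dif_pos hs]
  exact (exists_sec_germ hs).choose_spec

/-- The symbol of an element of `D_ℂ E`. -/
abbrev symb {x : M} (D : DCfib EX F V x) : CT EX x := D.1.2

/-- Locality from the Leibniz rule: if d vanishes near x and χ is a bump function supported there
with χ(x) = 1, then χd = 0, so that 0 = D(χd) = σ(D)(χ)d(x) + χ(x)D(d) = D(d). -/
theorem apply_eq_of_germ {x : M} (D : DCfib EX F V x) {e e' : Sec EX F V}
    (h : ∀ᶠ y in 𝓝 x, e.1 y = e'.1 y) : D.1.1 e = D.1.1 e' := by
  rw [← sub_eq_zero, ← map_sub]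
  set d := e - e' with hd
  have hd0 : ∀ᶠ y in 𝓝 x, d.1 y = 0 := by
    filter_upwards [h] with y hy
    change e.1 y - e'.1 y = 0
    rw [hy, sub_self]
  obtain ⟨χ, hχ, h1, hsupp⟩ := exists_bump (EX := EX) hd0
  have hχ' : ContMDiff 𝓘(ℝ, EX) 𝓘(ℝ, ℂ) ∞ (fun y => (χ y : ℂ)) :=
    Complex.ofRealCLM.contDiff.contMDiff.comp hχ
  have hz : Sec.mul EX F V _ hχ' d = 0 := by
    ext y
    change (χ y : ℂ) • d.1 y = 0
    by_cases hy : y ∈ tsupport χ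
    · have : d.1 y = 0 := hsupp hy
      rw [this, smul_zero]
    · rw [image_eq_zero_of_notMem_tsupport hy, Complex.ofReal_zero, zero_smul]
  have h2 := D.2 _ hχ' d
  have hd0' : d.1 x = 0 := hd0.self_of_nhds
  have hχx : χ x = 1 := h1.self_of_nhds
  rw [hz, map_zero, hd0', smul_zero, zero_add, hχx, Complex.ofReal_one, one_smul] at h2
  exact h2.symm

/-- The action of an element of `D_ℂ E` on local sections of `E`. -/
def opAct {x : M} (D : DCfib EX F V x) (s : ∀ y, V y) : V x := D.1.1 (secGerm x s)

section Act

variable {x : M} (D : DCfib EX F V x) {s t : ∀ y, V y}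

theorem opAct_eq (hs : SecAt EX F V s x) {e : Sec EX F V} (he : ∀ᶠ y in 𝓝 x, e.1 y = s y) :
    opAct D s = D.1.1 e := by
  refine apply_eq_of_germ D ?_
  filter_upwards [secGerm_eq hs, he] with y h1 h2 using h1.trans h2.symm

@[simp] theorem opAct_sec (e : Sec EX F V) : opAct D e.1 = D.1.1 e :=
  opAct_eq D (Sec.secAt e x) (Eventually.of_forall fun _ => rfl)

theorem opAct_congr (hs : SecAt EX F V s x) (h : ∀ᶠ y in 𝓝 x, t y = s y) :
    opAct D t = opAct D s := by
  refine opAct_eq D (hs.congr h) ?_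
  filter_upwards [secGerm_eq hs, h] with y h1 h2 using h1.trans h2.symm

theorem opAct_add (hs : SecAt EX F V s x) (ht : SecAt EX F V t x) :
    opAct D (fun y => s y + t y) = opAct D s + opAct D t := by
  rw [opAct_eq D (hs.add ht) (e := secGerm x s + secGerm x t), map_add]
  · rfl
  · filter_upwards [secGerm_eq hs, secGerm_eq ht] with y h1 h2
    exact congrArg₂ (· + ·) h1 h2

theorem opAct_smul {f : M → ℂ} (hf : FunAt EX f x) (hs : SecAt EX F V s x) :
    opAct D (fun y => f y • s y) = cAct EX (symb D) f • s x + f x • opAct D s := by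
  obtain ⟨g, hg, hgf⟩ := exists_fun_germ hf
  rw [opAct_eq D (hs.csmul hf) (e := Sec.mul EX F V g hg (secGerm x s)), D.2 g hg, cAct_congr _ hgf,
    hgf.self_of_nhds, (secGerm_eq hs).self_of_nhds]
  · rfl
  · filter_upwards [secGerm_eq hs, hgf] with y h1 h2
    exact congrArg₂ (· • ·) h2 h1

theorem opAct_sub (hs : SecAt EX F V s x) (ht : SecAt EX F V t x) :
    opAct D (fun y => s y - t y) = opAct D s - opAct D t := by
  rw [opAct_eq D (hs.sub ht) (e := secGerm x s - secGerm x t), map_sub]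
  · rfl
  · filter_upwards [secGerm_eq hs, secGerm_eq ht] with y h1 h2
    exact congrArg₂ (· - ·) h1 h2

theorem opAct_const_smul (c : ℂ) (hs : SecAt EX F V s x) :
    opAct D (fun y => c • s y) = c • opAct D s := by
  rw [opAct_smul D (funAt_const c x) hs, cAct_const, zero_smul, zero_add]

theorem add_opAct (D' : DCfib EX F V x) (s : ∀ y, V y) :
    opAct (D + D') s = opAct D s + opAct D' s := rfl

theorem smul_opAct (c : ℂ) (s : ∀ y, V y) : opAct (c • D) s = c • opAct D s := rfl

theorem neg_opAct (s : ∀ y, V y) : opAct (-D) s = -opAct D s := rfl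

variable {D} in
-- Equality of the symbols is a separate hypothesis because in rank 0 the operator does not
-- determine the symbol.
theorem opAct_ext {D' : DCfib EX F V x}
    (h : ∀ s, SecAt EX F V s x → opAct D s = opAct D' s) (h' : (symb D) = (symb D')) : D = D' := by
  refine Subtype.ext (Prod.ext (LinearMap.ext fun e => ?_) h')
  have := h e.1 (Sec.secAt e x)
  rwa [opAct_sec D, opAct_sec D'] at this

end Act

/-- The local section `P` of `D_ℂ E` is smooth around `x`. -/
def DCAt (P : ∀ y, DCfib EX F V y) (x : M) : Prop :=
  (∀ᶠ y in 𝓝 x, ∀ e : Sec EX F V, SecAt EX F V (fun z => (P z).1.1 e) y) ∧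
    CVFAt (fun y => (symb (P y))) x

/-! ### The commutator bracket of local sections of D_ℂE. -/

section Commutator

variable {x : M} {P P' Q R : ∀ y, DCfib EX F V y} {s : ∀ y, V y}

theorem DCAt.eventually (hP : DCAt P x) : ∀ᶠ y in 𝓝 x, DCAt P y :=
  (eventually_eventually_nhds.2 hP.1).and hP.2.eventually

theorem DCAt.congr (hP : DCAt P x) (h : ∀ᶠ y in 𝓝 x, P' y = P y) : DCAt P' x := by
  refine ⟨?_, hP.2.congr (h.mono fun y hy => by rw [hy])⟩
  filter_upwards [hP.1, eventually_eventually_nhds.2 h] with y h1 h2 e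
  exact (h1 e).congr (h2.mono fun z hz => by rw [hz])

/-- `DCAt` tests smoothness on global sections; the passage to germs replaces `s` by one global
section that agrees with it near `x`, hence also as a germ at each nearby point. -/
theorem DCAt.act (hP : DCAt P x) (hs : SecAt EX F V s x) :
    SecAt EX F V (fun y => opAct (P y) s) x := by
  refine (hP.1.self_of_nhds (secGerm x s)).congr ?_
  filter_upwards [hs.eventually, eventually_eventually_nhds.2 (secGerm_eq hs)] with y h1 h2
  exact opAct_eq (P y) h1 h2

theorem dcAt_of_act (h : ∀ᶠ y in 𝓝 x, ∀ s, SecAt EX F V s y → SecAt EX F V (fun z => opAct (P z) s) y)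
    (h' : CVFAt (fun y => (symb (P y))) x) : DCAt P x := by
  refine ⟨?_, h'⟩
  filter_upwards [h] with y hy e
  have := hy e.1 (Sec.secAt e y)
  simpa using this

theorem DCAt.add (hP : DCAt P x) (hQ : DCAt Q x) : DCAt (fun y => P y + Q y) x := by
  refine dcAt_of_act ?_ (hP.2.add hQ.2)
  filter_upwards [hP.eventually, hQ.eventually] with y h1 h2 s hs
  exact (h1.act hs).add (h2.act hs)

theorem DCAt.sub (hP : DCAt P x) (hQ : DCAt Q x) : DCAt (fun y => P y - Q y) x := by
  refine dcAt_of_act ?_ (hP.2.sub hQ.2)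
  filter_upwards [hP.eventually, hQ.eventually] with y h1 h2 s hs
  exact (h1.act hs).sub (h2.act hs)

theorem DCAt.smul {f : M → ℂ} (hf : FunAt EX f x) (hP : DCAt P x) :
    DCAt (fun y => f y • P y) x := by
  refine dcAt_of_act ?_ (hP.2.smul hf)
  filter_upwards [hP.eventually, hf.eventually] with y h1 h2 s hs
  exact (h1.act hs).csmul h2

theorem DCAt.const_smul (c : ℂ) (hP : DCAt P x) : DCAt (fun y => c • P y) x :=
  hP.smul (funAt_const c x)

/-- The commutator of two sections of `D_ℂ E` which are smooth around `x`. -/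
def commAux (hP : DCAt P x) (hQ : DCAt Q x) : DCfib EX F V x :=
  ⟨({ toFun := fun e => opAct (P x) (fun y => opAct (Q y) e.1) - opAct (Q x) (fun y => opAct (P y) e.1)
      map_add' := fun e e' => by
        have h : ∀ R : ∀ y, DCfib EX F V y, (fun y => opAct (R y) (e + e').1)
            = fun y => opAct (R y) e.1 + opAct (R y) e'.1 := fun R => by
          ext y; simp only [opAct_sec, map_add]
        rw [h, h, opAct_add _ (hQ.act (Sec.secAt e x)) (hQ.act (Sec.secAt e' x)),
          opAct_add _ (hP.act (Sec.secAt e x)) (hP.act (Sec.secAt e' x))]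
        abel
      map_smul' := fun c e => by
        have h : ∀ R : ∀ y, DCfib EX F V y, (fun y => opAct (R y) (c • e).1)
            = fun y => c • opAct (R y) e.1 := fun R => by
          ext y; simp only [opAct_sec, map_smul]
        rw [h, h, opAct_const_smul _ _ (hQ.act (Sec.secAt e x)),
          opAct_const_smul _ _ (hP.act (Sec.secAt e x)), ← smul_sub, RingHom.id_apply] },
    cLie EX (fun y => (symb (P y))) (fun y => (symb (Q y))) x), by
    intro f hf e
    have hfx := funAt_of_contMDiff hf x
    have hex := Sec.secAt e x
    -- In the expansion of P(Q(fe)) the two middle terms, with only one derivative on f, are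
    -- exchanged by swapping P and Q and cancel in the commutator. The first terms combine to the
    -- action of the bracket of the symbols.
    have key : ∀ {P Q : ∀ y, DCfib EX F V y}, DCAt P x → DCAt Q x →
        opAct (P x) (fun y => opAct (Q y) (Sec.mul EX F V f hf e).1)
          = (cAct EX (symb (P x)) (fun y => cAct EX (symb (Q y)) f) • e.1 x
            + cAct EX (symb (Q x)) f • opAct (P x) e.1)
            + (cAct EX (symb (P x)) f • opAct (Q x) e.1
              + f x • opAct (P x) (fun y => opAct (Q y) e.1)) := by
      intro P Q hP hQ
      have h1 : (fun y => opAct (Q y) (Sec.mul EX F V f hf e).1)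
          = fun y => cAct EX (symb (Q y)) f • e.1 y + f y • opAct (Q y) e.1 := by
        ext y
        exact opAct_smul (Q y) (funAt_of_contMDiff hf y) (Sec.secAt e y)
      rw [h1, opAct_add _ (hex.csmul (hfx.cAct hQ.2)) ((hQ.act hex).csmul hfx),
        opAct_smul _ (hfx.cAct hQ.2) hex, opAct_smul _ hfx (hQ.act hex)]
    change opAct (P x) (fun y => opAct (Q y) (Sec.mul EX F V f hf e).1)
      - opAct (Q x) (fun y => opAct (P y) (Sec.mul EX F V f hf e).1)
      = cAct EX (cLie EX (fun y => (symb (P y))) (fun y => (symb (Q y))) x) f • e.1 x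
        + f x • (opAct (P x) (fun y => opAct (Q y) e.1) - opAct (Q x) (fun y => opAct (P y) e.1))
    rw [key hP hQ, key hQ hP, cAct_cLie hP.2 hQ.2 hfx]
    module⟩

open Classical in
/-- The commutator bracket on local sections of `D_ℂ E`. -/
def comm (P Q : ∀ y, DCfib EX F V y) (x : M) : DCfib EX F V x :=
  -- The value 0 at points without smoothness is arbitrary.
  if h : DCAt P x ∧ DCAt Q x then commAux h.1 h.2 else 0

theorem comm_act (hP : DCAt P x) (hQ : DCAt Q x) (hs : SecAt EX F V s x) :
    opAct (comm P Q x) s = opAct (P x) (fun y => opAct (Q y) s) - opAct (Q x) (fun y => opAct (P y) s) := by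
  have h : ∀ {P Q : ∀ y, DCfib EX F V y}, DCAt Q x →
      opAct (P x) (fun y => opAct (Q y) s)
        = opAct (P x) (fun y => opAct (Q y) (secGerm x s : Sec EX F V).1) := by
    intro P Q hQ
    refine opAct_congr (P x) (hQ.act (Sec.secAt _ x)) ?_
    filter_upwards [eventually_eventually_nhds.2 (secGerm_eq hs)] with y hy
    exact opAct_congr (Q y) (Sec.secAt _ y) (hy.mono fun z hz => hz.symm)
  rw [h hQ, h hP, comm, dif_pos ⟨hP, hQ⟩]
  rfl

theorem comm_symb (hP : DCAt P x) (hQ : DCAt Q x) :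
    (symb (comm P Q x)) = cLie EX (fun y => (symb (P y))) (fun y => (symb (Q y))) x := by
  rw [comm, dif_pos ⟨hP, hQ⟩]; rfl

theorem isCommC_comm (hP : DCAt P x) (hQ : DCAt Q x) :
    IsCommC (fun y => (P y).1) (fun y => (Q y).1) x (comm P Q x).1 := by
  refine ⟨fun e e₁ e₂ h₁ h₂ => ?_, comm_symb hP hQ⟩
  rw [← opAct_sec, comm_act hP hQ (Sec.secAt e x),
    opAct_eq (P x) (hQ.act (Sec.secAt e x)) (e := e₂) (h₂.mono fun y hy => by rw [hy, opAct_sec]),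
    opAct_eq (Q x) (hP.act (Sec.secAt e x)) (e := e₁) (h₁.mono fun y hy => by rw [hy, opAct_sec])]

theorem DCAt.comm (hP : DCAt P x) (hQ : DCAt Q x) : DCAt (comm P Q) x := by
  refine dcAt_of_act ?_ ((hP.2.lie hQ.2).congr ?_)
  · filter_upwards [hP.eventually, hQ.eventually] with y h1 h2 s hs
    refine ((h1.act (h2.act hs)).sub (h2.act (h1.act hs))).congr ?_
    filter_upwards [h1.eventually, h2.eventually, hs.eventually] with z h1 h2 hs
    exact comm_act h1 h2 hs
  · filter_upwards [hP.eventually, hQ.eventually] with y h1 h2 using comm_symb h1 h2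

theorem comm_congr (hP : DCAt P x) (hQ : DCAt Q x) (h : ∀ᶠ y in 𝓝 x, P' y = P y)
    (h' : ∀ᶠ y in 𝓝 x, R y = Q y) : comm P' R x = comm P Q x := by
  refine opAct_ext (fun s hs => ?_) ?_
  · rw [comm_act (hP.congr h) (hQ.congr h') hs, comm_act hP hQ hs, h.self_of_nhds,
      h'.self_of_nhds, opAct_congr (P x) (hQ.act hs) (h'.mono fun y hy => by rw [hy]),
      opAct_congr (Q x) (hP.act hs) (h.mono fun y hy => by rw [hy])]
  · rw [comm_symb (hP.congr h) (hQ.congr h'), comm_symb hP hQ]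
    exact cLie_congr (h.mono fun y hy => by rw [hy]) (h'.mono fun y hy => by rw [hy])

theorem comm_swap (hP : DCAt P x) (hQ : DCAt Q x) : comm P Q x = -comm Q P x := by
  refine opAct_ext (fun s hs => ?_) ?_
  · rw [neg_opAct, comm_act hP hQ hs, comm_act hQ hP hs, neg_sub]
  · rw [comm_symb hP hQ, cLie_swap hP.2 hQ.2, ← comm_symb hQ hP]; rfl

theorem comm_add_left (hP : DCAt P x) (hP' : DCAt P' x) (hQ : DCAt Q x) :
    comm (fun y => P y + P' y) Q x = comm P Q x + comm P' Q x := by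
  refine opAct_ext (fun s hs => ?_) ?_
  · rw [add_opAct, comm_act hP hQ hs, comm_act hP' hQ hs, comm_act (hP.add hP') hQ hs,
      add_opAct]
    simp only [add_opAct]
    rw [opAct_add (Q x) (hP.act hs) (hP'.act hs)]
    abel
  · rw [comm_symb (hP.add hP') hQ]
    refine (cLie_add_left hP.2 hP'.2 hQ.2).trans ?_
    rw [← comm_symb hP hQ, ← comm_symb hP' hQ]; rfl

theorem comm_smul_right {f : M → ℂ} (hf : FunAt EX f x) (hP : DCAt P x) (hQ : DCAt Q x) :
    comm P (fun y => f y • Q y) x = cAct EX (symb (P x)) f • Q x + f x • comm P Q x := by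
  refine opAct_ext (fun s hs => ?_) ?_
  · rw [add_opAct, smul_opAct, smul_opAct, comm_act hP hQ hs,
      comm_act hP (hQ.smul hf) hs, smul_opAct]
    simp only [smul_opAct]
    rw [opAct_smul (P x) hf (hQ.act hs)]
    module
  · rw [comm_symb hP (hQ.smul hf)]
    refine (cLie_smul_right hf hP.2 hQ.2).trans ?_
    rw [← comm_symb hP hQ]; rfl

theorem comm_add_right (hP : DCAt P x) (hQ : DCAt Q x) (hR : DCAt R x) :
    comm P (fun y => Q y + R y) x = comm P Q x + comm P R x := by
  rw [comm_swap hP (hQ.add hR), comm_add_left hQ hR hP, comm_swap hP hQ, comm_swap hP hR]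
  abel

theorem comm_const_smul_right (c : ℂ) (hP : DCAt P x) (hQ : DCAt Q x) :
    comm P (fun y => c • Q y) x = c • comm P Q x := by
  rw [comm_smul_right (funAt_const c x) hP hQ, cAct_const, zero_smul, zero_add]

theorem comm_smul_left {f : M → ℂ} (hf : FunAt EX f x) (hP : DCAt P x) (hQ : DCAt Q x) :
    comm (fun y => f y • P y) Q x = -(cAct EX (symb (Q x)) f • P x) + f x • comm P Q x := by
  rw [comm_swap (hP.smul hf) hQ, comm_smul_right hf hQ hP, comm_swap hP hQ]
  module

theorem comm_const_smul_left (c : ℂ) (hP : DCAt P x) (hQ : DCAt Q x) :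
    comm (fun y => c • P y) Q x = c • comm P Q x := by
  rw [comm_smul_left (funAt_const c x) hP hQ, cAct_const, zero_smul, neg_zero, zero_add]

theorem comm_sub_left (hP : DCAt P x) (hP' : DCAt P' x) (hQ : DCAt Q x) :
    comm (fun y => P y - P' y) Q x = comm P Q x - comm P' Q x := by
  have h : (fun y => P y - P' y) = fun y => P y + (-1 : ℂ) • P' y := by ext1 y; module
  rw [h, comm_add_left hP (hP'.const_smul _) hQ, comm_const_smul_left _ hP' hQ]
  module

theorem comm_sub_right (hP : DCAt P x) (hQ : DCAt Q x) (hR : DCAt R x) :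
    comm P (fun y => Q y - R y) x = comm P Q x - comm P R x := by
  rw [comm_swap hP (hQ.sub hR), comm_sub_left hQ hR hP, comm_swap hP hQ, comm_swap hP hR]
  abel

/-- The formal identity for triple compositions of operators, and `cLie_jacobi` for the symbols. As
for vector fields, the inner commutators are expanded on a neighbourhood. -/
theorem comm_jacobi (hP : DCAt P x) (hQ : DCAt Q x) (hR : DCAt R x) :
    comm P (comm Q R) x = comm (comm P Q) R x + comm Q (comm P R) x := by
  refine opAct_ext (fun s hs => ?_) ?_
  · have e : ∀ {P Q R : ∀ y, DCfib EX F V y}, DCAt Q x → DCAt R x →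
        opAct (P x) (fun y => opAct (comm Q R y) s)
          = opAct (P x) (fun y => opAct (Q y) fun z => opAct (R z) s)
            - opAct (P x) (fun y => opAct (R y) fun z => opAct (Q z) s) := by
      intro P Q R hQ hR
      rw [← opAct_sub (P x) (hQ.act (hR.act hs)) (hR.act (hQ.act hs))]
      refine opAct_congr (P x) ((hQ.act (hR.act hs)).sub (hR.act (hQ.act hs))) ?_
      filter_upwards [hQ.eventually, hR.eventually, hs.eventually] with y h1 h2 h3
      exact comm_act h1 h2 h3
    rw [add_opAct, comm_act hP (hQ.comm hR) hs, comm_act (hP.comm hQ) hR hs,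
      comm_act hQ (hP.comm hR) hs, e hQ hR, e hP hQ, e hP hR, comm_act hQ hR (hP.act hs),
      comm_act hP hQ (hR.act hs), comm_act hP hR (hQ.act hs)]
    abel
  · have e : ∀ {Q R : ∀ y, DCfib EX F V y}, DCAt Q x → DCAt R x →
        ∀ᶠ y in 𝓝 x, (symb (comm Q R y)) = cLie EX (fun y => (symb (Q y))) (fun y => (symb (R y))) y := by
      intro Q R hQ hR
      filter_upwards [hQ.eventually, hR.eventually] with y h1 h2 using comm_symb h1 h2
    have hr : ∀ {P : ∀ y, DCfib EX F V y}, ∀ᶠ y in 𝓝 x, (symb (P y)) = (symb (P y)) :=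
      Eventually.of_forall fun _ => rfl
    rw [comm_symb hP (hQ.comm hR), cLie_congr hr (e hQ hR), cLie_jacobi hP.2 hQ.2 hR.2]
    change _ = symb (comm (comm P Q) R x) + symb (comm Q (comm P R) x)
    rw [comm_symb (hP.comm hQ) hR, comm_symb hQ (hP.comm hR), cLie_congr (e hP hQ) hr,
      cLie_congr hr (e hP hR)]

end Commutator

end LocalSections

end HolGauge

end

noncomputable section
namespace HolGauge
open VectorField

/-! ### Smoothness of a section read in a trivialization. -/

section SectionsInTrivialization

variable {EX : Type*} [NormedAddCommGroup EX] [NormedSpace ℂ EX]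
  {M : Type*} [TopologicalSpace M] [ChartedSpace EX M] [IsManifold 𝓘(ℂ, EX) ω M]
  {F : Type*} [NormedAddCommGroup F] [NormedSpace ℝ F]
  {V : M → Type*} [TopologicalSpace (TotalSpace F V)]
  [∀ x, AddCommGroup (V x)] [∀ x, Module ℝ (V x)] [∀ x, TopologicalSpace (V x)]
  [FiberBundle F V] [VectorBundle ℝ F V] [ContMDiffVectorBundle ∞ F V 𝓘(ℝ, EX)]

theorem secAt_iff_funAt (e : Trivialization F (TotalSpace.proj : TotalSpace F V → M))
    [MemTrivializationAtlas e] {s : ∀ x, V x} {x : M} (hx : x ∈ e.baseSet) :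
    SecAt EX F V s x ↔ FunAt EX (fun y => (e ⟨y, s y⟩).2) x := by
  have h : ∀ᶠ y in 𝓝 x, (ContMDiffAt 𝓘(ℝ, EX) (𝓘(ℝ, EX).prod 𝓘(ℝ, F)) ∞
      (fun z => TotalSpace.mk' F z (s z)) y ↔
        ContMDiffAt 𝓘(ℝ, EX) 𝓘(ℝ, F) ∞ (fun y => (e ⟨y, s y⟩).2) y) := by
    filter_upwards [e.open_baseSet.mem_nhds hx] with y hy using e.contMDiffAt_section_iff hy
  exact eventually_congr h

end SectionsInTrivialization

/-! ### Local frames, and extension of a (0,1)-vector to a local section. -/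

section TangentExtension

variable {EX : Type*} [NormedAddCommGroup EX] [NormedSpace ℂ EX]
  {M : Type*} [TopologicalSpace M] [ChartedSpace EX M] [IsManifold 𝓘(ℂ, EX) ω M]

/-- The tangent vector at `y` with given components in the preferred trivialization of the tangent
bundle at `x`. -/
def tExt (x y : M) : EX →ₗ[ℝ] TangentSpace 𝓘(ℝ, EX) y :=
  ((trivializationAt EX (fun y : M => TangentSpace 𝓘(ℝ, EX) y) x).symmL ℝ y).toLinearMap

/-- The components of a tangent vector at `y` in the preferred trivialization at `x`. -/
def tCoord (x y : M) : TangentSpace 𝓘(ℝ, EX) y →ₗ[ℝ] EX :=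
  ((trivializationAt EX (fun y : M => TangentSpace 𝓘(ℝ, EX) y) x).continuousLinearMapAt
    ℝ y).toLinearMap

/-- The base set of the preferred trivialization of the tangent bundle at `x`. -/
def tBase (x : M) : Set M := (trivializationAt EX (fun y : M => TangentSpace 𝓘(ℝ, EX) y) x).baseSet

theorem tBase_mem_nhds {x y : M} (hy : y ∈ tBase (EX := EX) x) : tBase (EX := EX) x ∈ 𝓝 y :=
  (trivializationAt EX (fun y : M => TangentSpace 𝓘(ℝ, EX) y) x).open_baseSet.mem_nhds hy

theorem mem_tBase (x : M) : x ∈ tBase (EX := EX) x :=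
  mem_baseSet_trivializationAt EX (fun y : M => TangentSpace 𝓘(ℝ, EX) y) x

theorem tCoord_eq {x y : M} (hy : y ∈ tBase (EX := EX) x) (v : TangentSpace 𝓘(ℝ, EX) y) :
    tCoord x y v = (trivializationAt EX (fun y : M => TangentSpace 𝓘(ℝ, EX) y) x ⟨y, v⟩).2 :=
  congrFun (Trivialization.coe_linearMapAt_of_mem (R := ℝ) _ hy) v

theorem tExt_tCoord {x y : M} (hy : y ∈ tBase (EX := EX) x) (v : TangentSpace 𝓘(ℝ, EX) y) :
    tExt x y (tCoord x y v) = v :=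
  Trivialization.symmL_continuousLinearMapAt (R := ℝ) _ hy v

theorem tCoord_tExt {x y : M} (hy : y ∈ tBase (EX := EX) x) (v : EX) :
    tCoord x y (tExt x y v) = v :=
  Trivialization.continuousLinearMapAt_symmL (R := ℝ) _ hy v

theorem vfAt_iff_tCoord {v : ∀ y : M, TangentSpace 𝓘(ℝ, EX) y} {x y : M}
    (hy : y ∈ tBase (EX := EX) x) : VFAt v y ↔ FunAt EX (fun z => tCoord x z (v z)) y := by
  have h : (fun z => tCoord x z (v z)) =ᶠ[𝓝 y]
      fun z => (trivializationAt EX (fun y : M => TangentSpace 𝓘(ℝ, EX) y) x ⟨z, v z⟩).2 := by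
    filter_upwards [tBase_mem_nhds hy] with z hz using tCoord_eq hz _
  rw [VFAt, secAt_iff_funAt _ hy]
  exact ⟨fun h' => h'.congr h, fun h' => h'.congr h.symm⟩

theorem vfAt_tExt (x : M) (v : EX) {y : M} (hy : y ∈ tBase (EX := EX) x) :
    VFAt (fun y => tExt x y v) y := by
  rw [vfAt_iff_tCoord hy]
  refine (funAt_const v y).congr ?_
  filter_upwards [tBase_mem_nhds hy] with z hz using tCoord_tExt hz v

variable [FiniteDimensional ℂ EX]

variable (EX) in
/-- A basis of the real vector space underlying `EX`. -/
def realBasis : Module.Basis (Fin (Module.finrank ℝ EX)) ℝ EX :=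
  have : FiniteDimensional ℝ EX := FiniteDimensional.complexToReal EX
  Module.finBasis ℝ EX

/-- The components of a complex tangent vector at `y` in the preferred frame at `x`. -/
def cCoord (x y : M) (i : Fin (Module.finrank ℝ EX)) (ξ : CT EX y) : ℂ :=
  ((realBasis EX).repr (tCoord x y (cRe ξ)) i : ℂ)
    + Complex.I * ((realBasis EX).repr (tCoord x y (cIm ξ)) i : ℂ)

/-- The preferred frame of the complexified tangent bundle at `x`. -/
def cFrame (x y : M) (i : Fin (Module.finrank ℝ EX)) : CT EX y :=
  (1 : ℂ) ⊗ₜ[ℝ] tExt x y (realBasis EX i)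

theorem sum_cCoord_smul_cFrame {x y : M} (hy : y ∈ tBase (EX := EX) x) (ξ : CT EX y) :
    ∑ i, cCoord x y i ξ • cFrame x y i = ξ := by
  have h : ∀ v : TangentSpace 𝓘(ℝ, EX) y,
      ∑ i, (realBasis EX).repr (tCoord x y v) i • tExt x y (realBasis EX i) = v := by
    intro v
    conv_rhs => rw [← tExt_tCoord hy v, ← (realBasis EX).sum_repr (tCoord x y v)]
    simp only [map_sum, map_smul]
  apply complexified_ext
  · rw [map_sum]
    refine Eq.trans (Finset.sum_congr rfl fun i _ => ?_) (h (cRe ξ))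
    simp [cCoord, cFrame]
  · rw [map_sum]
    refine Eq.trans (Finset.sum_congr rfl fun i _ => ?_) (h (cIm ξ))
    simp [cCoord, cFrame]

theorem funAt_cCoord {ξ : ∀ y : M, CT EX y} {x y : M} (hy : y ∈ tBase (EX := EX) x)
    (hξ : CVFAt ξ y) (i : Fin (Module.finrank ℝ EX)) :
    FunAt EX (fun z => cCoord x z i (ξ z)) y := by
  have : FiniteDimensional ℝ EX := FiniteDimensional.complexToReal EX
  have h : ∀ {v : ∀ z : M, TangentSpace 𝓘(ℝ, EX) z}, VFAt v y →
      FunAt EX (fun z => ((realBasis EX).repr (tCoord x z (v z)) i : ℂ)) y := fun hv =>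
    ((vfAt_iff_tCoord hy).1 hv).clm
      (Complex.ofRealCLM.comp (LinearMap.toContinuousLinearMap ((realBasis EX).coord i)))
  exact (h hξ.1).add ((funAt_const _ _).mul (h hξ.2))

theorem cvfAt_cFrame {x y : M} (hy : y ∈ tBase (EX := EX) x) (i : Fin (Module.finrank ℝ EX)) :
    CVFAt (fun z => cFrame x z i) y :=
  (vfAt_tExt x _ hy).ofReal

/-- The vector at `y` which has the same components as a given tangent vector at `x`, in the
preferred trivialization of the tangent bundle at `x`. -/
def tTrans (x y : M) : TangentSpace 𝓘(ℝ, EX) x →ₗ[ℝ] TangentSpace 𝓘(ℝ, EX) y :=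
  tExt x y ∘ₗ tCoord x x

/-- The local section of `T^{0,1}` with constant components extending a given vector at `x`. -/
def ext01 (x y : M) : T01 EX x →ₗ[ℂ] T01 EX y :=
  p01 EX y ∘ₗ (tTrans x y).baseChange ℂ ∘ₗ (T01 EX x).subtype

theorem ext01_self (x : M) (ξ : T01 EX x) : ext01 x x ξ = ξ := by
  have h : (tTrans x x).baseChange ℂ (ξ : CT EX x) = (ξ : CT EX x) := by
    have : tTrans (EX := EX) x x = LinearMap.id := LinearMap.ext (tExt_tCoord (mem_tBase x))
    rw [this, LinearMap.baseChange_id, LinearMap.id_apply]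
  change p01 EX x ((tTrans x x).baseChange ℂ (ξ : CT EX x)) = ξ
  rw [h, p01_of_mem ξ.2]

/-- With `ext01_self`, this provides a smooth local extension of a (0,1)-vector that depends
linearly on it; the connection defined by means of it is then linear in the direction without
further argument. -/
theorem cvfAt_ext01 (x : M) (ξ : T01 EX x) : CVFAt (fun y => (ext01 x y ξ : CT EX y)) x := by
  have h : CVFAt (fun y => (tTrans x y).baseChange ℂ (ξ : CT EX x)) x := by
    simp only [CVFAt, cRe_baseChange, cIm_baseChange]
    exact ⟨vfAt_tExt x _ (mem_tBase x), vfAt_tExt x _ (mem_tBase x)⟩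
  exact h.p01

end TangentExtension

end HolGauge

end

noncomputable section
namespace HolGauge
open VectorField

/-! ### ∂̄ inside D_ℂE, the projection onto D^{1,0}E, and the connection ∂̄^{DE}. -/

section DbarOperators

variable {EX : Type*} [NormedAddCommGroup EX] [NormedSpace ℂ EX] [FiniteDimensional ℂ EX]
  {M : Type*} [TopologicalSpace M] [T2Space M] [ChartedSpace EX M] [IsManifold 𝓘(ℂ, EX) ω M]
  {F : Type*} [NormedAddCommGroup F] [NormedSpace ℂ F]
  {V : M → Type*} [TopologicalSpace (TotalSpace F V)]
  [∀ x, AddCommGroup (V x)] [∀ x, Module ℂ (V x)] [∀ x, TopologicalSpace (V x)]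
  [FiberBundle F V] [VectorBundle ℂ F V] [ContMDiffVectorBundle ∞ F V 𝓘(ℝ, EX)]
  (dbar : DbarConnection EX (vecBundle EX F V)) {x : M}

theorem exists_isSmooth {s : ∀ y, V y} (hs : SecAt EX F V s x) :
    ∃ U : Set M, IsOpen U ∧ x ∈ U ∧ (vecBundle EX F V).IsSmooth U s := by
  obtain ⟨U, hU, hUo, hxU⟩ := eventually_nhds_iff.1 hs
  exact ⟨U, hUo, hxU, fun y hy => (hU y hy).contMDiffWithinAt⟩

theorem dbar_zero : dbar.toFun (fun y => (0 : V y)) x = 0 := by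
  have h := dbar.map_add univ isOpen_univ (fun y => (0 : V y)) (fun y => (0 : V y))
    (smooth_univ (0 : Sec EX F V)) (smooth_univ (0 : Sec EX F V)) x (mem_univ x)
  have h2 : (fun y => (show (vecBundle EX F V).Fib y from (0 : V y))
      + (show (vecBundle EX F V).Fib y from (0 : V y))) = fun y => (0 : V y) := by
    ext y; exact add_zero (0 : V y)
  rw [h2] at h
  simpa using h

/-- The cut-off argument of `apply_eq_of_germ`, repeated for the connection itself because it is
also applied to sections that are only locally smooth. Additivity reduces the claim to the
difference, which vanishes near the point. -/
theorem dbar_congr {s t : ∀ y, V y} (hs : SecAt EX F V s x) (h : ∀ᶠ y in 𝓝 x, t y = s y) :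
    dbar.toFun t x = dbar.toFun s x := by
  have ht := hs.congr h
  have hd0 : ∀ᶠ y in 𝓝 x, t y - s y = 0 := h.mono fun y hy => by rw [hy, sub_self]
  have key : dbar.toFun (fun y => t y - s y) x = 0 := by
    obtain ⟨χ, hχ, h1, hsupp⟩ := exists_bump (EX := EX) hd0
    obtain ⟨U, hU, hxU, hsm⟩ := exists_isSmooth (ht.sub hs)
    have hχ' : ContMDiff 𝓘(ℝ, EX) 𝓘(ℝ, ℂ) ∞ (fun y => (χ y : ℂ)) :=
      Complex.ofRealCLM.contDiff.contMDiff.comp hχ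
    have hz : (fun y => (χ y : ℂ) • (t y - s y)) = fun y => (0 : V y) := by
      ext y
      by_cases hy : y ∈ tsupport χ
      · have : t y - s y = 0 := hsupp hy
        rw [this, smul_zero]
      · rw [image_eq_zero_of_notMem_tsupport hy, Complex.ofReal_zero, zero_smul]
    ext1 ξ
    have hl : dbar.toFun (fun y => (χ y : ℂ) • (t y - s y)) x ξ
        = cAct EX (ξ : CT EX x) (fun y => (χ y : ℂ)) • (t x - s x)
          + (χ x : ℂ) • (show V x from dbar.toFun (fun y => t y - s y) x ξ) :=
      dbar.leibniz U hU _ _ hχ'.contMDiffOn hsm x hxU ξ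
    rw [hz, dbar_zero, hd0.self_of_nhds, h1.self_of_nhds] at hl
    have h0 : cAct EX (ξ : CT EX x) (fun y => (χ y : ℂ)) • (0 : V x) = 0 := smul_zero _
    rw [h0, Pi.one_apply, Complex.ofReal_one, one_smul, zero_add] at hl
    exact hl.symm
  obtain ⟨U, hU, hxU, hsU⟩ := exists_isSmooth hs
  obtain ⟨U', hU', hxU', hdU⟩ := exists_isSmooth (ht.sub hs)
  have h3 := dbar.map_add (U ∩ U') (hU.inter hU') s (fun y => t y - s y)
    (ContMDiffOn.mono hsU inter_subset_left) (ContMDiffOn.mono hdU inter_subset_right) x ⟨hxU, hxU'⟩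
  have h4 : (fun y => (show (vecBundle EX F V).Fib y from s y)
      + (show (vecBundle EX F V).Fib y from t y - s y)) = t := by
    ext y; exact add_sub_cancel (s y) (t y)
  rw [h4, key, add_zero] at h3
  exact h3

theorem opAct_dbarOp {s : ∀ y, V y} (hs : SecAt EX F V s x) (ξ : T01 EX x) :
    opAct (dbarOp dbar x ξ) s = dbar.toFun s x ξ :=
  congrArg (fun L : T01 EX x →ₗ[ℂ] V x => L ξ) (dbar_congr dbar hs (secGerm_eq hs))

theorem symb_dbarOp (ξ : T01 EX x) : symb (dbarOp dbar x ξ) = ξ := rfl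

theorem dcAt_dbarOp {ζ : ∀ y : M, T01 EX y} (hζ : CVFAt (fun y => (ζ y : CT EX y)) x) :
    DCAt (fun y => dbarOp dbar y (ζ y)) x := by
  refine ⟨?_, hζ⟩
  obtain ⟨U, hU, hUo, hxU⟩ := eventually_nhds_iff.1 hζ.eventually
  filter_upwards [hUo.mem_nhds hxU] with y hy e
  have := dbar.smooth U hUo ζ e.1 ((smoothCVF_iff hUo).2 hU) (ContMDiffOn.mono e.2.contMDiffOn (subset_univ U))
  exact (vecBundle_isSmooth_iff hUo).1 this y hy

/-- Flatness of ∂̄, restated as an identity in D_ℂE. For the symbols, the bracket is already of type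
(0,1), so `p01` changes nothing. -/
theorem comm_dbarOp {ζ η : ∀ y : M, T01 EX y} (hζ : CVFAt (fun y => (ζ y : CT EX y)) x)
    (hη : CVFAt (fun y => (η y : CT EX y)) x) :
    comm (fun y => dbarOp dbar y (ζ y)) (fun y => dbarOp dbar y (η y)) x
      = dbarOp dbar x (p01 EX x (cLie EX (fun y => (ζ y : CT EX y)) (fun y => (η y : CT EX y)) x)) := by
  have hP := dcAt_dbarOp dbar hζ
  have hQ := dcAt_dbarOp dbar hη
  refine opAct_ext (fun s hs => ?_) ?_
  · obtain ⟨U, hU, hUo, hxU⟩ := eventually_nhds_iff.1 ((hζ.eventually.and hη.eventually).and hs.eventually)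
    have hf := dbar.flat U hUo ζ η s ((smoothCVF_iff hUo).2 fun y hy => (hU y hy).1.1)
      ((smoothCVF_iff hUo).2 fun y hy => (hU y hy).1.2)
      ((vecBundle_isSmooth_iff hUo).2 fun y hy => (hU y hy).2) x hxU
    rw [comm_act hP hQ hs, opAct_dbarOp dbar hs]
    refine Eq.trans ?_ hf
    have key : ∀ {ζ η : ∀ y : M, T01 EX y}, DCAt (fun y => dbarOp dbar y (η y)) x →
        opAct (dbarOp dbar x (ζ x)) (fun y => opAct (dbarOp dbar y (η y)) s)
          = dbar.toFun (fun y => dbar.toFun s y (η y)) x (ζ x) := by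
      intro ζ η hQ
      rw [opAct_dbarOp dbar (hQ.act hs)]
      have h1 : ∀ᶠ y in 𝓝 x, opAct (dbarOp dbar y (η y)) s = dbar.toFun s y (η y) := by
        filter_upwards [hs.eventually] with y hy using opAct_dbarOp dbar hy _
      exact congrArg (fun L : T01 EX x →ₗ[ℂ] V x => L (ζ x))
        (dbar_congr dbar (hQ.act hs) (h1.mono fun y hy => hy.symm)).symm
    rw [key hQ, key hP]
    rfl
  · rw [comm_symb hP hQ, symb_dbarOp, p01_of_mem]
    rfl
    exact cLie_mem_T01 hζ hη (Eventually.of_forall fun y => (ζ y).2)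
      (Eventually.of_forall fun y => (η y).2)

/-- The inclusion of `D^{1,0} E` in `D_ℂ E`. -/
def incl10 (x : M) : (D10 EX F V).Fib x →ₗ[ℂ] DCfib EX F V x :=
  Submodule.inclusion (p := D10fib EX F V x) (p' := DCfib EX F V x) inf_le_left

/-- The projection of `D_ℂ E` onto `D^{1,0} E`. -/
def proj10L (x : M) : DCfib EX F V x →ₗ[ℂ] (D10 EX F V).Fib x where
  toFun := proj10 dbar x
  map_add' D D' := by
    apply Subtype.ext
    change (D + D').1 - (dbarOp dbar x (p01 EX x (D.1.2 + D'.1.2))).1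
      = (D.1 - (dbarOp dbar x (p01 EX x D.1.2)).1) + (D'.1 - (dbarOp dbar x (p01 EX x D'.1.2)).1)
    rw [map_add, map_add, Submodule.coe_add, Submodule.coe_add]
    abel
  map_smul' c D := by
    apply Subtype.ext
    change (c • D).1 - (dbarOp dbar x (p01 EX x (c • D.1.2))).1
      = c • (D.1 - (dbarOp dbar x (p01 EX x D.1.2)).1)
    rw [map_smul, map_smul, Submodule.coe_smul, Submodule.coe_smul, smul_sub]

theorem incl10_injective (x : M) : Function.Injective (incl10 (EX := EX) (F := F) (V := V) x) :=
  Submodule.inclusion_injective inf_le_left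

theorem val_eq_incl10 (Δ : (D10 EX F V).Fib x) : D10.val Δ = (incl10 x Δ).1 := rfl

theorem symb_incl10_mem (Δ : (D10 EX F V).Fib x) : symb (incl10 x Δ) ∈ T10 EX x :=
  (Subtype.property (p := fun D => D ∈ D10fib EX F V x) Δ).2

theorem incl10_proj10L (D : DCfib EX F V x) :
    incl10 x (proj10L dbar x D) = D - dbarOp dbar x (p01 EX x (symb D)) := rfl

theorem proj10L_of_mem {D : DCfib EX F V x} (h : symb D ∈ T10 EX x) :
    incl10 x (proj10L dbar x D) = D := by
  rw [incl10_proj10L, p01_of_mem_T10 h, map_zero, sub_zero]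

@[simp] theorem proj10L_incl10 (Δ : (D10 EX F V).Fib x) : proj10L dbar x (incl10 x Δ) = Δ :=
  incl10_injective x (proj10L_of_mem dbar (symb_incl10_mem Δ))

@[simp] theorem proj10L_dbarOp (ξ : T01 EX x) : proj10L dbar x (dbarOp dbar x ξ) = 0 := by
  apply incl10_injective x
  rw [incl10_proj10L, symb_dbarOp, p01_of_mem ξ.2, sub_self, map_zero]

theorem symb_proj10L (D : DCfib EX F V x) :
    symb (incl10 x (proj10L dbar x D)) = p10 EX x (symb D) := by
  have h := p10_add_p01 (symb D)
  rw [incl10_proj10L]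
  change symb D - (p01 EX x (symb D) : CT EX x) = _
  conv_lhs => rw [← h]
  rw [h, sub_eq_iff_eq_add, h]

theorem d10_isSmooth_iff {Δ : ∀ y, (D10 EX F V).Fib y} {U : Set M} (hU : IsOpen U) :
    (D10 EX F V).IsSmooth U Δ ↔ ∀ x ∈ U, DCAt (fun y => incl10 y (Δ y)) x := by
  constructor
  · intro h x hx
    refine ⟨?_, (smoothCVF_iff hU).1 h.2 x hx⟩
    filter_upwards [hU.mem_nhds hx] with y hy e
    exact (vecBundle_isSmooth_iff hU).1 (h.1 e) y hy
  · intro h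
    exact ⟨fun e => (vecBundle_isSmooth_iff hU).2 fun x hx => (h x hx).1.self_of_nhds e,
      (smoothCVF_iff hU).2 fun x hx => (h x hx).2⟩

theorem DCAt.proj10 {P : ∀ y, DCfib EX F V y} (hP : DCAt P x) :
    DCAt (fun y => incl10 y (proj10L dbar y (P y))) x :=
  hP.sub (dcAt_dbarOp dbar hP.2.p01)

theorem comm_sum_left {ι : Type*} (S : Finset ι) {P : ι → ∀ y, DCfib EX F V y}
    {Q : ∀ y, DCfib EX F V y} (hP : ∀ i, DCAt (P i) x) (hQ : DCAt Q x) :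
    DCAt (fun y => ∑ i ∈ S, P i y) x ∧
      comm (fun y => ∑ i ∈ S, P i y) Q x = ∑ i ∈ S, comm (P i) Q x := by
  classical
  induction S using Finset.induction_on with
  | empty =>
    have h := hQ.const_smul 0
    simp only [zero_smul] at h
    have h2 := comm_const_smul_left 0 hQ hQ
    simp only [zero_smul] at h2
    simpa using ⟨h, h2⟩
  | insert i S hi ih =>
    simp only [Finset.sum_insert hi]
    exact ⟨(hP i).add ih.1, by rw [comm_add_left (hP i) ih.1 hQ, ih.2]⟩

/-- Tensoriality in ζ. Near x, ∂̄_ζ is a sum of terms c_i P_i with P_i values of ∂̄ on a frame and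
c_i(x) = 0. At x the commutator of c_i P_i with Q is -σ(Q)(c_i)P_i, which the projection kills. -/
theorem proj10L_comm_eq_zero {ζ : ∀ y : M, T01 EX y} {Q : ∀ y, DCfib EX F V y}
    (hζ : CVFAt (fun y => (ζ y : CT EX y)) x) (hQ : DCAt Q x) (h0 : ζ x = 0) :
    proj10L dbar x (comm (fun y => dbarOp dbar y (ζ y)) Q x) = 0 := by
  have hx := mem_tBase (EX := EX) x
  have hc := funAt_cCoord hx hζ
  have hF : ∀ i, DCAt (fun y => dbarOp dbar y (p01 EX y (cFrame x y i))) x :=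
    fun i => dcAt_dbarOp dbar (cvfAt_cFrame hx i).p01
  have hP := fun i => (hF i).smul (hc i)
  have heq : ∀ᶠ y in 𝓝 x, dbarOp dbar y (ζ y)
      = ∑ i, cCoord x y i (ζ y : CT EX y) • dbarOp dbar y (p01 EX y (cFrame x y i)) := by
    filter_upwards [tBase_mem_nhds hx] with y hy
    have h : ζ y = p01 EX y (ζ y : CT EX y) := by rw [p01_of_mem (ζ y).2]
    conv_lhs => rw [h, ← sum_cCoord_smul_cFrame hy (ζ y : CT EX y)]
    simp only [map_sum, map_smul]
  obtain ⟨h1, h2⟩ := comm_sum_left Finset.univ hP hQ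
  rw [comm_congr h1 hQ heq (Eventually.of_forall fun _ => rfl), h2, map_sum]
  refine Finset.sum_eq_zero fun i _ => ?_
  have hz : cCoord x x i (ζ x : CT EX x) = 0 := by simp [h0, cCoord]
  rw [comm_smul_left (hc i) (hF i) hQ, hz, zero_smul, add_zero, map_neg, map_smul, proj10L_dbarOp,
    smul_zero, neg_zero]

theorem proj10L_comm_congr {ζ η : ∀ y : M, T01 EX y} {Q : ∀ y, DCfib EX F V y}
    (hζ : CVFAt (fun y => (ζ y : CT EX y)) x) (hη : CVFAt (fun y => (η y : CT EX y)) x)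
    (hQ : DCAt Q x) (h : ζ x = η x) :
    proj10L dbar x (comm (fun y => dbarOp dbar y (ζ y)) Q x)
      = proj10L dbar x (comm (fun y => dbarOp dbar y (η y)) Q x) := by
  have hd : CVFAt (fun y => ((ζ y - η y : T01 EX y) : CT EX y)) x := hζ.sub hη
  have h0 := proj10L_comm_eq_zero dbar hd hQ (by rw [h, sub_self])
  simp only [map_sub] at h0
  rw [comm_sub_left (dcAt_dbarOp dbar hζ) (dcAt_dbarOp dbar hη) hQ, map_sub] at h0
  exact sub_eq_zero.1 h0

open Classical in
/-- The value of `∂̄^{DE}_ξ Δ`. -/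
def nablaFun (Δ : ∀ y, (D10 EX F V).Fib y) (x : M) : T01 EX x →ₗ[ℂ] (D10 EX F V).Fib x :=
  if h : DCAt (fun y => incl10 y (Δ y)) x then
    { toFun := fun ξ => proj10L dbar x
        (comm (fun y => dbarOp dbar y (ext01 x y ξ)) (fun y => incl10 y (Δ y)) x)
      map_add' := fun ξ η => by
        simp only [map_add]
        rw [comm_add_left (dcAt_dbarOp dbar (cvfAt_ext01 x ξ)) (dcAt_dbarOp dbar (cvfAt_ext01 x η)) h,
          map_add]
      map_smul' := fun c ξ => by
        simp only [map_smul]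
        rw [comm_const_smul_left c (dcAt_dbarOp dbar (cvfAt_ext01 x ξ)) h, map_smul,
          RingHom.id_apply] }
  else 0

/-- By tensoriality, the particular extension used in the definition may be replaced by any smooth
field with the same value at x. -/
theorem nablaFun_eq {Δ : ∀ y, (D10 EX F V).Fib y} (h : DCAt (fun y => incl10 y (Δ y)) x)
    {ζ : ∀ y : M, T01 EX y} (hζ : CVFAt (fun y => (ζ y : CT EX y)) x) :
    nablaFun dbar Δ x (ζ x)
      = proj10L dbar x (comm (fun y => dbarOp dbar y (ζ y)) (fun y => incl10 y (Δ y)) x) := by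
  rw [nablaFun, dif_pos h]
  exact proj10L_comm_congr dbar (cvfAt_ext01 x (ζ x)) hζ h (ext01_self x (ζ x))

theorem nablaFun_eq_ext {Δ : ∀ y, (D10 EX F V).Fib y} (h : DCAt (fun y => incl10 y (Δ y)) x)
    (ξ : T01 EX x) : nablaFun dbar Δ x ξ = proj10L dbar x
      (comm (fun y => dbarOp dbar y (ext01 x y ξ)) (fun y => incl10 y (Δ y)) x) := by
  rw [nablaFun, dif_pos h]; rfl

theorem dcAt_nablaFun {Δ : ∀ y, (D10 EX F V).Fib y} (h : DCAt (fun y => incl10 y (Δ y)) x)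
    {ζ : ∀ y : M, T01 EX y} (hζ : CVFAt (fun y => (ζ y : CT EX y)) x) :
    DCAt (fun y => incl10 y (nablaFun dbar Δ y (ζ y))) x := by
  refine (((dcAt_dbarOp dbar hζ).comm h).proj10 dbar).congr ?_
  filter_upwards [h.eventually, hζ.eventually] with y h1 h2
  rw [nablaFun_eq dbar h1 h2]

/-- The inner projection may be dropped: it subtracts a value of ∂̄, whose commutator with ∂̄_ζ is
again a value of ∂̄ by flatness and is killed by the outer projection. -/
theorem proj10L_comm_nablaFun {Δ : ∀ y, (D10 EX F V).Fib y} (h : DCAt (fun y => incl10 y (Δ y)) x)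
    {ζ η : ∀ y : M, T01 EX y} (hζ : CVFAt (fun y => (ζ y : CT EX y)) x)
    (hη : CVFAt (fun y => (η y : CT EX y)) x) :
    nablaFun dbar (fun y => nablaFun dbar Δ y (η y)) x (ζ x)
      = proj10L dbar x (comm (fun y => dbarOp dbar y (ζ y))
          (comm (fun y => dbarOp dbar y (η y)) (fun y => incl10 y (Δ y))) x) := by
  have hP := dcAt_dbarOp dbar hζ
  have hQ := (dcAt_dbarOp dbar hη).comm h
  have hR := dcAt_dbarOp dbar hQ.2.p01
  rw [nablaFun_eq dbar (dcAt_nablaFun dbar h hη) hζ]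
  have heq : ∀ᶠ y in 𝓝 x, incl10 y (nablaFun dbar Δ y (η y))
      = comm (fun y => dbarOp dbar y (η y)) (fun y => incl10 y (Δ y)) y
        - dbarOp dbar y (p01 EX y
          (symb (comm (fun y => dbarOp dbar y (η y)) (fun y => incl10 y (Δ y)) y))) := by
    filter_upwards [h.eventually, hη.eventually] with y h1 h2
    rw [nablaFun_eq dbar h1 h2]; rfl
  rw [comm_congr hP (hQ.sub hR) (Eventually.of_forall fun _ => rfl) heq, comm_sub_right hP hQ hR,
    comm_dbarOp dbar hζ hQ.2.p01, map_sub, proj10L_dbarOp, sub_zero]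

/-- The flat `T^{0,1}`-connection `∂̄^{DE}` in `D^{1,0} E`. -/
def nabla : DbarConnection EX (D10 EX F V) where
  toFun := nablaFun dbar
  map_add U hU s t hs ht x hx := by
    have h1 := (d10_isSmooth_iff hU).1 hs x hx
    have h2 := (d10_isSmooth_iff hU).1 ht x hx
    have h3 : DCAt (fun y => incl10 y (s y + t y)) x := by simpa only [map_add] using h1.add h2
    ext1 ξ
    rw [LinearMap.add_apply, nablaFun_eq_ext dbar h1, nablaFun_eq_ext dbar h2,
      nablaFun_eq_ext dbar h3, ← map_add]
    simp only [map_add (incl10 _)]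
    rw [comm_add_right (dcAt_dbarOp dbar (cvfAt_ext01 x ξ)) h1 h2]
  leibniz U hU f s hf hs x hx ξ := by
    have h1 := (d10_isSmooth_iff hU).1 hs x hx
    have h2 := (contMDiffOn_iff_funAt hU).1 hf x hx
    have h3 : DCAt (fun y => incl10 y (f y • s y)) x := by simpa only [map_smul] using h1.smul h2
    rw [nablaFun_eq_ext dbar h1, nablaFun_eq_ext dbar h3]
    simp only [map_smul (incl10 _)]
    rw [comm_smul_right h2 (dcAt_dbarOp dbar (cvfAt_ext01 x ξ)) h1, map_add, map_smul, map_smul,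
      proj10L_incl10, symb_dbarOp, ext01_self]
  smooth U hU ζ s hζ hs := (d10_isSmooth_iff hU).2 fun x hx =>
    dcAt_nablaFun dbar ((d10_isSmooth_iff hU).1 hs x hx) ((smoothCVF_iff hU).1 hζ x hx)
  flat U hU ζ η s hζ hη hs x hx := by
    have h1 := (smoothCVF_iff hU).1 hζ x hx
    have h2 := (smoothCVF_iff hU).1 hη x hx
    have h3 := (d10_isSmooth_iff hU).1 hs x hx
    have hP := dcAt_dbarOp dbar h1
    have hQ := dcAt_dbarOp dbar h2
    have h12 := (h1.lie h2).p01
    have heq : ∀ᶠ y in 𝓝 x, comm (fun y => dbarOp dbar y (ζ y)) (fun y => dbarOp dbar y (η y)) y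
        = dbarOp dbar y (p01 EX y
          (cLie EX (fun y => (ζ y : CT EX y)) (fun y => (η y : CT EX y)) y)) := by
      filter_upwards [h1.eventually, h2.eventually] with y h1 h2 using comm_dbarOp dbar h1 h2
    -- The curvature is now the projection of a difference of double commutators, which the Jacobi
    -- identity turns into [[∂̄_ζ, ∂̄_η], Δ]; flatness of ∂̄ identifies the inner bracket.
    rw [proj10L_comm_nablaFun dbar h3 h1 h2, proj10L_comm_nablaFun dbar h3 h2 h1,
      comm_jacobi hP hQ h3, map_add, add_sub_cancel_right,
      comm_congr (dcAt_dbarOp dbar h12) h3 heq (Eventually.of_forall fun _ => rfl),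
      ← nablaFun_eq dbar h3 h12]

end DbarOperators

end HolGauge

end

noncomputable section
namespace HolGauge
open VectorField

/-! ### The algebroids D^{1,0}E and DE, and the isomorphism ι. -/

section GaugeAlgebroids

variable {EX : Type*} [NormedAddCommGroup EX] [NormedSpace ℂ EX] [FiniteDimensional ℂ EX]
  {M : Type*} [TopologicalSpace M] [T2Space M] [ChartedSpace EX M] [IsManifold 𝓘(ℂ, EX) ω M]
  {F : Type*} [NormedAddCommGroup F] [NormedSpace ℂ F]
  {V : M → Type*} [TopologicalSpace (TotalSpace F V)]
  [∀ x, AddCommGroup (V x)] [∀ x, Module ℂ (V x)] [∀ x, TopologicalSpace (V x)]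
  [FiberBundle F V] [VectorBundle ℂ F V] [ContMDiffVectorBundle ∞ F V 𝓘(ℝ, EX)]
  (dbar : DbarConnection EX (vecBundle EX F V)) {x : M}

/-- Brackets of (1,0)-fields are of type (1,0), so here the projection only records membership in
D^{1,0}E. -/
theorem incl10_proj10L_comm {Δ Δ' : ∀ y, (D10 EX F V).Fib y}
    (h : DCAt (fun y => incl10 y (Δ y)) x) (h' : DCAt (fun y => incl10 y (Δ' y)) x) :
    incl10 x (proj10L dbar x (comm (fun y => incl10 y (Δ y)) (fun y => incl10 y (Δ' y)) x))
      = comm (fun y => incl10 y (Δ y)) (fun y => incl10 y (Δ' y)) x := by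
  apply proj10L_of_mem
  rw [comm_symb h h']
  exact cLie_mem_T10 h.2 h'.2 (Eventually.of_forall fun y => symb_incl10_mem _)
    (Eventually.of_forall fun y => symb_incl10_mem _)

theorem dcAt_bracket10 {Δ Δ' : ∀ y, (D10 EX F V).Fib y}
    (h : DCAt (fun y => incl10 y (Δ y)) x) (h' : DCAt (fun y => incl10 y (Δ' y)) x) :
    DCAt (fun y => incl10 y
      (proj10L dbar y (comm (fun y => incl10 y (Δ y)) (fun y => incl10 y (Δ' y)) y))) x := by
  refine (h.comm h').congr ?_
  filter_upwards [h.eventually, h'.eventually] with y h1 h2 using incl10_proj10L_comm dbar h1 h2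

/-- The complex Lie algebroid `D^{1,0} E`. -/
def algebroid10 (hvb : (D10 EX F V).IsVectorBundle EX) : ComplexLieAlgebroid EX (D10 EX F V) where
  isVectorBundle := hvb
  anchor x := LinearMap.snd ℂ _ _ ∘ₗ (DCfib EX F V x).subtype ∘ₗ incl10 x
  bracket Δ Δ' x := proj10L dbar x (comm (fun y => incl10 y (Δ y)) (fun y => incl10 y (Δ' y)) x)
  anchor_smooth U hU s hs := (smoothCVF_iff hU).2 fun x hx => ((d10_isSmooth_iff hU).1 hs x hx).2
  bracket_smooth U hU s t hs ht := (d10_isSmooth_iff hU).2 fun x hx =>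
    dcAt_bracket10 dbar ((d10_isSmooth_iff hU).1 hs x hx) ((d10_isSmooth_iff hU).1 ht x hx)
  add_bracket U hU s s' t hs hs' ht x hx := by
    simp only [map_add (incl10 _)]
    rw [comm_add_left ((d10_isSmooth_iff hU).1 hs x hx) ((d10_isSmooth_iff hU).1 hs' x hx)
      ((d10_isSmooth_iff hU).1 ht x hx), map_add]
  smul_bracket U hU c s t hs ht x hx := by
    simp only [map_smul (incl10 _)]
    rw [comm_const_smul_left c ((d10_isSmooth_iff hU).1 hs x hx)
      ((d10_isSmooth_iff hU).1 ht x hx), map_smul]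
  skew U hU s t hs ht x hx := by
    rw [comm_swap ((d10_isSmooth_iff hU).1 hs x hx) ((d10_isSmooth_iff hU).1 ht x hx), map_neg]
  jacobi U hU s t r hs ht hr x hx := by
    have h1 := (d10_isSmooth_iff hU).1 hs x hx
    have h2 := (d10_isSmooth_iff hU).1 ht x hx
    have h3 := (d10_isSmooth_iff hU).1 hr x hx
    have e : ∀ {s t : ∀ y, (D10 EX F V).Fib y}, DCAt (fun y => incl10 y (s y)) x →
        DCAt (fun y => incl10 y (t y)) x → ∀ᶠ y in 𝓝 x, incl10 y
          (proj10L dbar y (comm (fun y => incl10 y (s y)) (fun y => incl10 y (t y)) y))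
          = comm (fun y => incl10 y (s y)) (fun y => incl10 y (t y)) y := by
      intro s t h1 h2
      filter_upwards [h1.eventually, h2.eventually] with y h1 h2 using incl10_proj10L_comm dbar h1 h2
    have er : ∀ {s : ∀ y, (D10 EX F V).Fib y}, ∀ᶠ y in 𝓝 x, incl10 y (s y) = incl10 y (s y) :=
      Eventually.of_forall fun _ => rfl
    rw [comm_congr h1 (h2.comm h3) er (e h2 h3), comm_congr (h1.comm h2) h3 (e h1 h2) er,
      comm_congr h2 (h1.comm h3) er (e h1 h3), comm_jacobi h1 h2 h3, map_add]
  leibniz U hU f s t hf hs ht x hx := by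
    have h1 := (d10_isSmooth_iff hU).1 hs x hx
    have h2 := (d10_isSmooth_iff hU).1 ht x hx
    simp only [map_smul (incl10 _)]
    rw [comm_smul_right ((contMDiffOn_iff_funAt hU).1 hf x hx) h1 h2, map_add, map_smul, map_smul,
      proj10L_incl10]
    rfl

theorem cAct_ofReal {f : M → ℝ} (hf : FunAt EX f x) (v : TangentSpace 𝓘(ℝ, EX) x) :
    cAct EX ((1 : ℂ) ⊗ₜ[ℝ] v) (fun y => (f y : ℂ)) = (tAct EX v f : ℂ) := by
  rw [cAct_eq, cRe_tmul, cIm_tmul, Complex.one_re, Complex.one_im, one_smul, zero_smul]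
  have h0 : dAct (fun y => (f y : ℂ)) (0 : TangentSpace 𝓘(ℝ, EX) x) = 0 := map_zero _
  rw [h0, mul_zero, add_zero]
  exact dAct_clm hf Complex.ofRealCLM v

/-- The element of `D_ℂ E` defined by an element of `DE`: the same operator, with the real symbol
considered as a complex tangent vector. -/
def deToDC (D : (DE dbar).Fib x) : DCfib EX F V x :=
  ⟨({ toFun := (DE.val D).1
      map_add' := map_add (DE.val D).1
      map_smul' := (Subtype.property (p := fun D => D ∈ Dfib EX F V x) D).2 },
    (1 : ℂ) ⊗ₜ[ℝ] (DE.val D).2), by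
    have hD := Subtype.property (p := fun D => D ∈ Dfib EX F V x) D
    intro f hf e
    have hre : ContMDiff 𝓘(ℝ, EX) 𝓘(ℝ, ℝ) ∞ (fun y => (f y).re) :=
      Complex.reCLM.contDiff.contMDiff.comp hf
    have him : ContMDiff 𝓘(ℝ, EX) 𝓘(ℝ, ℝ) ∞ (fun y => (f y).im) :=
      Complex.imCLM.contDiff.contMDiff.comp hf
    have h1 := hD.1 _ hre e
    have h2 := hD.1 _ him (Complex.I • e)
    -- Only the Leibniz rule over real functions is given. Writing fe = (Re f)e + (Im f)(ie) and
    -- using complex linearity of the operator extends it to complex f.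
    have hs : Sec.mul EX F V f hf e = Sec.rmul EX F V _ hre e
        + Sec.rmul EX F V _ him (Complex.I • e) := by
      ext y
      change f y • e.1 y = ((f y).re : ℂ) • e.1 y + ((f y).im : ℂ) • (Complex.I • e.1 y)
      rw [smul_smul, ← add_smul, Complex.re_add_im]
    have h3 : (DE.val D).1 (Complex.I • e) = Complex.I • (DE.val D).1 e := hD.2 Complex.I e
    have h4 : cAct EX ((1 : ℂ) ⊗ₜ[ℝ] (DE.val D).2) f
        = (tAct EX (DE.val D).2 (fun y => (f y).re) : ℂ)
          + Complex.I * (tAct EX (DE.val D).2 (fun y => (f y).im) : ℂ) := by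
      have e1 := cAct_real _ hre (DE.val D).2 1
      have e2 := cAct_real _ him (DE.val D).2 1
      have hfre : FunAt EX (fun y => ((f y).re : ℂ)) x :=
        funAt_of_contMDiff (Complex.ofRealCLM.contDiff.contMDiff.comp hre) x
      have hfim : FunAt EX (fun y => ((f y).im : ℂ)) x :=
        funAt_of_contMDiff (Complex.ofRealCLM.contDiff.contMDiff.comp him) x
      rw [one_mul] at e1 e2
      rw [← e1, ← e2, ← cAct_const_mul _ _ hfim, ← cAct_add _ hfre ((funAt_const _ x).mul hfim)]
      congr 1
      ext y
      rw [mul_comm, Complex.re_add_im]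
    change (DE.val D).1 (Sec.mul EX F V f hf e)
      = cAct EX ((1 : ℂ) ⊗ₜ[ℝ] (DE.val D).2) f • e.1 x + f x • (DE.val D).1 e
    rw [hs, map_add, h4]
    refine (congrArg₂ (· + ·) h1 h2).trans ?_
    change _ + (tAct EX (DE.val D).2 (fun y => (f y).im) • (Complex.I • e.1 x)
      + (f x).im • (DE.val D).1 (Complex.I • e)) = _
    rw [h3]
    simp only [← Complex.coe_smul]
    have hfx : f x = ((f x).re : ℂ) + ((f x).im : ℂ) * Complex.I := (Complex.re_add_im _).symm
    conv_rhs => rw [hfx]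
    simp only [DE.val]
    module⟩

/-- The element of `DE` defined by an element of `D_ℂ E` with real symbol. -/
def deOfDC (D : DCfib EX F V x) (hD : cIm (symb D) = 0) : (DE dbar).Fib x :=
  show Dfib EX F V x from ⟨(D.1.1.restrictScalars ℝ, cRe (symb D)), by
    refine ⟨fun f hf e => ?_, fun c e => map_smul D.1.1 c e⟩
    have h := D.2 (fun y => (f y : ℂ)) (Complex.ofRealCLM.contDiff.contMDiff.comp hf) e
    have hs : D.1.2 = (1 : ℂ) ⊗ₜ[ℝ] cRe (symb D) := by
      have := eq_cRe_add_cIm (symb D)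
      rwa [hD, TensorProduct.tmul_zero, add_zero] at this
    rw [hs, cAct_real f hf, one_mul] at h
    simp only [Complex.coe_smul] at h
    exact h⟩

variable {dbar}

theorem symb_deToDC (D : (DE dbar).Fib x) : symb (deToDC dbar D) = (1 : ℂ) ⊗ₜ[ℝ] (DE.val D).2 := rfl

theorem cIm_symb_deToDC (D : (DE dbar).Fib x) : cIm (symb (deToDC dbar D)) = 0 := by
  rw [symb_deToDC, cIm_tmul, Complex.one_im, zero_smul]

theorem deToDC_deOfDC (D : DCfib EX F V x) (hD : cIm (symb D) = 0) :
    deToDC dbar (deOfDC dbar D hD) = D := by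
  refine Subtype.ext (Prod.ext (LinearMap.ext fun e => rfl) ?_)
  have := eq_cRe_add_cIm (symb D)
  rw [hD, TensorProduct.tmul_zero, add_zero] at this
  exact this.symm

theorem deToDC_injective : Function.Injective (deToDC (x := x) dbar) := by
  intro D D' h
  apply Subtype.ext
  have h1 := congrArg Subtype.val h
  refine Prod.ext (LinearMap.ext fun e => ?_) ?_
  · exact congrArg (fun P : (Sec EX F V →ₗ[ℂ] V x) × CT EX x => P.1 e) h1
  · have h2 := congrArg (fun P : (Sec EX F V →ₗ[ℂ] V x) × CT EX x => cRe P.2) h1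
    simpa [deToDC, DE.val] using h2

theorem deToDC_add (D D' : (DE dbar).Fib x) :
    deToDC dbar (D + D') = deToDC dbar D + deToDC dbar D' :=
  Subtype.ext (Prod.ext (LinearMap.ext fun _ => rfl) (TensorProduct.tmul_add _ _ _))

/-- Multiplication by z in DE is multiplication by z in D_ℂE up to a value of ∂̄: the correction
comes from the term -2∂̄ in the definition of j_DE. This makes the projection DE → D^{1,0}E complex
linear. -/
theorem deToDC_smul (z : ℂ) (D : (DE dbar).Fib x) : deToDC dbar (z • D)
    = z • deToDC dbar D
      - ((2 * z.im : ℂ) * Complex.I) • dbarOp dbar x (p01 EX x (symb (deToDC dbar D))) := by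
  have hop : ∀ e, (deToDC dbar (z • D)).1.1 e = z.re • (DE.val D).1 e + z.im •
      (Complex.I • ((DE.val D).1 e - (2 : ℝ) • (dbarOp dbar x (t01 x (DE.val D).2)).1.1 e)) :=
    fun e => rfl
  have hsy : (deToDC dbar (z • D)).1.2
    = (1 : ℂ) ⊗ₜ[ℝ] (z.re • (DE.val D).2 + z.im • jT EX x (DE.val D).2) := rfl
  refine Subtype.ext (Prod.ext (LinearMap.ext fun e => ?_) ?_)
  · rw [hop]
    change _ = z • (DE.val D).1 e
      - ((2 * z.im : ℂ) * Complex.I) • (dbarOp dbar x (t01 x (DE.val D).2)).1.1 e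
    simp only [← Complex.coe_smul]
    conv_rhs => rw [← Complex.re_add_im z]
    push_cast
    simp only [Complex.add_im, Complex.ofReal_im, Complex.mul_im, Complex.ofReal_re, Complex.I_im,
      mul_one, Complex.I_re, mul_zero, add_zero, zero_add]
    module
  · rw [hsy]
    change _ = z • ((1 : ℂ) ⊗ₜ[ℝ] (DE.val D).2)
      - ((2 * z.im : ℂ) * Complex.I) • (p01 EX x ((1 : ℂ) ⊗ₜ[ℝ] (DE.val D).2) : CT EX x)
    apply complexified_ext
    · simp [cRe_p01, cIm_p01]
      module
    · simp [cRe_p01, cIm_p01]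
      module

theorem deToDC_rsmul (r : ℝ) (D : (DE dbar).Fib x) : deToDC dbar (r • D)
    = (r : ℂ) • deToDC dbar D := by
  have h := deToDC_smul (r : ℂ) D
  rw [Complex.ofReal_im, Complex.ofReal_zero, mul_zero, zero_mul, zero_smul, sub_zero] at h
  rw [← h]; rfl

theorem symb_deToDC_I (D : (DE dbar).Fib x) : (DE.val (Complex.I • D)).2 = jT EX x (DE.val D).2 := by
  change (0 : ℝ) • (DE.val D).2 + (1 : ℝ) • jT EX x (DE.val D).2 = _
  rw [zero_smul, zero_add, one_smul]

/-- The inverse of `ι`. -/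
def iotaInv (x : M) : (DE dbar).Fib x →ₗ[ℂ] (D10 EX F V).Fib x where
  toFun D := proj10L dbar x (deToDC dbar D)
  map_add' D D' := by rw [deToDC_add, map_add]
  map_smul' z D := by
    rw [deToDC_smul, map_sub, map_smul, map_smul, proj10L_dbarOp, smul_zero, sub_zero,
      RingHom.id_apply]

/-- The element `Δ + ∂̄_{σ(Δ)‾}` of `D_ℂ E`. -/
def iotaDC (dbar : DbarConnection EX (vecBundle EX F V)) (Δ : (D10 EX F V).Fib x) :
    DCfib EX F V x :=
  incl10 x Δ + dbarOp dbar x (D10.symbConj Δ)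

theorem symb_iotaDC (Δ : (D10 EX F V).Fib x) :
    symb (iotaDC dbar Δ) = symb (incl10 x Δ) + cConj (symb (incl10 x Δ)) := rfl

theorem cIm_symb_iotaDC (Δ : (D10 EX F V).Fib x) : cIm (symb (iotaDC dbar Δ)) = 0 := by
  rw [symb_iotaDC, map_add, cIm_cConj, add_neg_cancel]

theorem cConj_p10 {x : M} (ξ : CT EX x) :
    cConj (p10 EX x ξ : CT EX x) = (p01 EX x (cConj ξ) : CT EX x) := by
  apply complexified_ext
  · rw [cRe_cConj, cRe_p10, cRe_p01, cRe_cConj, cIm_cConj, map_neg, sub_neg_eq_add]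
  · rw [cIm_cConj, cIm_p10, cIm_p01, cRe_cConj, cIm_cConj]
    module

theorem cConj_of_cIm {x : M} {ξ : CT EX x} (h : cIm ξ = 0) : cConj ξ = ξ := by
  apply complexified_ext
  · rw [cRe_cConj]
  · rw [cIm_cConj, h, neg_zero]

/-- For a real symbol, the conjugate of the (1,0)-part is the (0,1)-part, so ι adds back exactly
what the projection removed. -/
theorem iotaDC_proj10L {D : DCfib EX F V x} (hD : cIm (symb D) = 0) :
    iotaDC dbar (proj10L dbar x D) = D := by
  have h : D10.symbConj (proj10L dbar x D) = p01 EX x (symb D) := by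
    apply Subtype.ext
    change cConj (symb (incl10 x (proj10L dbar x D))) = _
    rw [symb_proj10L, cConj_p10, cConj_of_cIm hD]
  rw [iotaDC, h, incl10_proj10L, sub_add_cancel]

theorem proj10L_iotaDC (Δ : (D10 EX F V).Fib x) : proj10L dbar x (iotaDC dbar Δ) = Δ := by
  rw [iotaDC, map_add, proj10L_incl10, proj10L_dbarOp, add_zero]

/-- The isomorphism `ι : D^{1,0} E → DE`. -/
def iota (dbar : DbarConnection EX (vecBundle EX F V)) (x : M) :
    (D10 EX F V).Fib x ≃ₗ[ℂ] (DE dbar).Fib x :=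
  -- ι is constructed as an inverse, since complex linearity is known for the projection and passes
  -- to its inverse.
  LinearEquiv.symm
    { iotaInv (dbar := dbar) x with
      invFun := fun Δ => deOfDC dbar (iotaDC dbar Δ) (cIm_symb_iotaDC Δ)
      left_inv := fun D => by
        apply deToDC_injective
        rw [deToDC_deOfDC]
        exact iotaDC_proj10L (cIm_symb_deToDC D)
      right_inv := fun Δ => by
        change proj10L dbar x (deToDC dbar (deOfDC dbar (iotaDC dbar Δ) (cIm_symb_iotaDC Δ))) = Δ
        rw [deToDC_deOfDC, proj10L_iotaDC] }

theorem deToDC_iota (Δ : (D10 EX F V).Fib x) : deToDC dbar (iota dbar x Δ) = iotaDC dbar Δ :=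
  deToDC_deOfDC _ (cIm_symb_iotaDC Δ)

theorem iota_symm (D : (DE dbar).Fib x) :
    (iota dbar x).symm D = proj10L dbar x (deToDC dbar D) := rfl

theorem deToDC_iota_proj10L {D : DCfib EX F V x} (hD : cIm (symb D) = 0) :
    deToDC dbar (iota dbar x (proj10L dbar x D)) = D := by
  rw [deToDC_iota, iotaDC_proj10L hD]

theorem de_isSmooth_iff {Δ : ∀ y, (DE dbar).Fib y} {U : Set M} (hU : IsOpen U) :
    (DE dbar).IsSmooth U Δ ↔ ∀ x ∈ U, DCAt (fun y => deToDC dbar (Δ y)) x := by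
  constructor
  · intro h x hx
    refine ⟨?_, ((smoothVF_iff hU).1 h.2 x hx).ofReal⟩
    filter_upwards [hU.mem_nhds hx] with y hy e
    exact (vecBundle_isSmooth_iff hU).1 (h.1 e) y hy
  · intro h
    refine ⟨fun e => (vecBundle_isSmooth_iff hU).2 fun x hx => (h x hx).1.self_of_nhds e,
      (smoothVF_iff hU).2 fun x hx => (h x hx).2.1.congr (Eventually.of_forall fun y => ?_)⟩
    change (DE.val (Δ y)).2 = cRe ((1 : ℂ) ⊗ₜ[ℝ] (DE.val (Δ y)).2)
    rw [cRe_tmul, Complex.one_re, one_smul]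

theorem DCAt.iotaDC {Δ : ∀ y, (D10 EX F V).Fib y} (h : DCAt (fun y => incl10 y (Δ y)) x) :
    DCAt (fun y => HolGauge.iotaDC dbar (Δ y)) x :=
  h.add (dcAt_dbarOp dbar h.2.conj)

theorem isBundleIso_iota : IsBundleIso (iota dbar) := by
  intro U hU s
  rw [d10_isSmooth_iff hU, de_isSmooth_iff hU]
  simp only [deToDC_iota]
  refine ⟨fun h x hx => (h x hx).iotaDC, fun h x hx => ?_⟩
  have := (h x hx).proj10 dbar
  simpa only [proj10L_iotaDC] using this

/-- Brackets of real fields are real, hence DE is closed under the commutator of D_ℂE. -/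
theorem cIm_symb_comm {D D' : ∀ y, (DE dbar).Fib y} (h : DCAt (fun y => deToDC dbar (D y)) x)
    (h' : DCAt (fun y => deToDC dbar (D' y)) x) :
    symb (comm (fun y => deToDC dbar (D y)) (fun y => deToDC dbar (D' y)) x)
      = (1 : ℂ) ⊗ₜ[ℝ] mlieBracket 𝓘(ℝ, EX) (fun y => (DE.val (D y)).2)
        (fun y => (DE.val (D' y)).2) x := by
  have hv : ∀ {D : ∀ y, (DE dbar).Fib y}, DCAt (fun y => deToDC dbar (D y)) x →
      VFAt (fun y => (DE.val (D y)).2) x := fun h =>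
    h.2.1.congr (Eventually.of_forall fun y => by simp [symb_deToDC])
  rw [comm_symb h h', ← cLie_ofReal (hv h) (hv h')]
  rfl

variable (dbar) in
/-- The bracket of `DE`. -/
def deBracket (D D' : ∀ y, (DE dbar).Fib y) (x : M) : (DE dbar).Fib x :=
  iota dbar x (proj10L dbar x (comm (fun y => deToDC dbar (D y)) (fun y => deToDC dbar (D' y)) x))

/-- On elements with real symbol, the projection followed by ι inverts `deToDC`; this is how
`deBracket` brings the commutator back from D_ℂE to DE. With injectivity of `deToDC`, it reduces the
algebroid axioms to those of `comm`. -/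
theorem deToDC_deBracket {D D' : ∀ y, (DE dbar).Fib y} (h : DCAt (fun y => deToDC dbar (D y)) x)
    (h' : DCAt (fun y => deToDC dbar (D' y)) x) : deToDC dbar (deBracket dbar D D' x)
      = comm (fun y => deToDC dbar (D y)) (fun y => deToDC dbar (D' y)) x := by
  apply deToDC_iota_proj10L
  rw [cIm_symb_comm h h', cIm_tmul, Complex.one_im, zero_smul]

variable (dbar) in
/-- The real Lie algebroid `DE`. -/
def realAlgebroid (hvb : (DE dbar).IsVectorBundle EX) : RealLieAlgebroid EX (DE dbar) where
  isVectorBundle := hvb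
  anchor x :=
    { toFun := fun D => (DE.val D).2
      map_add' := fun D D' => rfl
      map_smul' := fun r D => by
        have h := congrArg (fun D => cRe (symb D)) (deToDC_rsmul r D)
        have h2 : symb ((r : ℂ) • deToDC dbar D) = (r : ℂ) • symb (deToDC dbar D) := rfl
        simp only [h2, symb_deToDC, cRe_smul] at h
        simp only [cRe_tmul, cIm_tmul, Complex.one_re, Complex.one_im, Complex.ofReal_re,
          Complex.ofReal_im, one_smul, zero_smul, sub_zero] at h
        exact h }
  bracket := deBracket dbar
  anchor_smooth U hU s hs := hs.2
  bracket_smooth U hU s t hs ht := (de_isSmooth_iff hU).2 fun x hx => by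
    have h1 := (de_isSmooth_iff hU).1 hs x hx
    have h2 := (de_isSmooth_iff hU).1 ht x hx
    refine (h1.comm h2).congr ?_
    filter_upwards [h1.eventually, h2.eventually] with y h1 h2 using deToDC_deBracket h1 h2
  add_bracket U hU s s' t hs hs' ht x hx := by
    have h1 := (de_isSmooth_iff hU).1 hs x hx
    have h2 := (de_isSmooth_iff hU).1 hs' x hx
    have h3 := (de_isSmooth_iff hU).1 ht x hx
    have h4 : DCAt (fun y => deToDC dbar (s y + s' y)) x := by
      simpa only [deToDC_add] using h1.add h2
    apply deToDC_injective
    rw [deToDC_add, deToDC_deBracket h1 h3, deToDC_deBracket h2 h3, deToDC_deBracket h4 h3]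
    simp only [deToDC_add]
    exact comm_add_left h1 h2 h3
  smul_bracket U hU c s t hs ht x hx := by
    have h1 := (de_isSmooth_iff hU).1 hs x hx
    have h2 := (de_isSmooth_iff hU).1 ht x hx
    have h3 : DCAt (fun y => deToDC dbar (c • s y)) x := by
      simpa only [deToDC_rsmul] using h1.const_smul (c : ℂ)
    apply deToDC_injective
    rw [deToDC_rsmul, deToDC_deBracket h1 h2, deToDC_deBracket h3 h2]
    simp only [deToDC_rsmul]
    exact comm_const_smul_left _ h1 h2
  skew U hU s t hs ht x hx := by
    have h1 := (de_isSmooth_iff hU).1 hs x hx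
    have h2 := (de_isSmooth_iff hU).1 ht x hx
    change deBracket dbar s t x = -deBracket dbar t s x
    rw [deBracket, deBracket, comm_swap h1 h2, map_neg, map_neg]
  jacobi U hU s t r hs ht hr x hx := by
    have h1 := (de_isSmooth_iff hU).1 hs x hx
    have h2 := (de_isSmooth_iff hU).1 ht x hx
    have h3 := (de_isSmooth_iff hU).1 hr x hx
    have e : ∀ {s t : ∀ y, (DE dbar).Fib y}, DCAt (fun y => deToDC dbar (s y)) x →
        DCAt (fun y => deToDC dbar (t y)) x → ∀ᶠ y in 𝓝 x, deToDC dbar (deBracket dbar s t y)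
          = comm (fun y => deToDC dbar (s y)) (fun y => deToDC dbar (t y)) y := by
      intro s t h1 h2
      filter_upwards [h1.eventually, h2.eventually] with y h1 h2 using deToDC_deBracket h1 h2
    have er : ∀ {s : ∀ y, (DE dbar).Fib y},
        ∀ᶠ y in 𝓝 x, deToDC dbar (s y) = deToDC dbar (s y) :=
      Eventually.of_forall fun _ => rfl
    change deBracket dbar s (deBracket dbar t r) x
      = deBracket dbar (deBracket dbar s t) r x + deBracket dbar t (deBracket dbar s r) x
    unfold deBracket at e ⊢
    rw [comm_congr h1 (h2.comm h3) er (e h2 h3), comm_congr (h1.comm h2) h3 (e h1 h2) er,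
      comm_congr h2 (h1.comm h3) er (e h1 h3), comm_jacobi h1 h2 h3, map_add, map_add]
  leibniz U hU f s t hf hs ht x hx := by
    have h1 := (de_isSmooth_iff hU).1 hs x hx
    have h2 := (de_isSmooth_iff hU).1 ht x hx
    have hfx : FunAt EX f x := (contMDiffOn_iff_funAt hU).1 hf x hx
    have hf' : FunAt EX (fun y => (f y : ℂ)) x := hfx.clm Complex.ofRealCLM
    have h3 : DCAt (fun y => deToDC dbar (f y • t y)) x := by
      simpa only [deToDC_rsmul] using h2.smul hf'
    apply deToDC_injective
    rw [deToDC_add, deToDC_rsmul, deToDC_rsmul, deToDC_deBracket h1 h2, deToDC_deBracket h1 h3]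
    simp only [deToDC_rsmul]
    rw [comm_smul_right hf' h1 h2]
    congr 2
    exact cAct_ofReal hfx (DE.val (s x)).2

end GaugeAlgebroids

end HolGauge

end

noncomputable section
namespace HolGauge
open VectorField

/-! ### Vector bundle structures from compatible local trivializations. -/

section LocalTriviality

universe u v w

variable (EX : Type u) [NormedAddCommGroup EX] [NormedSpace ℂ EX]
  {M : Type v} [TopologicalSpace M] [ChartedSpace EX M]

/-- Local trivializations of the family `A`, compatible with the notion `S` of section which is
smooth around a point. -/
structure LocalTrivializations (A : CBundle.{v, w} M) (G : Type*) [NormedAddCommGroup G]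
    [NormedSpace ℂ G] (S : (∀ y, A.Fib y) → M → Prop) where
  base : M → Set M
  isOpen_base : ∀ x, IsOpen (base x)
  mem_base : ∀ x, x ∈ base x
  coord : ∀ (_ : M) (y : M), A.Fib y →ₗ[ℂ] G
  lift : ∀ (_ : M) (y : M), G →ₗ[ℂ] A.Fib y
  coord_lift : ∀ x, ∀ y ∈ base x, ∀ g, coord x y (lift x y g) = g
  lift_coord : ∀ x, ∀ y ∈ base x, ∀ a, lift x y (coord x y a) = a
  smooth_iff : ∀ x, ∀ y ∈ base x, ∀ s, S s y ↔ FunAt EX (fun z => coord x z (s z)) y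

variable {EX} {A : CBundle.{v, w} M} {G : Type*} [NormedAddCommGroup G]
    [NormedSpace ℂ G] [FiniteDimensional ℂ G] {S : (∀ y, A.Fib y) → M → Prop}
    (T : LocalTrivializations EX A G S)

/-- In finite dimensions an operator is a fixed linear function of its values on a basis. -/
theorem contMDiffAt_clm_of_apply {f : M → G →L[ℂ] G} {x : M}
    (h : ∀ g, ContMDiffAt 𝓘(ℝ, EX) 𝓘(ℝ, G) ∞ (fun y => f y g) x) :
    ContMDiffAt 𝓘(ℝ, EX) 𝓘(ℝ, G →L[ℂ] G) ∞ f x := by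
  let b := Module.finBasis ℂ G
  let L : (Fin (Module.finrank ℂ G) → G) →L[ℂ] (G →L[ℂ] G) := LinearMap.toContinuousLinearMap
    (LinearMap.toContinuousLinearMap.toLinearMap ∘ₗ (b.constr ℂ).toLinearMap)
  have hf : f = fun y => L.restrictScalars ℝ (fun i => f y (b i)) := by
    ext1 y
    have h1 : b.constr ℂ (fun i => f y (b i)) = (f y : G →ₗ[ℂ] G) := b.ext fun i => by simp
    change f y = LinearMap.toContinuousLinearMap (b.constr ℂ (fun i => f y (b i)))
    rw [h1]
    rfl
  rw [hf]
  exact (L.restrictScalars ℝ).contDiff.contMDiff.contMDiffAt.comp x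
    (contMDiffAt_pi_space.2 fun i => h (b i))

namespace LocalTrivializations

/-- The pretrivialization with centre `x`. -/
def pretriv (x : M) : Pretrivialization G (TotalSpace.proj : TotalSpace G A.Fib → M) where
  toFun p := (p.1, T.coord x p.1 p.2)
  invFun q := ⟨q.1, T.lift x q.1 q.2⟩
  source := TotalSpace.proj ⁻¹' T.base x
  target := T.base x ×ˢ univ
  map_source' p hp := ⟨hp, mem_univ _⟩
  map_target' q hq := hq.1
  left_inv' p hp := by
    change (⟨p.1, T.lift x p.1 (T.coord x p.1 p.2)⟩ : TotalSpace G A.Fib) = p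
    rw [T.lift_coord x p.1 hp]
  right_inv' q hq := by
    change (q.1, T.coord x q.1 (T.lift x q.1 q.2)) = q
    rw [T.coord_lift x q.1 hq.1]
  open_target := (T.isOpen_base x).prod isOpen_univ
  baseSet := T.base x
  open_baseSet := T.isOpen_base x
  source_eq := rfl
  target_eq := rfl
  proj_toFun p hp := rfl

theorem pretriv_symm {x y : M} (hy : y ∈ T.base x) (g : G) :
    (T.pretriv x).symm y g = T.lift x y g := by
  rw [Pretrivialization.symm_apply _ hy]
  rfl

/-- The coordinate changes. -/
def coordChange (x x' y : M) : G →L[ℂ] G :=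
  LinearMap.toContinuousLinearMap (T.coord x' y ∘ₗ T.lift x y)

/-- A section with constant coordinates in one trivialization is smooth by `smooth_iff`, hence has
smooth coordinates in any other. No formula for the coordinate changes is needed. -/
theorem contMDiffAt_coordChange {x x' y : M} (hy : y ∈ T.base x) (hy' : y ∈ T.base x') :
    ContMDiffAt 𝓘(ℝ, EX) 𝓘(ℝ, G →L[ℂ] G) ∞ (T.coordChange x x') y := by
  refine contMDiffAt_clm_of_apply fun g => ?_
  have h : FunAt EX (fun z => T.coord x z (T.lift x z g)) y := by
    refine (funAt_const g y).congr ?_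
    filter_upwards [(T.isOpen_base x).mem_nhds hy] with z hz using T.coord_lift x z hz g
  exact ((T.smooth_iff x' y hy' fun z => T.lift x z g).1
    ((T.smooth_iff x y hy fun z => T.lift x z g).2 h)).contMDiffAt

/-- The topology of the fibres. -/
@[reducible] def fibTopology (y : M) : TopologicalSpace (A.Fib y) :=
  TopologicalSpace.induced (fun a => (y, T.coord y y a)) inferInstance

/-- The vector prebundle defined by local trivializations. -/
def prebundle : letI := T.fibTopology
    VectorPrebundle ℂ G A.Fib :=
  letI := T.fibTopology
  { pretrivializationAtlas := range T.pretriv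
    pretrivialization_linear' := by
      rintro _ ⟨x, rfl⟩
      exact ⟨fun y _ => ⟨(T.coord x y).map_add, (T.coord x y).map_smul⟩⟩
    pretrivializationAt := T.pretriv
    mem_base_pretrivializationAt := T.mem_base
    pretrivialization_mem_atlas := fun x => ⟨x, rfl⟩
    exists_coordChange := by
      rintro _ ⟨x, rfl⟩ _ ⟨x', rfl⟩
      refine ⟨T.coordChange x x', fun y hy =>
        (T.contMDiffAt_coordChange hy.1 hy.2).continuousAt.continuousWithinAt, fun y hy g => ?_⟩
      rw [T.pretriv_symm hy.1]
      rfl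
    totalSpaceMk_isInducing := fun y => ⟨rfl⟩ }

/-- The trivializations form a vector prebundle, whose smooth sections are by `smooth_iff` the
prescribed ones. The model fibre lies in `Type` because `CBundle.IsVectorBundle` asks for this. -/
theorem isVectorBundle_of_small [IsManifold 𝓘(ℂ, EX) ω M] {G : Type} [NormedAddCommGroup G]
    [NormedSpace ℂ G] [FiniteDimensional ℂ G] (T : LocalTrivializations EX A G S)
    (hS : ∀ U : Set M, IsOpen U → ∀ s, A.IsSmooth U s ↔ ∀ x ∈ U, S s x) :
    A.IsVectorBundle EX := by
  let _ := T.fibTopology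
  let _ := T.prebundle.totalSpaceTopology
  let _ := T.prebundle.toFiberBundle
  have := T.prebundle.toVectorBundle
  have hsm : ContMDiffVectorBundle ∞ G A.Fib 𝓘(ℝ, EX) := by
    refine ⟨?_⟩
    intro e e' he he'
    have hl : e.IsLinear ℝ := inferInstance
    have hl' : e'.IsLinear ℝ := inferInstance
    obtain ⟨_, ⟨x, rfl⟩, rfl⟩ := he
    obtain ⟨_, ⟨x', rfl⟩, rfl⟩ := he'
    intro y hy
    have h := ((ContinuousLinearMap.restrictScalarsL ℂ G G ℝ ℝ).contDiff.contMDiff.contMDiffAt.comp y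
      (T.contMDiffAt_coordChange hy.1 hy.2)).contMDiffWithinAt
      (s := T.base x ∩ T.base x')
    refine h.congr_of_mem ?_ hy
    intro z hz
    ext g
    rw [ContinuousLinearEquiv.coe_coe, Trivialization.coordChangeL_apply _ _ hz]
    change (T.pretriv x' ⟨z, (T.pretriv x).symm z g⟩).2 = _
    rw [T.pretriv_symm hz.1]
    rfl
  refine ⟨G, inferInstance, inferInstance, inferInstance, inferInstance, inferInstance,
    inferInstance, inferInstance, hsm, fun U hU s => ?_⟩
  rw [hS U hU, contMDiffOn_iff_secAt hU]
  refine forall₂_congr fun x hx => ?_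
  rw [T.smooth_iff x x (T.mem_base x)]
  have hx' : T.pretriv x ∈ T.prebundle.pretrivializationAtlas := ⟨x, rfl⟩
  have : MemTrivializationAtlas
      (T.prebundle.trivializationOfMemPretrivializationAtlas hx') := ⟨_, hx', rfl⟩
  exact (secAt_iff_funAt (T.prebundle.trivializationOfMemPretrivializationAtlas hx')
    (T.mem_base x)).symm

end LocalTrivializations

end LocalTriviality

end HolGauge

end

noncomputable section
namespace HolGauge
open VectorField

/-! ### Complex derivatives of vector valued functions. -/

section VectorValuedFunctions

variable {EX : Type*} [NormedAddCommGroup EX] [NormedSpace ℂ EX]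
  {M : Type*} [TopologicalSpace M] [ChartedSpace EX M] [IsManifold 𝓘(ℂ, EX) ω M]
  {F : Type*} [NormedAddCommGroup F] [NormedSpace ℂ F] {x : M}

/-- The derivative of a vector valued function, extended complex linearly. -/
def vAct (g : M → F) (x : M) : CT EX x →ₗ[ℂ] F :=
  let L : TangentSpace 𝓘(ℝ, EX) x →L[ℝ] F := mfderiv 𝓘(ℝ, EX) 𝓘(ℝ, F) g x
  LinearMap.liftBaseChange ℂ L.toLinearMap

theorem vAct_eq (g : M → F) (ξ : CT EX x) :
    vAct g x ξ = dAct g (cRe ξ) + Complex.I • dAct g (cIm ξ) := by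
  conv_lhs => rw [eq_cRe_add_cIm ξ]
  unfold vAct
  rw [map_add, LinearMap.liftBaseChange_tmul, LinearMap.liftBaseChange_tmul, one_smul]
  rfl

/-- Composition with functionals reduces the vector valued case to the scalar one; `vec_ext` leads
back. -/
theorem apply_vAct {g : M → F} (hg : FunAt EX g x) (ξ : CT EX x) (ℓ : F →L[ℂ] ℂ) :
    ℓ (vAct g x ξ) = cAct EX ξ (fun y => ℓ (g y)) := by
  have h : ∀ v : TangentSpace 𝓘(ℝ, EX) x, dAct (fun y => ℓ (g y)) v = ℓ (dAct g v) :=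
    fun v => dAct_clm hg (ℓ.restrictScalars ℝ) v
  rw [vAct_eq, cAct_eq, h, h, map_add, map_smul, smul_eq_mul]

theorem FunAt.complexCLM {g : M → F} (hg : FunAt EX g x) (ℓ : F →L[ℂ] ℂ) :
    FunAt EX (fun y => ℓ (g y)) x := hg.clm (ℓ.restrictScalars ℝ)

theorem vAct_congr {g g' : M → F} (h : g =ᶠ[𝓝 x] g') : vAct g x = vAct (EX := EX) g' x := by
  refine LinearMap.ext fun ξ => ?_
  rw [vAct_eq, vAct_eq, dAct_congr h, dAct_congr h]

variable [FiniteDimensional ℂ F]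

theorem vec_ext {u v : F} (h : ∀ ℓ : F →L[ℂ] ℂ, ℓ u = ℓ v) : u = v :=
  (Module.finBasis ℂ F).ext_elem fun i =>
    h (LinearMap.toContinuousLinearMap ((Module.finBasis ℂ F).coord i))

theorem vAct_add {g g' : M → F} (hg : FunAt EX g x) (hg' : FunAt EX g' x) (ξ : CT EX x) :
    vAct (fun y => g y + g' y) x ξ = vAct g x ξ + vAct g' x ξ := by
  refine vec_ext fun ℓ => ?_
  rw [map_add, apply_vAct (hg.add hg'), apply_vAct hg, apply_vAct hg',
    ← cAct_add ξ (hg.complexCLM ℓ) (hg'.complexCLM ℓ)]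
  simp only [map_add]

theorem FunAt.csmul {f : M → ℂ} {g : M → F} (hf : FunAt EX f x) (hg : FunAt EX g x) :
    FunAt EX (fun y => f y • g y) x := by
  filter_upwards [hf, hg] with y h1 h2
  have hc : ContDiff ℝ ∞ (fun p : ℂ × F => p.1 • p.2) := contDiff_fst.smul contDiff_snd
  exact hc.contMDiff.contMDiffAt.comp y (h1.prodMk_space h2)

theorem vAct_smul {f : M → ℂ} {g : M → F} (hf : FunAt EX f x) (hg : FunAt EX g x) (ξ : CT EX x) :
    vAct (fun y => f y • g y) x ξ = cAct EX ξ f • g x + f x • vAct g x ξ := by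
  refine vec_ext fun ℓ => ?_
  rw [map_add, map_smul, map_smul, apply_vAct (hf.csmul hg), apply_vAct hg, smul_eq_mul, smul_eq_mul,
    ← cAct_mul ξ hf (hg.complexCLM ℓ)]
  simp only [map_smul, smul_eq_mul]

theorem FunAt.vAct {g : M → F} {ξ : ∀ y : M, CT EX y} (hg : FunAt EX g x) (hξ : CVFAt ξ x) :
    FunAt EX (fun y => HolGauge.vAct g y (ξ y)) x := by
  simp only [vAct_eq]
  exact (hg.dAct hξ.1).add ((funAt_const Complex.I x).csmul (hg.dAct hξ.2))

end VectorValuedFunctions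

/-! ### Coordinates on T^{1,0} and on E. -/

section Coordinates

variable {EX : Type*} [NormedAddCommGroup EX] [NormedSpace ℂ EX] [FiniteDimensional ℂ EX]
  {M : Type*} [TopologicalSpace M] [ChartedSpace EX M] [IsManifold 𝓘(ℂ, EX) ω M]

theorem tCoord_jT {x y : M} (hy : y ∈ tBase (EX := EX) x) (v : TangentSpace 𝓘(ℝ, EX) y) :
    tCoord x y (jT EX y v) = Complex.I • tCoord x y v := by
  have hy' : y ∈ (chartAt EX x).source := hy
  rw [tCoord_eq hy, tCoord_eq hy, trivializationAt_tangent_apply hy',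
    trivializationAt_tangent_apply hy', dAct_jT (mdifferentiableAt_chart hy')]

/-- The complex linear extension of `tCoord`. -/
def ctCoord (x y : M) : CT EX y →ₗ[ℂ] EX := LinearMap.liftBaseChange ℂ (tCoord x y)

theorem ctCoord_eq {x y : M} (ξ : CT EX y) :
    ctCoord x y ξ = tCoord x y (cRe ξ) + Complex.I • tCoord x y (cIm ξ) := by
  conv_lhs => rw [eq_cRe_add_cIm ξ]
  unfold ctCoord
  rw [map_add, LinearMap.liftBaseChange_tmul, LinearMap.liftBaseChange_tmul, one_smul]

/-- A (1,0)-vector is a - i·ja, and in coordinates both summands contribute the components of a;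
hence the factor 2. -/
theorem ctCoord_of_mem {x y : M} (hy : y ∈ tBase (EX := EX) x) {ξ : CT EX y} (hξ : ξ ∈ T10 EX y) :
    ctCoord x y ξ = (2 : ℝ) • tCoord x y (cRe ξ) := by
  rw [ctCoord_eq, mem_T10_iff.1 hξ, map_neg, tCoord_jT hy, smul_neg, smul_smul, Complex.I_mul_I]
  module

/-- The element of `T^{1,0}_y` with given components. -/
def lift10 (x y : M) : EX →ₗ[ℂ] T10 EX y :=
  -- Prescribing values on a complex basis gives a complex linear map by construction, `tExt` being
  -- provided only as a real linear one.
  (Module.finBasis ℂ EX).constr ℂ fun i =>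
    p10 EX y ((1 : ℂ) ⊗ₜ[ℝ] tExt x y (Module.finBasis ℂ EX i))

theorem ctCoord_lift10 {x y : M} (hy : y ∈ tBase (EX := EX) x) (u : EX) :
    ctCoord x y (lift10 x y u : CT EX y) = u := by
  have h : ctCoord x y ∘ₗ (T10 EX y).subtype ∘ₗ lift10 x y = LinearMap.id := by
    refine (Module.finBasis ℂ EX).ext fun i => ?_
    rw [LinearMap.comp_apply, LinearMap.comp_apply, lift10, Module.Basis.constr_basis,
      LinearMap.id_apply, Submodule.subtype_apply, ctCoord_of_mem hy (Subtype.property _), cRe_p10,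
      cRe_tmul, cIm_tmul, Complex.one_re, Complex.one_im, one_smul, zero_smul, map_zero, add_zero,
      map_smul, tCoord_tExt hy]
    module
  exact congrArg (fun L : EX →ₗ[ℂ] EX => L u) h

variable {F : Type*} [NormedAddCommGroup F] [NormedSpace ℂ F]
  {V : M → Type*} [TopologicalSpace (TotalSpace F V)]
  [∀ x, AddCommGroup (V x)] [∀ x, Module ℂ (V x)] [∀ x, TopologicalSpace (V x)]
  [FiberBundle F V] [VectorBundle ℂ F V]

variable (F V) in
/-- The vector at `y` with given components in the preferred trivialization at `x`. -/
def vExt (x y : M) : F →ₗ[ℂ] V y := ((trivializationAt F V x).symmL ℂ y).toLinearMap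

variable (F V) in
/-- The components of a vector at `y` in the preferred trivialization at `x`. -/
def vCoord (x y : M) : V y →ₗ[ℂ] F :=
  ((trivializationAt F V x).continuousLinearMapAt ℂ y).toLinearMap

variable (F V) in
/-- The base set of the preferred trivialization at `x`. -/
def vBase (x : M) : Set M := (trivializationAt F V x).baseSet

theorem vBase_mem_nhds {x y : M} (hy : y ∈ vBase F V x) : vBase F V x ∈ 𝓝 y :=
  (trivializationAt F V x).open_baseSet.mem_nhds hy

theorem vCoord_eq {x y : M} (hy : y ∈ vBase F V x) (v : V y) :
    vCoord F V x y v = (trivializationAt F V x ⟨y, v⟩).2 :=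
  congrFun (Trivialization.coe_linearMapAt_of_mem (R := ℂ) _ hy) v

theorem vExt_vCoord {x y : M} (hy : y ∈ vBase F V x) (v : V y) :
    vExt F V x y (vCoord F V x y v) = v :=
  Trivialization.symmL_continuousLinearMapAt (R := ℂ) _ hy v

theorem vCoord_vExt {x y : M} (hy : y ∈ vBase F V x) (v : F) :
    vCoord F V x y (vExt F V x y v) = v :=
  Trivialization.continuousLinearMapAt_symmL (R := ℂ) _ hy v

variable [ContMDiffVectorBundle ∞ F V 𝓘(ℝ, EX)]

theorem secAt_iff_vCoord {s : ∀ y, V y} {x y : M} (hy : y ∈ vBase F V x) :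
    SecAt EX F V s y ↔ FunAt EX (fun z => vCoord F V x z (s z)) y := by
  have h : (fun z => vCoord F V x z (s z)) =ᶠ[𝓝 y] fun z => (trivializationAt F V x ⟨z, s z⟩).2 := by
    filter_upwards [vBase_mem_nhds hy] with z hz using vCoord_eq hz _
  rw [secAt_iff_funAt _ hy]
  exact ⟨fun h' => h'.congr h, fun h' => h'.congr h.symm⟩

theorem secAt_vExt {g : M → F} {x y : M} (hy : y ∈ vBase F V x) (hg : FunAt EX g y) :
    SecAt EX F V (fun z => vExt F V x z (g z)) y := by
  rw [secAt_iff_vCoord hy]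
  refine hg.congr ?_
  filter_upwards [vBase_mem_nhds hy] with z hz using vCoord_vExt hz _

end Coordinates

/-! ### Connection matrix and symbol of an element of D_ℂE. -/

section TrivializationOfD10

variable {EX : Type*} [NormedAddCommGroup EX] [NormedSpace ℂ EX] [FiniteDimensional ℂ EX]
  {M : Type*} [TopologicalSpace M] [T2Space M] [ChartedSpace EX M] [IsManifold 𝓘(ℂ, EX) ω M]
  {F : Type*} [NormedAddCommGroup F] [NormedSpace ℂ F] [FiniteDimensional ℂ F]
  {V : M → Type*} [TopologicalSpace (TotalSpace F V)]
  [∀ x, AddCommGroup (V x)] [∀ x, Module ℂ (V x)] [∀ x, TopologicalSpace (V x)]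
  [FiberBundle F V] [VectorBundle ℂ F V] [ContMDiffVectorBundle ∞ F V 𝓘(ℝ, EX)] {x y : M}

theorem opAct_sum {ι : Type*} (S : Finset ι) {s : ι → ∀ y, V y} (D : DCfib EX F V x)
    (hs : ∀ i, SecAt EX F V (s i) x) :
    SecAt EX F V (fun y => ∑ i ∈ S, s i y) x ∧
      opAct D (fun y => ∑ i ∈ S, s i y) = ∑ i ∈ S, opAct D (s i) := by
  classical
  induction S using Finset.induction_on with
  | empty =>
    simp only [Finset.sum_empty]
    exact ⟨secAt_zero x, (opAct_sec D (0 : Sec EX F V)).trans (map_zero D.1.1)⟩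
  | insert i S hi ih =>
    simp only [Finset.sum_insert hi]
    exact ⟨(hs i).add ih.1, by rw [opAct_add D (hs i) ih.1, ih.2]⟩

open Classical in
/-- The connection matrix of an element of `D_ℂ E` in the preferred trivialization at `x`. -/
def endCoord (x y : M) : DCfib EX F V y →ₗ[ℂ] (F →L[ℂ] F) where
  toFun D := LinearMap.toContinuousLinearMap
    -- Outside the base set the frame sections need not be smooth; the value 0 keeps the map linear
    -- there.
    { toFun := fun v => if y ∈ vBase F V x then
        vCoord F V x y (opAct D (fun z => vExt F V x z v)) else 0
      map_add' := fun v w => by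
        split_ifs with hy
        · simp only [map_add (vExt F V x _)]
          rw [opAct_add D (secAt_vExt hy (funAt_const v y)) (secAt_vExt hy (funAt_const w y)),
            map_add]
        · rw [add_zero]
      map_smul' := fun c v => by
        split_ifs with hy
        · simp only [map_smul (vExt F V x _)]
          rw [opAct_const_smul D c (secAt_vExt hy (funAt_const v y)), map_smul, RingHom.id_apply]
        · rw [smul_zero] }
  map_add' D D' := by
    ext v
    change (if y ∈ vBase F V x then vCoord F V x y (opAct (D + D') fun z => vExt F V x z v) else 0)
      = (if y ∈ vBase F V x then vCoord F V x y (opAct D fun z => vExt F V x z v) else 0)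
        + (if y ∈ vBase F V x then vCoord F V x y (opAct D' fun z => vExt F V x z v) else 0)
    split_ifs
    · rw [add_opAct, map_add]
    · rw [add_zero]
  map_smul' c D := by
    ext v
    change (if y ∈ vBase F V x then vCoord F V x y (opAct (c • D) fun z => vExt F V x z v) else 0)
      = c • (if y ∈ vBase F V x then vCoord F V x y (opAct D fun z => vExt F V x z v) else 0)
    split_ifs
    · rw [smul_opAct, map_smul]
    · rw [smul_zero]

theorem endCoord_apply (hy : y ∈ vBase F V x) (D : DCfib EX F V y) (v : F) :
    endCoord x y D v = vCoord F V x y (opAct D (fun z => vExt F V x z v)) := if_pos hy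

/-- The local formula D s = ds(σ(D)) + A s: expand `s` in the frame of constant sections and apply
the Leibniz rule to each term. -/
theorem vCoord_opAct (hy : y ∈ vBase F V x) (D : DCfib EX F V y) {s : ∀ z, V z}
    (hs : SecAt EX F V s y) :
    vCoord F V x y (opAct D s) = vAct (fun z => vCoord F V x z (s z)) y (symb D)
      + endCoord x y D (vCoord F V x y (s y)) := by
  let b := Module.finBasis ℂ F
  let ℓ : Fin (Module.finrank ℂ F) → F →L[ℂ] ℂ := fun i =>
    LinearMap.toContinuousLinearMap (b.coord i)
  have hb : ∀ v : F, ∑ i, ℓ i v • b i = v := b.sum_repr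
  have hg := (secAt_iff_vCoord (x := x) hy).1 hs
  set g := fun z => vCoord F V x z (s z) with hgdef
  have hf : ∀ i, FunAt EX (fun z => ℓ i (g z)) y := fun i => hg.clm ((ℓ i).restrictScalars ℝ)
  have hc : ∀ i, SecAt EX F V (fun z => vExt F V x z (b i)) y :=
    fun i => secAt_vExt hy (funAt_const (b i) y)
  have heq : ∀ᶠ z in 𝓝 y, s z = ∑ i, ℓ i (g z) • vExt F V x z (b i) := by
    filter_upwards [vBase_mem_nhds hy] with z hz
    conv_lhs => rw [← vExt_vCoord hz (s z), ← hb (vCoord F V x z (s z))]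
    rw [map_sum]
    exact Finset.sum_congr rfl fun i _ => map_smul _ _ _
  obtain ⟨h1, h2⟩ := opAct_sum Finset.univ D fun i => (hc i).csmul (hf i)
  rw [opAct_congr D h1 heq, h2, map_sum]
  have hterm : ∀ i, vCoord F V x y (opAct D (fun z => ℓ i (g z) • vExt F V x z (b i)))
      = ℓ i (vAct g y (symb D)) • b i + ℓ i (g y) • endCoord x y D (b i) := by
    intro i
    rw [opAct_smul D (hf i) (hc i), map_add, map_smul, map_smul, vCoord_vExt hy,
      endCoord_apply hy, apply_vAct hg]
  simp only [hterm]
  rw [Finset.sum_add_distrib, hb]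
  congr 1
  conv_rhs => rw [← hb (vCoord F V x y (s y))]
  rw [map_sum]
  exact Finset.sum_congr rfl fun i _ => (map_smul _ _ _).symm

/-- The element of `D_ℂ E` with given connection matrix and symbol. -/
def dcLift (hy : y ∈ vBase F V x) (A : F →L[ℂ] F) (ξ : CT EX y) : DCfib EX F V y :=
  ⟨({ toFun := fun e => vExt F V x y
        (vAct (fun z => vCoord F V x z (e.1 z)) y ξ + A (vCoord F V x y (e.1 y)))
      map_add' := fun e e' => by
        have h : (fun z => vCoord F V x z ((e + e').1 z))
            = fun z => vCoord F V x z (e.1 z) + vCoord F V x z (e'.1 z) :=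
          funext fun z => map_add _ _ _
        have h' : vCoord F V x y ((e + e').1 y) = vCoord F V x y (e.1 y) + vCoord F V x y (e'.1 y) :=
          map_add _ _ _
        rw [h, h', vAct_add ((secAt_iff_vCoord hy).1 (Sec.secAt e y))
          ((secAt_iff_vCoord hy).1 (Sec.secAt e' y)), map_add A, ← map_add (vExt F V x y)]
        congr 1
        abel
      map_smul' := fun c e => by
        have h : (fun z => vCoord F V x z ((c • e).1 z))
            = fun z => c • vCoord F V x z (e.1 z) := funext fun z => map_smul _ _ _
        have h' : vCoord F V x y ((c • e).1 y) = c • vCoord F V x y (e.1 y) := map_smul _ _ _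
        rw [h, h', vAct_smul (funAt_const c y) ((secAt_iff_vCoord hy).1 (Sec.secAt e y)), cAct_const,
          zero_smul, zero_add, map_smul A, ← smul_add, map_smul, RingHom.id_apply] }, ξ), by
    intro f hf e
    have h : (fun z => vCoord F V x z ((Sec.mul EX F V f hf e).1 z))
        = fun z => f z • vCoord F V x z (e.1 z) := funext fun z => map_smul _ _ _
    have h' : vCoord F V x y ((Sec.mul EX F V f hf e).1 y) = f y • vCoord F V x y (e.1 y) :=
      map_smul _ _ _
    change vExt F V x y (vAct (fun z => vCoord F V x z ((Sec.mul EX F V f hf e).1 z)) y ξ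
        + A (vCoord F V x y ((Sec.mul EX F V f hf e).1 y)))
      = cAct EX ξ f • e.1 y + f y • vExt F V x y
        (vAct (fun z => vCoord F V x z (e.1 z)) y ξ + A (vCoord F V x y (e.1 y)))
    rw [h, h', vAct_smul (funAt_of_contMDiff hf y) ((secAt_iff_vCoord hy).1 (Sec.secAt e y)),
      map_smul A, add_assoc, ← smul_add, map_add, map_smul, map_smul, vExt_vCoord hy]⟩

theorem opAct_dcLift (hy : y ∈ vBase F V x) (A : F →L[ℂ] F) (ξ : CT EX y) {s : ∀ z, V z}
    (hs : SecAt EX F V s y) : opAct (dcLift hy A ξ) s = vExt F V x y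
      (vAct (fun z => vCoord F V x z (s z)) y ξ + A (vCoord F V x y (s y))) := by
  have h := secGerm_eq hs
  have h' : (fun z => vCoord F V x z ((secGerm y s : Sec EX F V).1 z)) =ᶠ[𝓝 y]
      fun z => vCoord F V x z (s z) := h.mono fun z hz => by simp only [hz]
  rw [← vAct_congr h', ← h.self_of_nhds]
  rfl

theorem dcLift_endCoord (hy : y ∈ vBase F V x) (D : DCfib EX F V y) :
    dcLift hy (endCoord x y D) (symb D) = D := by
  refine opAct_ext (fun s hs => ?_) rfl
  rw [opAct_dcLift hy _ _ hs, ← vCoord_opAct hy D hs, vExt_vCoord hy]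

theorem endCoord_dcLift (hy : y ∈ vBase F V x) (A : F →L[ℂ] F) (ξ : CT EX y) :
    endCoord x y (dcLift hy A ξ) = A := by
  ext v
  have hv := funAt_const (EX := EX) v y
  rw [endCoord_apply hy, opAct_dcLift hy _ _ (secAt_vExt hy hv), vCoord_vExt hy, vCoord_vExt hy]
  have h : (fun z => vCoord F V x z (vExt F V x z v)) =ᶠ[𝓝 y] fun _ => v := by
    filter_upwards [vBase_mem_nhds hy] with z hz using vCoord_vExt hz v
  have h0 : vAct (fun _ : M => v) y ξ = 0 := by
    refine vec_ext fun ℓ => ?_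
    rw [apply_vAct hv, cAct_const, map_zero]
  rw [vAct_congr h, h0, zero_add]

end TrivializationOfD10

end HolGauge

end

noncomputable section
namespace HolGauge
open VectorField

/-! ### Change of model fibre and transport of trivializations. -/

namespace LocalTrivializations

universe u v w w'

variable {EX : Type u} [NormedAddCommGroup EX] [NormedSpace ℂ EX]
  {M : Type v} [TopologicalSpace M] [ChartedSpace EX M] {A : CBundle.{v, w} M}
  {G : Type*} [NormedAddCommGroup G] [NormedSpace ℂ G] [FiniteDimensional ℂ G]
  {S : (∀ y, A.Fib y) → M → Prop}

/-- Change of the model fibre of local trivializations. -/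
def changeFiber (T : LocalTrivializations EX A G S) {G' : Type*} [NormedAddCommGroup G']
    [NormedSpace ℂ G'] (L : G ≃ₗ[ℂ] G') : LocalTrivializations EX A G' S where
  base := T.base
  isOpen_base := T.isOpen_base
  mem_base := T.mem_base
  coord x y := L.toLinearMap ∘ₗ T.coord x y
  lift x y := T.lift x y ∘ₗ L.symm.toLinearMap
  coord_lift x y hy g := by simp [T.coord_lift x y hy]
  lift_coord x y hy a := by simp [T.lift_coord x y hy]
  smooth_iff x y hy s := by
    rw [T.smooth_iff x y hy]
    have : FiniteDimensional ℂ G' := Module.Finite.equiv L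
    refine ⟨fun h => h.clm ((LinearMap.toContinuousLinearMap L.toLinearMap).restrictScalars ℝ),
      fun h => ?_⟩
    refine (h.clm
      ((LinearMap.toContinuousLinearMap L.symm.toLinearMap).restrictScalars ℝ)).congr ?_
    exact Eventually.of_forall fun z => (L.symm_apply_apply _).symm

/-- Transport of local trivializations along fibrewise linear isomorphisms. -/
def transport (T : LocalTrivializations EX A G S) {B : CBundle.{v, w'} M}
    (φ : ∀ x, B.Fib x ≃ₗ[ℂ] A.Fib x) :
    LocalTrivializations EX B G (fun s x => S (fun y => φ y (s y)) x) where
  base := T.base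
  isOpen_base := T.isOpen_base
  mem_base := T.mem_base
  coord x y := T.coord x y ∘ₗ (φ y).toLinearMap
  lift x y := (φ y).symm.toLinearMap ∘ₗ T.lift x y
  coord_lift x y hy g := by simp [T.coord_lift x y hy]
  lift_coord x y hy a := by simp [T.lift_coord x y hy]
  smooth_iff x y hy s := T.smooth_iff x y hy _

/-- A basis replaces the model fibre by a coordinate space ℂⁿ, which lies in `Type`. -/
theorem isVectorBundle [IsManifold 𝓘(ℂ, EX) ω M] (T : LocalTrivializations EX A G S)
    (hS : ∀ U : Set M, IsOpen U → ∀ s, A.IsSmooth U s ↔ ∀ x ∈ U, S s x) :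
    A.IsVectorBundle EX :=
  (T.changeFiber (Module.finBasis ℂ G).equivFun).isVectorBundle_of_small hS

end LocalTrivializations

/-! ### D^{1,0}E is a smooth vector bundle. -/

section LocalTrivialityOfD10

variable {EX : Type*} [NormedAddCommGroup EX] [NormedSpace ℂ EX] [FiniteDimensional ℂ EX]
  {M : Type*} [TopologicalSpace M] [T2Space M] [ChartedSpace EX M] [IsManifold 𝓘(ℂ, EX) ω M]
  {F : Type*} [NormedAddCommGroup F] [NormedSpace ℂ F] [FiniteDimensional ℂ F]
  {V : M → Type*} [TopologicalSpace (TotalSpace F V)]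
  [∀ x, AddCommGroup (V x)] [∀ x, Module ℂ (V x)] [∀ x, TopologicalSpace (V x)]
  [FiberBundle F V] [VectorBundle ℂ F V] [ContMDiffVectorBundle ∞ F V 𝓘(ℝ, EX)] {x y : M}

theorem T10_ext {ξ η : CT EX y} (hy : y ∈ tBase (EX := EX) x) (hξ : ξ ∈ T10 EX y)
    (hη : η ∈ T10 EX y) (h : ctCoord x y ξ = ctCoord x y η) : ξ = η := by
  rw [ctCoord_of_mem hy hξ, ctCoord_of_mem hy hη] at h
  have h2 : cRe ξ = cRe η := by
    rw [← tExt_tCoord hy (cRe ξ), ← tExt_tCoord hy (cRe η), smul_right_injective EX two_ne_zero h]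
  exact complexified_ext h2 (by rw [mem_T10_iff.1 hξ, mem_T10_iff.1 hη, h2])

theorem lift10_ctCoord {ξ : CT EX y} (hy : y ∈ tBase (EX := EX) x) (hξ : ξ ∈ T10 EX y) :
    (lift10 x y (ctCoord x y ξ) : CT EX y) = ξ :=
  T10_ext hy (Subtype.property _) hξ (ctCoord_lift10 hy _)

/-- The coordinates are twice those of the real part, and the imaginary part is recovered by
applying -j, which preserves smoothness. -/
theorem cvfAt_iff_ctCoord {ξ : ∀ z : M, CT EX z} (hy : y ∈ tBase (EX := EX) x)
    (hξ : ∀ z, ξ z ∈ T10 EX z) : CVFAt ξ y ↔ FunAt EX (fun z => ctCoord x z (ξ z)) y := by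
  constructor
  · intro h
    simp only [ctCoord_eq]
    exact ((vfAt_iff_tCoord hy).1 h.1).add
      ((funAt_const Complex.I y).csmul ((vfAt_iff_tCoord hy).1 h.2))
  · intro h
    have h1 : VFAt (fun z => cRe (ξ z)) y := by
      rw [vfAt_iff_tCoord hy]
      refine (h.clm ((1 / 2 : ℝ) • ContinuousLinearMap.id ℝ EX)).congr ?_
      filter_upwards [tBase_mem_nhds hy] with z hz
      change _ = (1 / 2 : ℝ) • ctCoord x z (ξ z)
      rw [ctCoord_of_mem hz (hξ z)]
      module
    refine ⟨h1, (SecAt.const_smul (-1) h1.jT).congr (Eventually.of_forall fun z => ?_)⟩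
    rw [mem_T10_iff.1 (hξ z), neg_one_smul]

open Classical in
/-- The element of `D_ℂ E` with given connection matrix and symbol. -/
def dcLiftL (x y : M) : ((F →L[ℂ] F) × CT EX y) →ₗ[ℂ] DCfib EX F V y :=
  if hy : y ∈ vBase F V x then
    { toFun := fun p => dcLift hy p.1 p.2
      map_add' := fun p q => by
        refine opAct_ext (fun s hs => ?_) rfl
        rw [add_opAct, opAct_dcLift hy _ _ hs, opAct_dcLift hy _ _ hs, opAct_dcLift hy _ _ hs,
          ← map_add, Prod.snd_add, Prod.fst_add,
          map_add (vAct (fun z => vCoord F V x z (s z)) y), add_apply]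
        congr 1
        abel
      map_smul' := fun c p => by
        refine opAct_ext (fun s hs => ?_) rfl
        rw [RingHom.id_apply, smul_opAct, opAct_dcLift hy _ _ hs, opAct_dcLift hy _ _ hs,
          ← map_smul, Prod.smul_snd, Prod.smul_fst, map_smul (vAct _ y), smul_apply,
          smul_add] }
  else 0

theorem dcLiftL_apply (hy : y ∈ vBase F V x) (A : F →L[ℂ] F) (ξ : CT EX y) :
    dcLiftL x y (A, ξ) = dcLift hy A ξ := by
  rw [dcLiftL, dif_pos hy]; rfl

/-- The element of `D^{1,0} E` with given connection matrix and components of the symbol. -/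
def d10Lift (x y : M) : ((F →L[ℂ] F) × EX) →ₗ[ℂ] (D10 EX F V).Fib y :=
  LinearMap.codRestrict (D10fib EX F V y)
    ((DCfib EX F V y).subtype ∘ₗ dcLiftL x y ∘ₗ
      LinearMap.prodMap LinearMap.id ((T10 EX y).subtype ∘ₗ lift10 x y)) fun p => by
    refine ⟨Subtype.property _, ?_⟩
    change symb (dcLiftL x y (p.1, (lift10 x y p.2 : CT EX y))) ∈ T10 EX y
    rw [dcLiftL]
    split_ifs with hy
    · exact Subtype.property _
    · exact Submodule.zero_mem _

theorem incl10_d10Lift (hy : y ∈ vBase F V x) (A : F →L[ℂ] F) (u : EX) :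
    incl10 y (d10Lift x y (A, u) : (D10 EX F V).Fib y) = dcLift hy A (lift10 x y u : CT EX y) :=
  (rfl : _ = dcLiftL x y (A, (lift10 x y u : CT EX y))).trans (dcLiftL_apply hy _ _)

/-- The columns of the matrix are the coordinates of the action on constant sections, which gives
one direction; the local formula `vCoord_opAct` gives the other. -/
theorem dcAt_iff_coord {P : ∀ z, DCfib EX F V z} (hy : y ∈ vBase F V x)
    (hs : CVFAt (fun z => symb (P z)) y) :
    DCAt P y ↔ FunAt EX (fun z => endCoord x z (P z)) y := by
  constructor
  · intro h
    filter_upwards [h.eventually, vBase_mem_nhds hy] with z h1 hz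
    refine contMDiffAt_clm_of_apply (G := F) (f := fun z => endCoord x z (P z)) fun v => ?_
    have h2 := ((secAt_iff_vCoord (x := x) hz).1
      (h1.act (secAt_vExt hz (funAt_const v z)))).contMDiffAt
    refine h2.congr_of_eventuallyEq ?_
    filter_upwards [vBase_mem_nhds hz] with z' hz' using endCoord_apply hz' _ v
  · intro h
    refine dcAt_of_act ?_ hs
    filter_upwards [h.eventually, hs.eventually, vBase_mem_nhds hy] with z h1 h2 hz s hs
    rw [secAt_iff_vCoord (x := x) hz]
    have h3 := (secAt_iff_vCoord (x := x) hz).1 hs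
    have h4 : FunAt EX (fun z => endCoord x z (P z) (vCoord F V x z (s z))) z := by
      filter_upwards [h1, h3] with z h1 h3
      have hc : ContDiff ℝ ∞ (fun p : (F →L[ℂ] F) × F => p.1 p.2) :=
        (isBoundedBilinearMap_apply (𝕜 := ℂ) (E := F) (F := F)).contDiff.restrict_scalars ℝ
      exact hc.contMDiff.contMDiffAt.comp z (h1.prodMk_space h3)
    refine ((h3.vAct h2).add h4).congr ?_
    filter_upwards [vBase_mem_nhds hz, hs.eventually] with z' hz' hs'
    exact vCoord_opAct hz' _ hs'

variable (EX F V) in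
/-- The local trivializations of `D^{1,0} E` defined by those of `E` and of the tangent bundle. -/
def localTrivializations10 : LocalTrivializations EX (D10 EX F V) ((F →L[ℂ] F) × EX)
    (fun s x => DCAt (fun y => incl10 y (s y)) x) where
  base x := vBase F V x ∩ tBase (EX := EX) x
  isOpen_base x := (trivializationAt F V x).open_baseSet.inter
    (trivializationAt EX (fun y : M => TangentSpace 𝓘(ℝ, EX) y) x).open_baseSet
  mem_base x := ⟨mem_baseSet_trivializationAt F V x, mem_tBase x⟩
  coord x y := LinearMap.prod (endCoord x y ∘ₗ incl10 y)
    (ctCoord x y ∘ₗ LinearMap.snd ℂ _ _ ∘ₗ (DCfib EX F V y).subtype ∘ₗ incl10 y)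
  lift x y := d10Lift x y
  coord_lift x y hy g := by
    change (endCoord x y (incl10 y (d10Lift x y (g.1, g.2))),
      ctCoord x y (symb (incl10 y (d10Lift x y (g.1, g.2))))) = g
    rw [incl10_d10Lift hy.1, endCoord_dcLift hy.1]
    exact Prod.ext rfl (ctCoord_lift10 hy.2 g.2)
  lift_coord x y hy Δ := by
    apply incl10_injective y
    refine (incl10_d10Lift hy.1 _ _).trans ?_
    change dcLift hy.1 (endCoord x y (incl10 y Δ))
      (lift10 x y (ctCoord x y (symb (incl10 y Δ))) : CT EX y) = _
    rw [lift10_ctCoord hy.2 (symb_incl10_mem Δ), dcLift_endCoord]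
  smooth_iff x y hy Δ := by
    constructor
    · intro h
      have h1 := (dcAt_iff_coord hy.1 h.2).1 h
      have h2 := (cvfAt_iff_ctCoord hy.2 fun z => symb_incl10_mem (Δ z)).1 h.2
      filter_upwards [h1, h2] with z h1 h2 using h1.prodMk_space h2
    · intro h
      have h2 : FunAt EX (fun z => ctCoord x z (symb (incl10 z (Δ z)))) y :=
        h.clm (ContinuousLinearMap.snd ℝ (F →L[ℂ] F) EX)
      have h1 : FunAt EX (fun z => endCoord x z (incl10 z (Δ z))) y :=
        h.clm (ContinuousLinearMap.fst ℝ (F →L[ℂ] F) EX)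
      exact (dcAt_iff_coord hy.1
        ((cvfAt_iff_ctCoord hy.2 fun z => symb_incl10_mem (Δ z)).2 h2)).2 h1

variable (EX F V) in
theorem isVectorBundle_D10 : (D10 EX F V).IsVectorBundle EX :=
  (localTrivializations10 EX F V).isVectorBundle fun _ hU _ => d10_isSmooth_iff hU

/-- DE and (DE)^{1,0} need no trivializations of their own: both are fibrewise isomorphic to
D^{1,0}E compatibly with smooth sections. -/
theorem isVectorBundle_of_iso_D10 {B : CBundle M} (φ : ∀ x, B.Fib x ≃ₗ[ℂ] (D10 EX F V).Fib x)
    (hφ : IsBundleIso φ) : B.IsVectorBundle EX :=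
  ((localTrivializations10 EX F V).transport φ).isVectorBundle fun U hU s => by
    rw [hφ U hU s, d10_isSmooth_iff hU]

end LocalTrivialityOfD10

end HolGauge

end

noncomputable section
namespace HolGauge

/-! ### Complex differentiable functions of several variables are smooth. -/

section ComplexDifferentiable

variable {E : Type*} [NormedAddCommGroup E] [NormedSpace ℂ E] [FiniteDimensional ℂ E]
  {f : E → ℂ} {U : Set E}

/-- Cauchy's formula on the complex line through x in direction v expresses the derivative of f
along v as a circle integral of f(x + zv)/z². The Cauchy estimate bounds the derivative of the
integrand in x, so one may differentiate under the integral sign. -/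
theorem differentiableAt_fderiv_apply (hU : IsOpen U) (hf : DifferentiableOn ℂ f U) (v : E) {x₀ : E}
    (hx₀ : x₀ ∈ U) : DifferentiableAt ℂ (fun x => fderiv ℂ f x v) x₀ := by
  have : ProperSpace E := FiniteDimensional.proper ℂ E
  have : ProperSpace (E →L[ℂ] ℂ) := FiniteDimensional.proper ℂ _
  obtain ⟨R', hR', hball⟩ := Metric.isOpen_iff.1 hU x₀ hx₀
  -- Three nested balls: x varies in radius R, the points x + zv stay within 2R, and the discs used
  -- in the Cauchy estimate stay within 3R.
  obtain ⟨R, hR, hRR⟩ : ∃ R > 0, 3 * R < R' := ⟨R' / 4, by positivity, by linarith⟩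
  have hsub : Metric.closedBall x₀ (3 * R) ⊆ U :=
    (Metric.closedBall_subset_ball hRR).trans hball
  obtain ⟨C, hC⟩ := (isCompact_closedBall x₀ (3 * R)).exists_bound_of_continuousOn
    (hf.continuousOn.mono hsub)
  have hC0 : 0 ≤ C := (norm_nonneg _).trans (hC x₀ (Metric.mem_closedBall_self (by positivity)))
  -- On the ball of radius R around y the values of f differ from f(y) by at most 2C.
  have hbound : ∀ y ∈ Metric.closedBall x₀ (2 * R), ‖fderiv ℂ f y‖ ≤ (2 * C + 1) / R := by
    intro y hy
    have hyb : Metric.ball y R ⊆ Metric.closedBall x₀ (3 * R) := fun z hz => by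
      rw [Metric.mem_closedBall] at hy ⊢
      rw [Metric.mem_ball] at hz
      linarith [dist_triangle z y x₀]
    refine Complex.norm_fderiv_le_div_of_mapsTo_ball (hf.mono (hyb.trans hsub)) (fun z hz => ?_) hR
    rw [Metric.mem_closedBall, dist_eq_norm]
    have h1 := hC z (hyb hz)
    have h2 := hC y (hyb (Metric.mem_ball_self hR))
    linarith [norm_sub_le (f z) (f y)]
  -- Chosen so that ‖zv‖ ≤ R on the disc of radius r; the summand 1 covers v = 0.
  set r : ℝ := R / (‖v‖ + 1) with hr
  have hr0 : 0 < r := by positivity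
  have hrv : ∀ z : ℂ, ‖z‖ ≤ r → ‖z • v‖ ≤ R := fun z hz => by
    rw [norm_smul]
    calc ‖z‖ * ‖v‖ ≤ r * (‖v‖ + 1) := by gcongr; linarith
      _ = R := by rw [hr]; field_simp
  have hmem : ∀ x ∈ Metric.closedBall x₀ R, ∀ z : ℂ, ‖z‖ ≤ r →
      x + z • v ∈ Metric.closedBall x₀ (2 * R) := fun x hx z hz => by
    rw [Metric.mem_closedBall, dist_eq_norm] at hx ⊢
    have h1 := norm_add_le (x - x₀) (z • v)
    have h2 := hrv z hz
    rw [show x + z • v - x₀ = x - x₀ + z • v by abel]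
    linarith
  have h23 : Metric.closedBall x₀ (2 * R) ⊆ U :=
    (Metric.closedBall_subset_closedBall (by linarith)).trans hsub
  have hdf : ∀ y ∈ Metric.closedBall x₀ (2 * R), DifferentiableAt ℂ f y := fun y hy =>
    hf.differentiableAt (hU.mem_nhds (h23 hy))
  have hcm : ∀ θ, ‖circleMap 0 r θ‖ ≤ r := fun θ => by
    rw [norm_circleMap_zero, abs_of_pos hr0]
  let w : ℝ → ℂ := fun θ => deriv (circleMap 0 r) θ * (1 / circleMap 0 r θ ^ 2)
  have hw : Continuous w := by
    have h1 : Continuous fun θ => 1 / circleMap 0 r θ ^ 2 :=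
      continuous_const.div ((continuous_circleMap 0 r).pow 2)
        fun θ => pow_ne_zero 2 (circleMap_ne_center hr0.ne')
    have h2 : Continuous (deriv (circleMap 0 r)) := by
      have : deriv (circleMap 0 r) = fun θ => circleMap 0 r θ * Complex.I := by
        ext θ; exact deriv_circleMap 0 r θ
      rw [this]
      exact (continuous_circleMap 0 r).mul continuous_const
    exact h2.mul h1
  have hcauchy : ∀ x ∈ Metric.closedBall x₀ R, ∫ θ in (0)..(2 * Real.pi),
      w θ * f (x + circleMap 0 r θ • v) = 2 * Real.pi * Complex.I * fderiv ℂ f x v := by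
    intro x hx
    have hline : ∀ z : ℂ, HasDerivAt (fun z : ℂ => x + z • v) v z := fun z => by
      simpa using ((hasDerivAt_id z).smul_const v).const_add x
    have hg : ∀ z : ℂ, ‖z‖ ≤ r →
        HasDerivAt (fun z : ℂ => f (x + z • v)) (fderiv ℂ f (x + z • v) v) z := fun z hz =>
      (hdf _ (hmem x hx z hz)).hasFDerivAt.comp_hasDerivAt z (hline z)
    have h := DifferentiableOn.deriv_eq_smul_circleIntegral (c := 0) hr0
      (f := fun z : ℂ => f (x + z • v)) fun z hz =>
        (hg z (by simpa using hz)).differentiableAt.differentiableWithinAt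
    rw [(hg 0 (by simpa using hr0.le)).deriv, zero_smul, add_zero] at h
    rw [smul_eq_mul] at h
    rw [← h, circleIntegral]
    refine intervalIntegral.integral_congr fun θ _ => ?_
    simp only [w, smul_eq_mul, sub_zero, mul_assoc]
  have hcont : ∀ x ∈ Metric.closedBall x₀ R, Continuous fun θ => f (x + circleMap 0 r θ • v) := by
    intro x hx
    refine continuous_iff_continuousAt.2 fun θ => ?_
    exact ContinuousAt.comp (f := fun θ => x + circleMap 0 r θ • v)
      (hdf _ (hmem x hx _ (hcm θ))).continuousAt
      (continuous_const.add ((continuous_circleMap 0 r).smul continuous_const)).continuousAt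
  have hnhds : Metric.closedBall x₀ R ∈ 𝓝 x₀ := Metric.closedBall_mem_nhds x₀ hR
  have hint := intervalIntegral.hasFDerivAt_integral_of_dominated_of_fderiv_le
    (μ := MeasureTheory.volume) (a := 0) (b := 2 * Real.pi) (𝕜 := ℂ)
    (F := fun x θ => w θ * f (x + circleMap 0 r θ • v))
    (F' := fun x θ => w θ • fderiv ℂ f (x + circleMap 0 r θ • v))
    (bound := fun θ => ‖w θ‖ * ((2 * C + 1) / R)) hnhds
    (by
      filter_upwards [hnhds] with x hx
      exact (hw.mul (hcont x hx)).aestronglyMeasurable)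
    ((hw.mul (hcont x₀ (Metric.mem_closedBall_self hR.le))).intervalIntegrable _ _)
    (by
      borelize E
      borelize (E →L[ℂ] ℂ)
      -- Continuity of the derivative is not yet known at this point, but the derivative of any
      -- function is measurable.
      have hm : Measurable fun θ => fderiv ℂ f (x₀ + circleMap 0 r θ • v) :=
        (measurable_fderiv ℂ f).comp
          (continuous_const.add ((continuous_circleMap 0 r).smul continuous_const)).measurable
      exact (hw.measurable.smul hm).aestronglyMeasurable)
    (by
      refine Eventually.of_forall fun θ _ x hx => ?_
      rw [norm_smul]
      exact mul_le_mul_of_nonneg_left (hbound _ (hmem x hx _ (hcm θ))) (norm_nonneg _))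
    ((hw.norm.mul continuous_const).intervalIntegrable _ _)
    (by
      refine Eventually.of_forall fun θ _ x hx => ?_
      have h1 : HasFDerivAt (fun x => x + circleMap 0 r θ • v) (ContinuousLinearMap.id ℂ E) x :=
        (hasFDerivAt_id x).add_const _
      exact ((hdf _ (hmem x hx _ (hcm θ))).hasFDerivAt.comp x h1).const_mul (w θ))
  have hne : (2 * Real.pi * Complex.I : ℂ) ≠ 0 := Complex.two_pi_I_ne_zero
  refine (hint.differentiableAt.const_mul (2 * Real.pi * Complex.I : ℂ)⁻¹).congr_of_eventuallyEq ?_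
  filter_upwards [hnhds] with x hx
  rw [hcauchy x hx, inv_mul_cancel_left₀ hne]

/-- Induction on the order: each directional derivative is again complex differentiable on the same
open set. -/
theorem contDiffOn_of_complexDifferentiableOn (hU : IsOpen U) (n : ℕ) :
    ∀ {f : E → ℂ}, DifferentiableOn ℂ f U → ContDiffOn ℂ n f U := by
  induction n with
  | zero => intro f hf; exact contDiffOn_zero.2 hf.continuousOn
  | succ n ih =>
    intro f hf
    rw [Nat.cast_succ, contDiffOn_succ_iff_fderiv_of_isOpen hU]
    refine ⟨hf, fun h => absurd h (by simp), contDiffOn_clm_apply.2 fun v => ih fun x hx => ?_⟩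
    exact (differentiableAt_fderiv_apply hU hf v hx).differentiableWithinAt

end ComplexDifferentiable

/-! ### Holomorphic functions on the manifold are smooth. -/

section HolomorphicFunctions

variable {EX : Type*} [NormedAddCommGroup EX] [NormedSpace ℂ EX] [FiniteDimensional ℂ EX]
  {M : Type*} [TopologicalSpace M] [ChartedSpace EX M] [IsManifold 𝓘(ℂ, EX) ω M]

theorem funAt_of_mdifferentiableOn {f : M → ℂ} {U : Set M} (hU : IsOpen U)
    (hf : MDifferentiableOn 𝓘(ℂ, EX) 𝓘(ℂ, ℂ) f U) {x : M} (hx : x ∈ U) : FunAt EX f x := by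
  set e := extChartAt 𝓘(ℂ, EX) x with he
  have hopen : IsOpen (e.target ∩ e.symm ⁻¹' U) :=
    (continuousOn_extChartAt_symm x).isOpen_inter_preimage (isOpen_extChartAt_target x) hU
  have hd : DifferentiableOn ℂ (f ∘ e.symm) (e.target ∩ e.symm ⁻¹' U) := by
    rw [← mdifferentiableOn_iff_differentiableOn]
    exact hf.comp ((mdifferentiableOn_extChartAt_symm (I := 𝓘(ℂ, EX))).mono inter_subset_left)
      inter_subset_right
  have hs : ContDiffOn ℝ ∞ (f ∘ e.symm) (e.target ∩ e.symm ⁻¹' U) :=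
    contDiffOn_infty.2 fun n => (contDiffOn_of_complexDifferentiableOn hopen n hd).restrict_scalars ℝ
  have hchart : ∀ᶠ y in 𝓝 x, ContMDiffAt 𝓘(ℝ, EX) 𝓘(ℝ, EX) ∞ e y := contMDiffAt_chart x
  filter_upwards [hchart, hU.mem_nhds hx, extChartAt_source_mem_nhds (I := 𝓘(ℂ, EX)) x,
    (eventually_eventually_nhds.2 (extChartAt_source_mem_nhds (I := 𝓘(ℂ, EX)) x))] with y h1 h2 h3 h4
  have h5 : e y ∈ e.target ∩ e.symm ⁻¹' U := ⟨e.map_source h3, by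
    rw [mem_preimage, e.left_inv h3]; exact h2⟩
  have h6 := ((hs.contDiffAt (hopen.mem_nhds h5)).contMDiffAt).comp y h1
  refine h6.congr_of_eventuallyEq ?_
  filter_upwards [h4] with z hz
  exact congrArg f (e.left_inv hz).symm

end HolomorphicFunctions

end HolGauge

end

noncomputable section
namespace HolGauge
open VectorField

/-! ### Transport of structures along bundle isomorphisms, and A^{1,0} ≅ A. -/

section Transport

universe u v w w'

variable {EX : Type u} [NormedAddCommGroup EX] [NormedSpace ℂ EX]
  {M : Type v} [TopologicalSpace M] [ChartedSpace EX M] [IsManifold 𝓘(ℂ, EX) ω M]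
  {A : CBundle.{v, w} M} {B : CBundle.{v, w'} M}

theorem IsBundleIso.symm {φ : ∀ x, A.Fib x ≃ₗ[ℂ] B.Fib x} (hφ : IsBundleIso φ) :
    IsBundleIso fun x => (φ x).symm := fun U hU s => by
  rw [hφ U hU]
  simp only [LinearEquiv.apply_symm_apply]

/-- Transport of a flat `T^{0,1}`-connection along an isomorphism of vector bundles. -/
def DbarConnection.transport (D : DbarConnection EX A) (φ : ∀ x, A.Fib x ≃ₗ[ℂ] B.Fib x)
    (hφ : IsBundleIso φ) : DbarConnection EX B where
  toFun s x := (φ x).toLinearMap ∘ₗ D.toFun (fun y => (φ y).symm (s y)) x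
  map_add U hU s t hs ht x hx := by
    simp only [_root_.map_add]
    rw [D.map_add U hU _ _ ((hφ.symm U hU s).1 hs) ((hφ.symm U hU t).1 ht) x hx,
      LinearMap.comp_add]
  leibniz U hU f s hf hs x hx ξ := by
    simp only [map_smul, LinearMap.comp_apply]
    rw [D.leibniz U hU f _ hf ((hφ.symm U hU s).1 hs) x hx]
    simp
  smooth U hU ζ s hζ hs := (hφ U hU _).1 (D.smooth U hU ζ _ hζ ((hφ.symm U hU s).1 hs))
  flat U hU ζ η s hζ hη hs x hx := by
    have h := D.flat U hU ζ η _ hζ hη ((hφ.symm U hU s).1 hs) x hx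
    simp only [LinearMap.comp_apply, LinearEquiv.coe_coe, LinearEquiv.symm_apply_apply] at h ⊢
    rw [← map_sub, h]

theorem DbarConnection.isHol_transport (D : DbarConnection EX A)
    {φ : ∀ x, A.Fib x ≃ₗ[ℂ] B.Fib x} (hφ : IsBundleIso φ) {U : Set M} (hU : IsOpen U)
    {s : ∀ x, B.Fib x} : (D.transport φ hφ).IsHol U s ↔ D.IsHol U fun x => (φ x).symm (s x) := by
  refine and_congr (hφ.symm U hU s) (forall₂_congr fun x _ => ?_)
  constructor
  · intro h
    ext1 ξ
    exact (φ x).injective ((congrArg (fun L => L ξ) h).trans (map_zero (φ x)).symm)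
  · intro h
    change (φ x).toLinearMap ∘ₗ D.toFun (fun y => (φ y).symm (s y)) x = 0
    rw [h, LinearMap.comp_zero]

/-- Transport of a complex Lie algebroid structure along an isomorphism of vector bundles. -/
def ComplexLieAlgebroid.transport (C : ComplexLieAlgebroid EX B) (φ : ∀ x, A.Fib x ≃ₗ[ℂ] B.Fib x)
    (hφ : IsBundleIso φ) (hA : A.IsVectorBundle EX) : ComplexLieAlgebroid EX A where
  isVectorBundle := hA
  anchor x := C.anchor x ∘ₗ (φ x).toLinearMap
  bracket s t x := (φ x).symm (C.bracket (fun y => φ y (s y)) (fun y => φ y (t y)) x)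
  anchor_smooth U hU s hs := C.anchor_smooth U hU _ ((hφ U hU s).1 hs)
  bracket_smooth U hU s t hs ht := (hφ.symm U hU _).1
    (C.bracket_smooth U hU _ _ ((hφ U hU s).1 hs) ((hφ U hU t).1 ht))
  add_bracket U hU s s' t hs hs' ht x hx := by
    simp only [map_add]
    rw [C.add_bracket U hU _ _ _ ((hφ U hU s).1 hs) ((hφ U hU s').1 hs') ((hφ U hU t).1 ht) x hx,
      map_add]
  smul_bracket U hU c s t hs ht x hx := by
    simp only [map_smul]
    rw [C.smul_bracket U hU c _ _ ((hφ U hU s).1 hs) ((hφ U hU t).1 ht) x hx, map_smul]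
  skew U hU s t hs ht x hx := by
    rw [C.skew U hU _ _ ((hφ U hU s).1 hs) ((hφ U hU t).1 ht) x hx, map_neg]
  jacobi U hU s t r hs ht hr x hx := by
    simp only [LinearEquiv.apply_symm_apply]
    rw [C.jacobi U hU _ _ _ ((hφ U hU s).1 hs) ((hφ U hU t).1 ht) ((hφ U hU r).1 hr) x hx, map_add]
  leibniz U hU f s t hf hs ht x hx := by
    simp only [map_smul]
    rw [C.leibniz U hU f _ _ hf ((hφ U hU s).1 hs) ((hφ U hU t).1 ht) x hx, map_add, map_smul,
      map_smul, LinearEquiv.symm_apply_apply]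
    rfl

theorem ComplexLieAlgebroid.isIso_transport (C : ComplexLieAlgebroid EX B)
    {φ : ∀ x, A.Fib x ≃ₗ[ℂ] B.Fib x} (hφ : IsBundleIso φ) (hA : A.IsVectorBundle EX) :
    (C.transport φ hφ hA).IsIso C φ :=
  ⟨hφ, fun _ _ => rfl, fun _ _ _ _ _ _ x _ => (φ x).apply_symm_apply _⟩

/-- The complex linear isomorphism `A^{1,0} → A` given by the real part. -/
def oneZeroEquiv (A : CBundle.{v, w} M) (x : M) : A.oneZero.Fib x ≃ₗ[ℂ] A.Fib x :=
  have hI : ∀ v : A.Fib x, Complex.I • Complex.I • v = -v := fun v => by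
    rw [smul_smul, Complex.I_mul_I, neg_one_smul]
  { toFun := fun Θ => cRe (Θ.1 : ℂ ⊗[ℝ] A.Fib x)
    map_add' := fun Θ Θ' => map_add cRe _ _
    map_smul' := fun z Θ => by
      have h := (mem_cEigen_I_iff (j := (LinearMap.lsmul ℂ (A.Fib x) Complex.I).restrictScalars ℝ)
        hI).1 Θ.2
      refine (cRe_smul z Θ.1).trans ?_
      rw [h]
      change z.re • cRe (Θ.1 : ℂ ⊗[ℝ] A.Fib x) - z.im • -(Complex.I • cRe (Θ.1 : ℂ ⊗[ℝ] A.Fib x))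
        = z • cRe (Θ.1 : ℂ ⊗[ℝ] A.Fib x)
      conv_rhs => rw [← Complex.re_add_im z]
      simp only [← Complex.coe_smul]
      module
    -- The imaginary part of an i-eigenvector is forced to be -j of its real part.
    invFun := fun v => ⟨(1 : ℂ) ⊗ₜ[ℝ] v - Complex.I ⊗ₜ[ℝ] (Complex.I • v), by
      rw [mem_cEigen_I_iff hI]
      simp⟩
    left_inv := fun Θ => by
      have h := (mem_cEigen_I_iff (j := (LinearMap.lsmul ℂ (A.Fib x) Complex.I).restrictScalars ℝ)
        hI).1 Θ.2
      apply Subtype.ext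
      apply complexified_ext
      · simp
      · simp [h]
    right_inv := fun v => by simp }

theorem oneZeroEquiv_apply {x : M} (Θ : A.oneZero.Fib x) :
    oneZeroEquiv A x Θ = cRe (Θ.1 : ℂ ⊗[ℝ] A.Fib x) := rfl

theorem cIm_oneZero {x : M} (Θ : A.oneZero.Fib x) : cIm (Θ.1 : ℂ ⊗[ℝ] A.Fib x)
    = -(Complex.I • oneZeroEquiv A x Θ) :=
  (mem_cEigen_I_iff (j := (LinearMap.lsmul ℂ (A.Fib x) Complex.I).restrictScalars ℝ) (fun v => by
    change Complex.I • Complex.I • v = -v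
    rw [smul_smul, Complex.I_mul_I, neg_one_smul])).1 Θ.2

end Transport

/-! ### Holomorphic sections, compatibility of ι with brackets, and the holomorphic algebroid. -/

section HolomorphicSections

variable {EX : Type*} [NormedAddCommGroup EX] [NormedSpace ℂ EX] [FiniteDimensional ℂ EX]
  {M : Type*} [TopologicalSpace M] [T2Space M] [ChartedSpace EX M] [IsManifold 𝓘(ℂ, EX) ω M]
  {F : Type*} [NormedAddCommGroup F] [NormedSpace ℂ F]
  {V : M → Type*} [TopologicalSpace (TotalSpace F V)]
  [∀ x, AddCommGroup (V x)] [∀ x, Module ℂ (V x)] [∀ x, TopologicalSpace (V x)]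
  [FiberBundle F V] [VectorBundle ℂ F V] [ContMDiffVectorBundle ∞ F V 𝓘(ℝ, EX)]
  {dbar : DbarConnection EX (vecBundle EX F V)} {x : M} {Δ Δ' : ∀ y, (D10 EX F V).Fib y}

/-- If the projection of the commutator vanishes, the commutator equals the term the projection
subtracts, namely ∂̄ of the (0,1)-part of its symbol. -/
theorem comm_dbarOp_of_hol (h : DCAt (fun y => incl10 y (Δ y)) x) (h0 : nablaFun dbar Δ x = 0)
    {ζ : ∀ y : M, T01 EX y} (hζ : CVFAt (fun y => (ζ y : CT EX y)) x) :
    comm (fun y => dbarOp dbar y (ζ y)) (fun y => incl10 y (Δ y)) x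
      = dbarOp dbar x (p01 EX x
        (cLie EX (fun y => (ζ y : CT EX y)) (fun y => symb (incl10 y (Δ y))) x)) := by
  have h1 := congrArg (incl10 x) (nablaFun_eq dbar h hζ)
  rw [h0, LinearMap.zero_apply, map_zero, incl10_proj10L, comm_symb (dcAt_dbarOp dbar hζ) h] at h1
  exact sub_eq_zero.1 h1.symm

/-- Compare the symbols in `comm_dbarOp_of_hol`, with the conjugate of σ(Δ) as direction; only Δ'
has to be holomorphic. -/
theorem cLie_conj_mem_T01 (h : DCAt (fun y => incl10 y (Δ y)) x)
    (h' : DCAt (fun y => incl10 y (Δ' y)) x) (h0' : nablaFun dbar Δ' x = 0) :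
    cLie EX (fun y => cConj (symb (incl10 y (Δ y)))) (fun y => symb (incl10 y (Δ' y))) x
      ∈ T01 EX x := by
  have hζ : CVFAt (fun y => (D10.symbConj (Δ y) : CT EX y)) x := h.2.conj
  have h1 := congrArg symb (comm_dbarOp_of_hol h' h0' hζ)
  rw [comm_symb (dcAt_dbarOp dbar hζ) h', symb_dbarOp] at h1
  change cLie EX (fun y => (D10.symbConj (Δ y) : CT EX y)) _ x ∈ _
  refine (congrArg (· ∈ T01 EX x) h1).mpr ?_
  exact Subtype.property _

theorem eq_zero_of_mem_T10_of_mem_T01 {ξ : CT EX x} (h : ξ ∈ T10 EX x) (h' : ξ ∈ T01 EX x) :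
    ξ = 0 := by
  rw [← p10_of_mem h, p10_of_mem_T01 h', Submodule.coe_zero]

/-- Symbols of holomorphic sections commute with their conjugates. -/
theorem cLie_conj_eq_zero (h : DCAt (fun y => incl10 y (Δ y)) x)
    (h' : DCAt (fun y => incl10 y (Δ' y)) x) (h0 : nablaFun dbar Δ x = 0)
    (h0' : nablaFun dbar Δ' x = 0) :
    cLie EX (fun y => cConj (symb (incl10 y (Δ y)))) (fun y => symb (incl10 y (Δ' y))) x = 0 := by
  -- Type (0,1) comes from holomorphy of Δ'. Type (1,0) comes from holomorphy of Δ: exchange the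
  -- roles, conjugate, and swap the arguments of the bracket.
  refine eq_zero_of_mem_T10_of_mem_T01 ?_ (cLie_conj_mem_T01 h h' h0')
  have h1 := cConj_mem_T10 (cLie_conj_mem_T01 h' h h0)
  rw [← cLie_conj h'.2.conj h.2] at h1
  simp only [cConj_cConj] at h1
  rw [cLie_swap h.2.conj h'.2]
  exact (T10 EX x).neg_mem h1

/-- Vanishing of the mixed terms in the bracket of ιΔ and ιΔ': each is ∂̄ of a vector field that is
zero by `cLie_conj_eq_zero`. -/
theorem comm_symbConj_of_hol (h : DCAt (fun y => incl10 y (Δ y)) x)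
    (h' : DCAt (fun y => incl10 y (Δ' y)) x) (h0 : nablaFun dbar Δ x = 0)
    (h0' : nablaFun dbar Δ' x = 0) :
    comm (fun y => dbarOp dbar y (D10.symbConj (Δ y))) (fun y => incl10 y (Δ' y)) x = 0 := by
  have hζ : CVFAt (fun y => (D10.symbConj (Δ y) : CT EX y)) x := h.2.conj
  rw [comm_dbarOp_of_hol h' h0' hζ]
  have h1 := cLie_conj_eq_zero h h' h0 h0'
  change dbarOp dbar x (p01 EX x (cLie EX (fun y => cConj (symb (incl10 y (Δ y)))) _ x)) = 0
  rw [h1, map_zero, map_zero]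

/-- Flatness of ∂̄ and compatibility of the bracket with conjugation; holomorphy plays no role. -/
theorem comm_symbConj_symbConj (h : DCAt (fun y => incl10 y (Δ y)) x)
    (h' : DCAt (fun y => incl10 y (Δ' y)) x) :
    comm (fun y => dbarOp dbar y (D10.symbConj (Δ y)))
        (fun y => dbarOp dbar y (D10.symbConj (Δ' y))) x
      = dbarOp dbar x (D10.symbConj
          (proj10L dbar x (comm (fun y => incl10 y (Δ y)) (fun y => incl10 y (Δ' y)) x))) := by
  have hζ : CVFAt (fun y => (D10.symbConj (Δ y) : CT EX y)) x := h.2.conj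
  have hη : CVFAt (fun y => (D10.symbConj (Δ' y) : CT EX y)) x := h'.2.conj
  rw [comm_dbarOp dbar hζ hη]
  congr 1
  apply Subtype.ext
  change (p01 EX x (cLie EX (fun y => cConj (symb (incl10 y (Δ y))))
    (fun y => cConj (symb (incl10 y (Δ' y)))) x) : CT EX x)
    = cConj (symb (incl10 x (proj10L dbar x _)))
  rw [cLie_conj h.2 h'.2, symb_proj10L, cConj_p10, comm_symb h h']

/-- Of the four terms of the bracket of Δ + ∂̄_{conj σ(Δ)} and Δ' + ∂̄_{conj σ(Δ')}, the mixed ones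
vanish by holomorphy and the other two make up ι[Δ, Δ']. -/
theorem iota_bracket (h : DCAt (fun y => incl10 y (Δ y)) x)
    (h' : DCAt (fun y => incl10 y (Δ' y)) x) (h0 : nablaFun dbar Δ x = 0)
    (h0' : nablaFun dbar Δ' x = 0) :
    iota dbar x (proj10L dbar x (comm (fun y => incl10 y (Δ y)) (fun y => incl10 y (Δ' y)) x))
      = deBracket dbar (fun y => iota dbar y (Δ y)) (fun y => iota dbar y (Δ' y)) x := by
  have hc : DCAt (fun y => dbarOp dbar y (D10.symbConj (Δ y))) x := dcAt_dbarOp dbar h.2.conj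
  have hc' : DCAt (fun y => dbarOp dbar y (D10.symbConj (Δ' y))) x := dcAt_dbarOp dbar h'.2.conj
  apply deToDC_injective
  rw [deToDC_deBracket (by simpa only [deToDC_iota] using h.iotaDC)
    (by simpa only [deToDC_iota] using h'.iotaDC)]
  simp only [deToDC_iota]
  simp only [iotaDC]
  rw [incl10_proj10L_comm dbar h h', comm_add_left h hc (h'.add hc'), comm_add_right h h' hc',
    comm_add_right hc h' hc', comm_swap h hc', comm_symbConj_of_hol h' h h0' h0,
    comm_symbConj_of_hol h h' h0 h0', comm_symbConj_symbConj h h', neg_zero, add_zero, zero_add]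

theorem val_iota_fst (Δ : (D10 EX F V).Fib x) (e : Sec EX F V) : (DE.val (iota dbar x Δ)).1 e
    = (D10.val Δ).1 e + (dbarOp dbar x (D10.symbConj Δ)).1.1 e := rfl

theorem val_iota_snd (Δ : (D10 EX F V).Fib x) :
    (DE.val (iota dbar x Δ)).2 = (2 : ℝ) • cRe (D10.val Δ).2 := by
  change cRe (symb (iotaDC dbar Δ)) = _
  rw [symb_iotaDC, map_add, cRe_cConj, two_smul]
  rfl

theorem symb_iota_symm (D : (DE dbar).Fib x) : symb (incl10 x ((iota dbar x).symm D))
    = p10 EX x ((1 : ℂ) ⊗ₜ[ℝ] (DE.val D).2) := by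
  rw [iota_symm, symb_proj10L, symb_deToDC]

theorem proj10L_comm_dbarOp_of_hol (h : DCAt (fun y => incl10 y (Δ y)) x)
    (h0 : nablaFun dbar Δ x = 0) {ζ : ∀ y : M, T01 EX y}
    (hζ : CVFAt (fun y => (ζ y : CT EX y)) x) :
    proj10L dbar x (comm (fun y => dbarOp dbar y (ζ y)) (fun y => incl10 y (Δ y)) x) = 0 := by
  rw [← nablaFun_eq dbar h hζ, h0, LinearMap.zero_apply]

/-- By the Jacobi identity [∂̄_ζ, [Δ, Δ']] is a sum of brackets of a holomorphic section with [∂̄_ζ,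
Δ] or [∂̄_ζ, Δ']. The latter are values of ∂̄ near x, so each summand has projection zero by
holomorphy once more. -/
theorem nablaFun_bracket (h : DCAt (fun y => incl10 y (Δ y)) x)
    (h' : DCAt (fun y => incl10 y (Δ' y)) x) (h0 : ∀ᶠ y in 𝓝 x, nablaFun dbar Δ y = 0)
    (h0' : ∀ᶠ y in 𝓝 x, nablaFun dbar Δ' y = 0) :
    nablaFun dbar (fun y => proj10L dbar y
      (comm (fun y => incl10 y (Δ y)) (fun y => incl10 y (Δ' y)) y)) x = 0 := by
  ext1 ξ
  have hζ := cvfAt_ext01 x ξ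
  have hP := dcAt_dbarOp dbar hζ
  have hcongr : ∀ {Δ : ∀ y, (D10 EX F V).Fib y}, DCAt (fun y => incl10 y (Δ y)) x →
      (∀ᶠ y in 𝓝 x, nablaFun dbar Δ y = 0) → ∀ᶠ y in 𝓝 x,
      comm (fun y => dbarOp dbar y (ext01 x y ξ)) (fun y => incl10 y (Δ y)) y
        = dbarOp dbar y (p01 EX y (cLie EX (fun y => (ext01 x y ξ : CT EX y))
          (fun y => symb (incl10 y (Δ y))) y)) := by
    intro Δ h h0
    filter_upwards [h.eventually, h0, hζ.eventually] with y h1 h2 h3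
      using comm_dbarOp_of_hol h1 h2 h3
  have hb : ∀ᶠ y in 𝓝 x, incl10 y (proj10L dbar y
      (comm (fun y => incl10 y (Δ y)) (fun y => incl10 y (Δ' y)) y))
      = comm (fun y => incl10 y (Δ y)) (fun y => incl10 y (Δ' y)) y := by
    filter_upwards [h.eventually, h'.eventually] with y h1 h2 using incl10_proj10L_comm dbar h1 h2
  have hl : CVFAt (fun y => (p01 EX y (cLie EX (fun y => (ext01 x y ξ : CT EX y))
      (fun y => symb (incl10 y (Δ y))) y) : CT EX y)) x := (hζ.lie h.2).p01
  have hl' : CVFAt (fun y => (p01 EX y (cLie EX (fun y => (ext01 x y ξ : CT EX y))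
      (fun y => symb (incl10 y (Δ' y))) y) : CT EX y)) x := (hζ.lie h'.2).p01
  have er : ∀ {P : ∀ y, DCfib EX F V y}, ∀ᶠ y in 𝓝 x, P y = P y :=
    Eventually.of_forall fun _ => rfl
  rw [nablaFun_eq_ext dbar (dcAt_bracket10 dbar h h'), comm_congr hP (h.comm h') er hb,
    comm_jacobi hP h h', map_add, comm_congr (dcAt_dbarOp dbar hl) h' (hcongr h h0) er,
    comm_congr h (dcAt_dbarOp dbar hl') er (hcongr h' h0'),
    comm_swap h (dcAt_dbarOp dbar hl'), map_neg,
    proj10L_comm_dbarOp_of_hol h' h0'.self_of_nhds hl,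
    proj10L_comm_dbarOp_of_hol h h0.self_of_nhds hl', neg_zero, add_zero, LinearMap.zero_apply]

theorem isHol_nabla_iff {U : Set M} (hU : IsOpen U) : (nabla dbar).IsHol U Δ ↔
    ∀ x ∈ U, DCAt (fun y => incl10 y (Δ y)) x ∧ ∀ᶠ y in 𝓝 x, nablaFun dbar Δ y = 0 := by
  constructor
  · intro h x hx
    refine ⟨(d10_isSmooth_iff hU).1 h.1 x hx, ?_⟩
    filter_upwards [hU.mem_nhds hx] with y hy using h.2 y hy
  · intro h
    exact ⟨(d10_isSmooth_iff hU).2 fun x hx => (h x hx).1, fun x hx => (h x hx).2.self_of_nhds⟩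

variable (dbar) in
/-- The holomorphic Lie algebroid `DE`. -/
def holAlgebroid (hvb : (D10 EX F V).IsVectorBundle EX) (hvb' : (DE dbar).IsVectorBundle EX) :
    HolLieAlgebroid EX (DE dbar) where
  isVectorBundle := hvb'
  dbar := (nabla dbar).transport (iota dbar) isBundleIso_iota
  anchor := (realAlgebroid dbar hvb').anchor
  anchor_I x a := symb_deToDC_I a
  anchor_smooth := (realAlgebroid dbar hvb').anchor_smooth
  anchor_hol U hU ζ s hζ hs x hx := by
    have h1 := (d10_isSmooth_iff hU).1 ((isBundleIso_iota.symm U hU s).1 hs) x hx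
    have h2 := (smoothCVF_iff hU).1 hζ x hx
    change (DE.val (iota dbar x (nablaFun dbar (fun y => (iota dbar y).symm (s y)) x (ζ x)))).2
      = (2 : ℝ) • cRe (p10 EX x (cLie EX (fun y => (ζ y : CT EX y))
        (fun y => (p10 EX y ((1 : ℂ) ⊗ₜ[ℝ] (DE.val (s y)).2) : CT EX y)) x) : CT EX x)
    -- The symbol of [∂̄_ζ, ι⁻¹s]^{1,0} is [ζ, σ^{1,0}]^{1,0}, and ι takes twice its real part: this
    -- is the formula for `dbarT`.
    rw [val_iota_snd, val_eq_incl10, nablaFun_eq dbar h1 h2]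
    change (2 : ℝ) • cRe (symb (incl10 x (proj10L dbar x _))) = _
    rw [symb_proj10L, comm_symb (dcAt_dbarOp dbar h2) h1]
    simp only [symb_dbarOp, symb_iota_symm]
  bracket s t x := iota dbar x ((algebroid10 dbar hvb).bracket
    (fun y => (iota dbar y).symm (s y)) (fun y => (iota dbar y).symm (t y)) x)
  bracket_hol U hU s t hs ht := by
    rw [DbarConnection.isHol_transport _ _ hU, isHol_nabla_iff hU] at hs ht ⊢
    simp only [LinearEquiv.symm_apply_apply]
    intro x hx
    have h : ∀ y ∈ U, DCAt (fun y => incl10 y ((algebroid10 dbar hvb).bracket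
          (fun y => (iota dbar y).symm (s y)) (fun y => (iota dbar y).symm (t y)) y)) y ∧
        nablaFun dbar ((algebroid10 dbar hvb).bracket
          (fun y => (iota dbar y).symm (s y)) (fun y => (iota dbar y).symm (t y))) y = 0 :=
      fun y hy => ⟨dcAt_bracket10 dbar (hs y hy).1 (ht y hy).1,
        nablaFun_bracket (hs y hy).1 (ht y hy).1 (hs y hy).2 (ht y hy).2⟩
    refine ⟨(h x hx).1, ?_⟩
    filter_upwards [hU.mem_nhds hx] with y hy using (h y hy).2
  add_bracket U hU s s' t hs hs' ht x hx := by
    simp only [map_add]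
    rw [(algebroid10 dbar hvb).add_bracket U hU _ _ _ ((isBundleIso_iota.symm U hU s).1 hs.1)
      ((isBundleIso_iota.symm U hU s').1 hs'.1) ((isBundleIso_iota.symm U hU t).1 ht.1) x hx,
      map_add]
  smul_bracket U hU c s t hs ht x hx := by
    simp only [map_smul]
    rw [(algebroid10 dbar hvb).smul_bracket U hU c _ _ ((isBundleIso_iota.symm U hU s).1 hs.1)
      ((isBundleIso_iota.symm U hU t).1 ht.1) x hx, map_smul]
  skew U hU s t hs ht x hx := by
    rw [(algebroid10 dbar hvb).skew U hU _ _ ((isBundleIso_iota.symm U hU s).1 hs.1)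
      ((isBundleIso_iota.symm U hU t).1 ht.1) x hx, map_neg]
  jacobi U hU s t r hs ht hr x hx := by
    simp only [LinearEquiv.symm_apply_apply]
    rw [(algebroid10 dbar hvb).jacobi U hU _ _ _ ((isBundleIso_iota.symm U hU s).1 hs.1)
      ((isBundleIso_iota.symm U hU t).1 ht.1) ((isBundleIso_iota.symm U hU r).1 hr.1) x hx,
      map_add]
  leibniz U hU f s t hf hs ht x hx := by
    have hfs : SmoothFun EX U f := (contMDiffOn_iff_funAt hU).2 fun y hy =>
      funAt_of_mdifferentiableOn hU hf hy
    have hfx : MDifferentiableAt 𝓘(ℂ, EX) 𝓘(ℂ, ℂ) f x := hf.mdifferentiableAt (hU.mem_nhds hx)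
    simp only [map_smul]
    rw [(algebroid10 dbar hvb).leibniz U hU f _ _ hfs ((isBundleIso_iota.symm U hU s).1 hs.1)
      ((isBundleIso_iota.symm U hU t).1 ht.1) x hx, map_add, map_smul, map_smul,
      LinearEquiv.apply_symm_apply]
    congr 2
    change cAct EX (symb (incl10 x ((iota dbar x).symm (s x)))) f
      = cAct EX ((1 : ℂ) ⊗ₜ[ℝ] (DE.val (s x)).2) f
    rw [symb_iota_symm]
    -- The algebroid D^{1,0}E differentiates f along the (1,0)-part of the real anchor; the
    -- (0,1)-part annihilates the holomorphic f.
    conv_rhs => rw [← p10_add_p01 ((1 : ℂ) ⊗ₜ[ℝ] (DE.val (s x)).2)]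
    rw [cAct_map_add, cAct_eq_zero_of_mem_T01 (Subtype.property _) hfx, add_zero]

theorem isUnderlyingReal_holAlgebroid (hvb : (D10 EX F V).IsVectorBundle EX)
    (hvb' : (DE dbar).IsVectorBundle EX) :
    (holAlgebroid dbar hvb hvb').IsUnderlyingReal (realAlgebroid dbar hvb') := by
  refine ⟨fun x => rfl, fun U hU s t hs ht x hx => ?_⟩
  have hs' := (isHol_nabla_iff hU).1
    ((DbarConnection.isHol_transport _ isBundleIso_iota hU).1 hs) x hx
  have ht' := (isHol_nabla_iff hU).1
    ((DbarConnection.isHol_transport _ isBundleIso_iota hU).1 ht) x hx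
  have h := iota_bracket hs'.1 ht'.1 hs'.2.self_of_nhds ht'.2.self_of_nhds
  simp only [LinearEquiv.apply_symm_apply] at h
  exact h.symm

end HolomorphicSections

end HolGauge

end

noncomputable section
namespace HolGauge
open VectorField

/-! ### The complex Lie algebroid (DE)^{1,0} and its identification with D^{1,0}E. -/

section OneZeroPart

variable {EX : Type*} [NormedAddCommGroup EX] [NormedSpace ℂ EX] [FiniteDimensional ℂ EX]
  {M : Type*} [TopologicalSpace M] [T2Space M] [ChartedSpace EX M] [IsManifold 𝓘(ℂ, EX) ω M]
  {F : Type*} [NormedAddCommGroup F] [NormedSpace ℂ F]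
  {V : M → Type*} [TopologicalSpace (TotalSpace F V)]
  [∀ x, AddCommGroup (V x)] [∀ x, Module ℂ (V x)] [∀ x, TopologicalSpace (V x)]
  [FiberBundle F V] [VectorBundle ℂ F V] [ContMDiffVectorBundle ∞ F V 𝓘(ℝ, EX)]
  {dbar : DbarConnection EX (vecBundle EX F V)} {x : M}

theorem DCAt.neg {P : ∀ y, DCfib EX F V y} (hP : DCAt P x) : DCAt (fun y => -P y) x :=
  (hP.const_smul (-1)).congr (Eventually.of_forall fun y => by module)

theorem comm_neg_left {P Q : ∀ y, DCfib EX F V y} (hP : DCAt P x) (hQ : DCAt Q x) :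
    comm (fun y => -P y) Q x = -comm P Q x := by
  have h : (fun y => -P y) = fun y => (-1 : ℂ) • P y := by ext1 y; module
  rw [h, comm_const_smul_left _ hP hQ]
  module

theorem comm_neg_right {P Q : ∀ y, DCfib EX F V y} (hP : DCAt P x) (hQ : DCAt Q x) :
    comm P (fun y => -Q y) x = -comm P Q x := by
  rw [comm_swap hP hQ.neg, comm_neg_left hQ hP, comm_swap hP hQ]

theorem deToDC_neg (D : (DE dbar).Fib x) : deToDC dbar (-D) = -deToDC dbar D := by
  have h := deToDC_rsmul (-1) D
  rw [neg_one_smul] at h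
  rw [h, Complex.ofReal_neg, Complex.ofReal_one]
  module

theorem deToDC_sub (D D' : (DE dbar).Fib x) :
    deToDC dbar (D - D') = deToDC dbar D - deToDC dbar D' := by
  rw [sub_eq_add_neg, deToDC_add, deToDC_neg, ← sub_eq_add_neg]

/-- The (0,1)-part of the symbol of ιΔ is the conjugate of σ(Δ), so subtracting 2∂̄ of it reverses
the sign of the ∂̄-term of ιΔ before the multiplication by i. -/
theorem deToDC_I_smul_iota (Δ : (D10 EX F V).Fib x) : deToDC dbar (Complex.I • iota dbar x Δ)
    = Complex.I • (incl10 x Δ - dbarOp dbar x (D10.symbConj Δ)) := by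
  have h : p01 EX x (symb (iotaDC dbar Δ)) = D10.symbConj Δ := by
    rw [symb_iotaDC, map_add, p01_of_mem_T10 (symb_incl10_mem Δ), zero_add]
    exact p01_of_mem (D10.symbConj Δ).2
  rw [deToDC_smul, deToDC_iota, h, iotaDC, Complex.I_im, Complex.ofReal_one]
  module

theorem DCAt.deToDC_I_smul {D : ∀ y, (DE dbar).Fib y} (h : DCAt (fun y => deToDC dbar (D y)) x) :
    DCAt (fun y => deToDC dbar (Complex.I • D y)) x := by
  simp only [deToDC_smul]
  exact (h.const_smul _).sub ((dcAt_dbarOp dbar h.2.p01).const_smul _)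

/-- The restriction to `(DE)^{1,0}` of the natural map `DE ⊗ ℂ → D_ℂ E`, as an isomorphism onto
`D^{1,0} E`. -/
def oneZeroToD10 (dbar : DbarConnection EX (vecBundle EX F V)) (x : M) :
    (DE dbar).oneZero.Fib x ≃ₗ[ℂ] (D10 EX F V).Fib x :=
  oneZeroEquiv (DE dbar) x ≪≫ₗ (iota dbar x).symm ≪≫ₗ
    LinearEquiv.smulOfNeZero ℂ _ (2 : ℂ) two_ne_zero

theorem oneZeroToD10_apply (Θ : (DE dbar).oneZero.Fib x) :
    oneZeroToD10 dbar x Θ = (2 : ℂ) • (iota dbar x).symm (oneZeroEquiv (DE dbar) x Θ) := rfl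

/-- The natural map sends the eigenvector with real part ιΔ to (Δ + ∂̄) - i·i(Δ - ∂̄) = 2Δ, where ∂̄
is taken along the conjugate of σ(Δ). This accounts for the factor 2 in `oneZeroToD10`. -/
theorem incl10_oneZeroToD10 (Θ : (DE dbar).oneZero.Fib x) : incl10 x (oneZeroToD10 dbar x Θ)
    = deToDC dbar (cRe (Θ.1 : ℂ ⊗[ℝ] (DE dbar).Fib x))
      + Complex.I • deToDC dbar (cIm (Θ.1 : ℂ ⊗[ℝ] (DE dbar).Fib x)) := by
  rw [cIm_oneZero, ← oneZeroEquiv_apply, oneZeroToD10_apply]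
  obtain ⟨Δ, hΔ⟩ := (iota dbar x).surjective (oneZeroEquiv (DE dbar) x Θ)
  rw [← hΔ, LinearEquiv.symm_apply_apply, deToDC_neg, deToDC_I_smul_iota, deToDC_iota, iotaDC,
    map_smul, smul_neg, smul_smul, Complex.I_mul_I]
  module

theorem isBundleIso_oneZeroToD10 : IsBundleIso (oneZeroToD10 dbar) := by
  intro U hU s
  have h1 : (DE dbar).oneZero.IsSmooth U s ↔
      (DE dbar).IsSmooth U (fun x => oneZeroEquiv (DE dbar) x (s x)) := by
    refine ⟨fun h => h.1, fun h => ⟨h, ?_⟩⟩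
    simp only [cIm_oneZero]
    rw [de_isSmooth_iff hU] at h ⊢
    intro x hx
    simpa only [deToDC_neg] using (h x hx).deToDC_I_smul.neg
  rw [h1, isBundleIso_iota.symm U hU, d10_isSmooth_iff hU, d10_isSmooth_iff hU]
  simp only [oneZeroToD10_apply, map_smul (incl10 _)]
  refine forall₂_congr fun x _ => ⟨fun h => h.const_smul 2, fun h => ?_⟩
  have := h.const_smul (1 / 2)
  simpa only [smul_smul, one_div, inv_mul_cancel₀ (two_ne_zero (α := ℂ)), one_smul] using this

/-- With a = Δ and b = ∂̄_{conj σ(Δ)}, the left side is [a + b, a' + b'] + [a - b, a' - b'] = 2[a,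
a'] + 2[b, b']. The mixed terms cancel for arbitrary smooth sections. -/
theorem deBracket_iota_sub {Δ Δ' : ∀ y, (D10 EX F V).Fib y}
    (h : DCAt (fun y => incl10 y (Δ y)) x) (h' : DCAt (fun y => incl10 y (Δ' y)) x) :
    deBracket dbar (fun y => iota dbar y (Δ y)) (fun y => iota dbar y (Δ' y)) x
      - deBracket dbar (fun y => Complex.I • iota dbar y (Δ y))
        (fun y => Complex.I • iota dbar y (Δ' y)) x
      = iota dbar x ((2 : ℂ) • proj10L dbar x
        (comm (fun y => incl10 y (Δ y)) (fun y => incl10 y (Δ' y)) x)) := by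
  have hc : DCAt (fun y => dbarOp dbar y (D10.symbConj (Δ y))) x := dcAt_dbarOp dbar h.2.conj
  have hc' : DCAt (fun y => dbarOp dbar y (D10.symbConj (Δ' y))) x := dcAt_dbarOp dbar h'.2.conj
  have hi : DCAt (fun y => deToDC dbar (iota dbar y (Δ y))) x := by
    simpa only [deToDC_iota] using h.iotaDC
  have hi' : DCAt (fun y => deToDC dbar (iota dbar y (Δ' y))) x := by
    simpa only [deToDC_iota] using h'.iotaDC
  apply deToDC_injective
  rw [deToDC_sub, deToDC_deBracket hi hi', deToDC_deBracket hi.deToDC_I_smul hi'.deToDC_I_smul]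
  simp only [deToDC_iota, deToDC_I_smul_iota]
  simp only [iotaDC]
  rw [comm_const_smul_left _ (h.sub hc) ((h'.sub hc').const_smul _),
    comm_const_smul_right _ (h.sub hc) (h'.sub hc'),
    comm_add_left h hc (h'.add hc'), comm_add_right h h' hc', comm_add_right hc h' hc',
    comm_sub_left h hc (h'.sub hc'), comm_sub_right h h' hc', comm_sub_right hc h' hc',
    comm_symbConj_symbConj h h', smul_smul, Complex.I_mul_I, map_smul]
  have e : ∀ Δ : (D10 EX F V).Fib x, D10.symbConj ((2 : ℂ) • Δ) = (2 : ℂ) • D10.symbConj Δ :=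
    fun Δ => Subtype.ext (by
      change cConj ((2 : ℂ) • (D10.val Δ).2) = (2 : ℂ) • cConj (D10.val Δ).2
      rw [cConj_smul, map_ofNat])
  rw [e, map_smul, incl10_proj10L_comm dbar h h']
  module

/-- Likewise i[a + b, a' - b'] + i[a - b, a' + b'] = 2i([a, a'] - [b, b']), which is j_DE applied to
ι(2[Δ, Δ']). -/
theorem deBracket_iota_add {Δ Δ' : ∀ y, (D10 EX F V).Fib y}
    (h : DCAt (fun y => incl10 y (Δ y)) x) (h' : DCAt (fun y => incl10 y (Δ' y)) x) :
    deBracket dbar (fun y => iota dbar y (Δ y)) (fun y => Complex.I • iota dbar y (Δ' y)) x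
      + deBracket dbar (fun y => Complex.I • iota dbar y (Δ y)) (fun y => iota dbar y (Δ' y)) x
      = Complex.I • iota dbar x ((2 : ℂ) • proj10L dbar x
        (comm (fun y => incl10 y (Δ y)) (fun y => incl10 y (Δ' y)) x)) := by
  have hc : DCAt (fun y => dbarOp dbar y (D10.symbConj (Δ y))) x := dcAt_dbarOp dbar h.2.conj
  have hc' : DCAt (fun y => dbarOp dbar y (D10.symbConj (Δ' y))) x := dcAt_dbarOp dbar h'.2.conj
  have hi : DCAt (fun y => deToDC dbar (iota dbar y (Δ y))) x := by
    simpa only [deToDC_iota] using h.iotaDC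
  have hi' : DCAt (fun y => deToDC dbar (iota dbar y (Δ' y))) x := by
    simpa only [deToDC_iota] using h'.iotaDC
  apply deToDC_injective
  rw [deToDC_add, deToDC_deBracket hi hi'.deToDC_I_smul, deToDC_deBracket hi.deToDC_I_smul hi']
  simp only [deToDC_iota, deToDC_I_smul_iota]
  simp only [iotaDC]
  rw [comm_const_smul_left _ (h.sub hc) (h'.add hc'),
    comm_const_smul_right _ (h.add hc) (h'.sub hc'),
    comm_add_left h hc (h'.sub hc'), comm_sub_right h h' hc', comm_sub_right hc h' hc',
    comm_sub_left h hc (h'.add hc'), comm_add_right h h' hc', comm_add_right hc h' hc',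
    comm_symbConj_symbConj h h', map_smul]
  have e : ∀ Δ : (D10 EX F V).Fib x, D10.symbConj ((2 : ℂ) • Δ) = (2 : ℂ) • D10.symbConj Δ :=
    fun Δ => Subtype.ext (by
      change cConj ((2 : ℂ) • (D10.val Δ).2) = (2 : ℂ) • cConj (D10.val Δ).2
      rw [cConj_smul, map_ofNat])
  rw [e, map_smul, incl10_proj10L_comm dbar h h']
  module

theorem deBracket_neg_left {D D' : ∀ y, (DE dbar).Fib y} (h : DCAt (fun y => deToDC dbar (D y)) x)
    (h' : DCAt (fun y => deToDC dbar (D' y)) x) :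
    deBracket dbar (fun y => -D y) D' x = -deBracket dbar D D' x := by
  simp only [deBracket, deToDC_neg]
  rw [comm_neg_left h h', map_neg, map_neg]

theorem deBracket_neg_right {D D' : ∀ y, (DE dbar).Fib y} (h : DCAt (fun y => deToDC dbar (D y)) x)
    (h' : DCAt (fun y => deToDC dbar (D' y)) x) :
    deBracket dbar D (fun y => -D' y) x = -deBracket dbar D D' x := by
  simp only [deBracket, deToDC_neg]
  rw [comm_neg_right h h', map_neg, map_neg]

/-- The bracket on (DE)^{1,0} is the one transported from D^{1,0}E, so its axioms are known; what
has to be checked is that it agrees with the complexified bracket of DE, separately in real and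
imaginary part. -/
theorem isOneZeroPart_transport (hvb : (D10 EX F V).IsVectorBundle EX)
    (hvb' : (DE dbar).IsVectorBundle EX) (hvb'' : (DE dbar).oneZero.IsVectorBundle EX) :
    (realAlgebroid dbar hvb').IsOneZeroPart ((algebroid10 dbar hvb).transport (oneZeroToD10 dbar)
      isBundleIso_oneZeroToD10 hvb'') := by
  refine ⟨fun x Θ => ?_, fun U hU s t hs ht x hx => ?_⟩
  · change symb (incl10 x (oneZeroToD10 dbar x Θ)) = _
    rw [incl10_oneZeroToD10]
    apply complexified_ext
    · rw [cRe_baseChange]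
      change cRe ((1 : ℂ) ⊗ₜ[ℝ] (DE.val _).2 + Complex.I • ((1 : ℂ) ⊗ₜ[ℝ] (DE.val _).2))
        = (DE.val _).2
      simp
    · rw [cIm_baseChange]
      change cIm ((1 : ℂ) ⊗ₜ[ℝ] (DE.val _).2 + Complex.I • ((1 : ℂ) ⊗ₜ[ℝ] (DE.val _).2))
        = (DE.val _).2
      simp
  · set Δ : ∀ y, (D10 EX F V).Fib y := fun y => (iota dbar y).symm (oneZeroEquiv (DE dbar) y (s y))
      with hΔ
    set Δ' : ∀ y, (D10 EX F V).Fib y := fun y => (iota dbar y).symm (oneZeroEquiv (DE dbar) y (t y))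
      with hΔ'
    have hsR : ∀ y, cRe ((s y).1 : ℂ ⊗[ℝ] (DE dbar).Fib y) = iota dbar y (Δ y) := fun y =>
      ((iota dbar y).apply_symm_apply _).symm
    have htR : ∀ y, cRe ((t y).1 : ℂ ⊗[ℝ] (DE dbar).Fib y) = iota dbar y (Δ' y) := fun y =>
      ((iota dbar y).apply_symm_apply _).symm
    have hsI : ∀ y, cIm ((s y).1 : ℂ ⊗[ℝ] (DE dbar).Fib y) = -(Complex.I • iota dbar y (Δ y)) :=
      fun y => by rw [cIm_oneZero, ← hsR, oneZeroEquiv_apply]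
    have htI : ∀ y, cIm ((t y).1 : ℂ ⊗[ℝ] (DE dbar).Fib y) = -(Complex.I • iota dbar y (Δ' y)) :=
      fun y => by rw [cIm_oneZero, ← htR, oneZeroEquiv_apply]
    have h : DCAt (fun y => incl10 y (Δ y)) x :=
      (d10_isSmooth_iff hU).1 ((isBundleIso_iota.symm U hU _).1 hs.1) x hx
    have h' : DCAt (fun y => incl10 y (Δ' y)) x :=
      (d10_isSmooth_iff hU).1 ((isBundleIso_iota.symm U hU _).1 ht.1) x hx
    have hi : DCAt (fun y => deToDC dbar (iota dbar y (Δ y))) x := by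
      simpa only [deToDC_iota] using h.iotaDC
    have hi' : DCAt (fun y => deToDC dbar (iota dbar y (Δ' y))) x := by
      simpa only [deToDC_iota] using h'.iotaDC
    set B := (2 : ℂ) • proj10L dbar x (comm (fun y => incl10 y (Δ y)) (fun y => incl10 y (Δ' y)) x)
      with hB
    set Θ := ((algebroid10 dbar hvb).transport (oneZeroToD10 dbar)
      isBundleIso_oneZeroToD10 hvb'').bracket s t x with hΘ
    -- The isomorphism with D^{1,0}E is 2ι⁻¹ of the real part, and [2Δ, 2Δ'] = 4[Δ, Δ'] = 2B; so the
    -- real part of the transported bracket is ι(B).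
    have hBr : oneZeroEquiv (DE dbar) x Θ = iota dbar x B := by
      have h1 : oneZeroToD10 dbar x Θ = (2 : ℂ) • B := by
        refine ((oneZeroToD10 dbar x).apply_symm_apply _).trans ?_
        change proj10L dbar x (comm (fun y => incl10 y ((2 : ℂ) • Δ y))
          (fun y => incl10 y ((2 : ℂ) • Δ' y)) x) = _
        simp only [map_smul (incl10 _)]
        rw [comm_const_smul_left _ h (h'.const_smul _), comm_const_smul_right _ h h', map_smul,
          map_smul]
      rw [oneZeroToD10_apply] at h1
      rw [← smul_right_injective _ (two_ne_zero (α := ℂ)) h1, LinearEquiv.apply_symm_apply]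
    change (Θ.1 : ℂ ⊗[ℝ] (DE dbar).Fib x) = cBracket (deBracket dbar) _ _ x
    unfold cBracket
    simp only [hsR, htR, hsI, htI]
    rw [deBracket_neg_left hi.deToDC_I_smul (by
        simpa only [deToDC_neg] using hi'.deToDC_I_smul.neg),
      deBracket_neg_right hi.deToDC_I_smul hi'.deToDC_I_smul, neg_neg, deBracket_iota_sub h h',
      deBracket_neg_right hi hi'.deToDC_I_smul, deBracket_neg_left hi.deToDC_I_smul hi', ← neg_add,
      deBracket_iota_add h h', ← hB, ← hBr]
    apply complexified_ext
    · simp [oneZeroEquiv_apply]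
    · rw [cIm_oneZero]
      simp

end OneZeroPart

end HolGauge

end

/-! ### The lemma and the corollary assembled. -/

theorem mainTheorem10
    {EX : Type*} [NormedAddCommGroup EX] [NormedSpace ℂ EX] [FiniteDimensional ℂ EX]
    {M : Type*} [TopologicalSpace M] [T2Space M] [ChartedSpace EX M] [IsManifold 𝓘(ℂ, EX) ω M]
    {F : Type*} [NormedAddCommGroup F] [NormedSpace ℂ F] [FiniteDimensional ℂ F]
    {V : M → Type*} [TopologicalSpace (TotalSpace F V)]
    [∀ x, AddCommGroup (V x)] [∀ x, Module ℂ (V x)] [∀ x, TopologicalSpace (V x)]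
    [FiberBundle F V] [VectorBundle ℂ F V] [ContMDiffVectorBundle ∞ F V 𝓘(ℝ, EX)]
    (dbar : DbarConnection EX (vecBundle EX F V)) :
    -- the holomorphic structure and the complex Lie algebroid structure of `D^{1,0} E`
    ∃ (nb : DbarConnection EX (D10 EX F V)) (CD : ComplexLieAlgebroid EX (D10 EX F V)),
      (∀ U : Set M, IsOpen U → ∀ (ζ : ∀ y, T01 EX y) (Δ : ∀ y, (D10 EX F V).Fib y),
        SmoothCVF EX U (fun y => (ζ y : CT EX y)) → (D10 EX F V).IsSmooth U Δ → ∀ x ∈ U,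
          ∃ B : DCfib EX F V x,
            IsCommC (fun y => (dbarOp dbar y (ζ y)).1) (fun y => D10.val (Δ y)) x B.1 ∧
            nb.toFun Δ x (ζ x) = proj10 dbar x B) ∧
      (∀ (x : M) (Δ : (D10 EX F V).Fib x), CD.anchor x Δ = (D10.val Δ).2) ∧
      (∀ U : Set M, IsOpen U → ∀ Δ Δ' : (∀ y, (D10 EX F V).Fib y),
        (D10 EX F V).IsSmooth U Δ → (D10 EX F V).IsSmooth U Δ' → ∀ x ∈ U,
          IsCommC (fun y => D10.val (Δ y)) (fun y => D10.val (Δ' y)) x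
            (D10.val (CD.bracket Δ Δ' x))) ∧
    -- the real Lie algebroid structure on `DE` obtained by restriction from `D_ℝ E`
    ∃ R : RealLieAlgebroid EX (DE dbar),
      (∀ (x : M) (Δ : (DE dbar).Fib x), R.anchor x Δ = (DE.val Δ).2) ∧
      (∀ U : Set M, IsOpen U → ∀ Δ Δ' : (∀ y, (DE dbar).Fib y),
        (DE dbar).IsSmooth U Δ → (DE dbar).IsSmooth U Δ' → ∀ x ∈ U,
          IsCommR (fun y => DE.val (Δ y)) (fun y => DE.val (Δ' y)) x
            (DE.val (R.bracket Δ Δ' x))) ∧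
    -- the isomorphism `ι`
    ∃ ι : ∀ x, (D10 EX F V).Fib x ≃ₗ[ℂ] (DE dbar).Fib x,
      IsBundleIso ι ∧
      (∀ (x : M) (Δ : (D10 EX F V).Fib x) (e : Sec EX F V),
        (DE.val (ι x Δ)).1 e
          = (D10.val Δ).1 e + (dbarOp dbar x (D10.symbConj Δ)).1.1 e) ∧
      (∀ (x : M) (Δ : (D10 EX F V).Fib x),
        (DE.val (ι x Δ)).2 = (2 : ℝ) • cRe (D10.val Δ).2) ∧
      (∀ U : Set M, IsOpen U → ∀ Δ Δ' : (∀ y, (D10 EX F V).Fib y),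
        nb.IsHol U Δ → nb.IsHol U Δ' → ∀ x ∈ U,
          ι x (CD.bracket Δ Δ' x)
            = R.bracket (fun y => ι y (Δ y)) (fun y => ι y (Δ' y)) x) ∧
    -- the holomorphic Lie algebroid structure on `DE`
    ∃ H : HolLieAlgebroid EX (DE dbar),
      (∀ U : Set M, IsOpen U → ∀ Δ : (∀ y, (D10 EX F V).Fib y), (D10 EX F V).IsSmooth U Δ →
        ∀ x ∈ U, ∀ ξ : T01 EX x,
          H.dbar.toFun (fun y => ι y (Δ y)) x ξ = ι x (nb.toFun Δ x ξ)) ∧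
      H.IsUnderlyingReal R ∧
    -- its associated complex Lie algebroid `(DE)^{1,0}` is `D^{1,0} E`
    ∃ (C10 : ComplexLieAlgebroid EX (DE dbar).oneZero)
      (φ : ∀ x, (DE dbar).oneZero.Fib x ≃ₗ[ℂ] (D10 EX F V).Fib x),
      R.IsOneZeroPart C10 ∧
      (∀ (x : M) (Θ : (DE dbar).oneZero.Fib x) (e : Sec EX F V),
        (D10.val (φ x Θ)).1 e
          = (DE.val (cRe (Θ.1 : ℂ ⊗[ℝ] (DE dbar).Fib x))).1 e
            + Complex.I • (DE.val (cIm (Θ.1 : ℂ ⊗[ℝ] (DE dbar).Fib x))).1 e) ∧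
      C10.IsIso CD φ := by
  have hvb := isVectorBundle_D10 EX F V
  have hvb' : (DE dbar).IsVectorBundle EX := isVectorBundle_of_iso_D10 _ isBundleIso_iota.symm
  have hvb'' : (DE dbar).oneZero.IsVectorBundle EX :=
    isVectorBundle_of_iso_D10 _ isBundleIso_oneZeroToD10
  refine ⟨nabla dbar, algebroid10 dbar hvb, fun U hU ζ Δ hζ hΔ x hx => ?_, fun _ _ => rfl,
    fun U hU Δ Δ' hΔ hΔ' x hx => ?_, realAlgebroid dbar hvb', fun _ _ => rfl,
    fun U hU D D' hD hD' x hx => ?_, iota dbar, isBundleIso_iota, fun _ => val_iota_fst,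
    fun _ => val_iota_snd, fun U hU Δ Δ' hΔ hΔ' x hx => ?_, holAlgebroid dbar hvb hvb',
    fun U hU Δ hΔ x hx ξ => ?_, isUnderlyingReal_holAlgebroid hvb hvb',
    (algebroid10 dbar hvb).transport (oneZeroToD10 dbar) isBundleIso_oneZeroToD10 hvb'',
    oneZeroToD10 dbar, isOneZeroPart_transport hvb hvb' hvb'', fun x Θ e => ?_,
    (algebroid10 dbar hvb).isIso_transport isBundleIso_oneZeroToD10 hvb''⟩
  · have h1 := (smoothCVF_iff hU).1 hζ x hx
    have h2 := (d10_isSmooth_iff hU).1 hΔ x hx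
    exact ⟨_, isCommC_comm (dcAt_dbarOp dbar h1) h2, nablaFun_eq dbar h2 h1⟩
  · have h1 := (d10_isSmooth_iff hU).1 hΔ x hx
    have h2 := (d10_isSmooth_iff hU).1 hΔ' x hx
    have h := isCommC_comm h1 h2
    rw [← incl10_proj10L_comm dbar h1 h2] at h
    exact h
  · have h1 := (de_isSmooth_iff hU).1 hD x hx
    have h2 := (de_isSmooth_iff hU).1 hD' x hx
    have h := isCommC_comm h1 h2
    have hs := cIm_symb_comm h1 h2
    rw [← deToDC_deBracket h1 h2] at h hs
    refine ⟨h.1, ?_⟩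
    have h3 := congrArg cRe hs
    rw [symb_deToDC, cRe_tmul, cRe_tmul, Complex.one_re, one_smul, one_smul] at h3
    exact h3
  · obtain ⟨h1, h2⟩ := (isHol_nabla_iff hU).1 hΔ x hx
    obtain ⟨h1', h2'⟩ := (isHol_nabla_iff hU).1 hΔ' x hx
    exact iota_bracket h1 h1' h2.self_of_nhds h2'.self_of_nhds
  · change iota dbar x (nablaFun dbar (fun y => (iota dbar y).symm (iota dbar y (Δ y))) x ξ) = _
    simp only [LinearEquiv.symm_apply_apply]
    rfl
  · rw [val_eq_incl10, incl10_oneZeroToD10]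
    rfl
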